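/- **Model.** Let $K$ be a field. An algebraic RAM has a fixed finite number of standard registers, which hold integers of $O(\log n)$ bits ($n$ is the size parameter), and algebraic registers, which hold elements of $K$. The algebraic registers are divided into a read-only input space, a read/write output space, which has exactly the size of the output, and a read/write work space. Work and output registers are uninitialized unless stated otherwise. The time of a computation is its number of arithmetic operations (and zero tests, if the program uses any) on algebraic registers; operations on indices and copies are free. The space is the number of algebraic work registers. An algorithm is *in-place* if its space is $O(1)$. **Problems** (a polynomial of size $\ell$ has degree $<\ell$). For $f,g$ of size $n$: the full product $fg$, of size $2n-1$; the low short product $fg \bmod X^n$, of size $n$; the high short product $fg \operatorname{quo} X^n$, of size $n-1$. For $f,g$ of size $n$ and $h$ of size $n-1$, with $h$ initially stored in the $n-1$ low-order (resp. high-order) registers of the output space: the low-order half-additive full product $h+fg$ (resp. the high-order one, $X^nh+fg$). For $f$ of size $2n-1$ and $g$ of size $n$: the middle product $\big((fg)\operatorname{quo}X^{n-1}\big)\bmod X^n$, of size $n$. **Theorem.** Let $c\ge 0$ be a rational constant, and let ${\sf M}:\mathbb{N}\to\mathbb{R}$ be a time bound such that ${\sf M}(n)>0$ for $n \ge 1$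 and ${\sf M}(n)/n$ is non-decreasing. 1. Suppose that $n=o({\sf M}(n))$. From a full product algorithm with time $\le {\sf M}(n)$ and space $\le cn$ one can build in-place algorithms for the low-order and for the high-order half-additive full product with time $\le (2c+7){\sf M}(n)+o({\sf M}(n))$. 2. Suppose that $n=o({\sf M}(n))$. From a low (resp. high) short product algorithm with time $\le {\sf M}(n)$ and space $\le cn$ one can build an in-place algorithm for the same problem with time $\le (2c+5){\sf M}(n)+o({\sf M}(n))$. 3. From a middle product algorithm with time $\le {\sf M}(n)$ and space $\le cn$ one can build an in-place algorithm for the same problem with time $\le {\sf M}(n)\log_{\frac{c+2}{c+1}}(n)+e(n)$, where $e(n)=O({\sf M}(n)+n\log n)$; in particular $e(n)=O({\sf M}(n))$ as soon as $n\log n=O({\sf M}(n))$. If moreover ${\sf M}$ is polynomially superlinear, that is, if for some $\gamma>1$ the function ${\sf M}(n)/n^\gamma$ is non-decreasing up to a constant factor (for instance if ${\sf M}(n)=\Theta(n^\gamma)$), then the time of this algorithm is $O({\sf M}(n))$. In each part the built algorithm depends only on the given algorithm and on $c$, not on ${\sf M}$, and it performs only ring operations $+,-,\times$ on algebraic registers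 (no division, no zero test) if the given algorithm does so. -/

import Mathlib

open Polynomial Filter Asymptotics

/-! # An algebraic RAM with read-only input and read/write output space -/

namespace AlgRAM

/-- Index expressions over the standard (integer) registers; `reg x` is the content of the
standard register `x`.  Subtraction is truncated and division is rounded down. -/
inductive IExp : Type
  | lit (v : ℕ)
  | reg (x : ℕ)
  | add (a b : IExp)
  | sub (a b : IExp)
  | mul (a b : IExp)
  | div (a b : IExp)

/-- The value of an index expression. -/
def IExp.eval (r : ℕ → ℕ) : IExp → ℕ
  | .lit v => v
  | .reg x => r x
  | .add a b => a.eval r + b.eval r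
  | .sub a b => a.eval r - b.eval r
  | .mul a b => a.eval r * b.eval r
  | .div a b => a.eval r / b.eval r

/-- What can be read in the algebraic part of the machine: a register of one of the two inputs
(`false`: first input, `true`: second input), of the output space or of the work space, at an
address given by an index expression; or a constant of the program. -/
inductive Src (K : Type*)
  | input (side : Bool) (e : IExp)
  | out (e : IExp)
  | work (e : IExp)
  | const (a : K)

/-- What can be written in the algebraic part of the machine: a register of the output space or
of the work space. The input space is read-only. -/
inductive Dst : Type
  | out (e : IExp)
  | work (e : IExp)

/-- The arithmetic operations of the field. -/
inductive ArithOp : Type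
  | add
  | sub
  | mul
  | div

/-- The result of an arithmetic operation. -/
def ArithOp.apply {K : Type*} [Field K] : ArithOp → K → K → K
  | .add, a, b => a + b
  | .sub, a, b => a - b
  | .mul, a, b => a * b
  | .div, a, b => a / b

/-- Programs of the algebraic RAM, in structured form (no recursion). The standard registers are
addressed by name only, so that a program owns a number of standard registers that is fixed once
and for all; only the algebraic registers can be addressed indirectly. -/
inductive Program (K : Type*)
  /-- do nothing -/
  | skip
  /-- standard register `x` receives the value of `e` -/
  | assign (x : ℕ) (e : IExp)
  /-- copy an algebraic value -/
  | move (d : Dst) (s : Src K)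
  /-- perform an arithmetic operation on algebraic values -/
  | arith (op : ArithOp) (d : Dst) (s₁ s₂ : Src K)
  /-- sequence -/
  | seq (p q : Program K)
  /-- if `a < b` then `p` else `q`, for index expressions `a` and `b` -/
  | ifLt (a b : IExp) (p q : Program K)
  /-- while `a < b` do `p`, for index expressions `a` and `b` -/
  | whileLt (a b : IExp) (p : Program K)
  /-- if the algebraic value `s` is zero then `p` else `q` -/
  | ifZero (s : Src K) (p q : Program K)

/-- The program performs only ring operations (addition, subtraction, multiplication) on algebraic
registers: no division and no zero test. -/
def Program.RingOnly {K : Type*} : Program K → Prop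
  | .skip => True
  | .assign _ _ => True
  | .move _ _ => True
  | .arith op _ _ _ => op ≠ .div
  | .seq p q => p.RingOnly ∧ q.RingOnly
  | .ifLt _ _ p q => p.RingOnly ∧ q.RingOnly
  | .whileLt _ _ p => p.RingOnly
  | .ifZero _ _ _ => False

/-- What does not change during a computation: the contents of the two inputs, the sizes of the
input, output and work spaces, and a strict upper bound `word` on the integers that fit into a
standard register. -/
structure Env (K : Type*) where
  input : Bool → ℕ → K
  inputSize : Bool → ℕ
  outSize : ℕ
  workSize : ℕ
  word : ℕ

/-- The contents of the standard registers, of the output space and of the work space. -/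
structure State (K : Type*) where
  reg : ℕ → ℕ
  out : ℕ → K
  work : ℕ → K

/-- Reading; it fails outside the available space. -/
def Src.read {K : Type*} (E : Env K) (σ : State K) : Src K → Option K
  | .input b e => if e.eval σ.reg < E.inputSize b then some (E.input b (e.eval σ.reg)) else none
  | .out e => if e.eval σ.reg < E.outSize then some (σ.out (e.eval σ.reg)) else none
  | .work e => if e.eval σ.reg < E.workSize then some (σ.work (e.eval σ.reg)) else none
  | .const a => some a

/-- Writing the value `v`; it fails outside the available space. -/
def Dst.write {K : Type*} (E : Env K) (σ : State K) (v : K) : Dst → Option (State K)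
  | .out e =>
    if e.eval σ.reg < E.outSize then
      some { σ with out := Function.update σ.out (e.eval σ.reg) v } else none
  | .work e =>
    if e.eval σ.reg < E.workSize then
      some { σ with work := Function.update σ.work (e.eval σ.reg) v } else none

/-- `Exec E p σ t σ'`: in the environment `E`, the program `p` started in the state `σ` halts in
the state `σ'` without any access outside the available space and without overflow of a standard
register, and its cost is `t`. Each arithmetic operation and each zero test on algebraic values
has cost `1`; index computations, tests on indices and copies are free. -/
inductive Exec {K : Type*} [Field K] (E : Env K) : Program K → State K → ℕ → State K → Prop
  | skip (σ : State K) : Exec E .skip σ 0 σ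
  | assign (σ : State K) (x : ℕ) (e : IExp) (h : e.eval σ.reg < E.word) :
      Exec E (.assign x e) σ 0 { σ with reg := Function.update σ.reg x (e.eval σ.reg) }
  | move (σ σ' : State K) (d : Dst) (s : Src K) (v : K)
      (hs : s.read E σ = some v) (hd : d.write E σ v = some σ') :
      Exec E (.move d s) σ 0 σ'
  | arith (σ σ' : State K) (op : ArithOp) (d : Dst) (s₁ s₂ : Src K) (v₁ v₂ : K)
      (h₁ : s₁.read E σ = some v₁) (h₂ : s₂.read E σ = some v₂)
      (hd : d.write E σ (op.apply v₁ v₂) = some σ') :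
      Exec E (.arith op d s₁ s₂) σ 1 σ'
  | seq (σ σ₁ σ₂ : State K) (p q : Program K) (t₁ t₂ : ℕ)
      (hp : Exec E p σ t₁ σ₁) (hq : Exec E q σ₁ t₂ σ₂) :
      Exec E (.seq p q) σ (t₁ + t₂) σ₂
  | ifLt_true (σ σ' : State K) (a b : IExp) (p q : Program K) (t : ℕ)
      (h : a.eval σ.reg < b.eval σ.reg) (hp : Exec E p σ t σ') :
      Exec E (.ifLt a b p q) σ t σ'
  | ifLt_false (σ σ' : State K) (a b : IExp) (p q : Program K) (t : ℕ)
      (h : ¬ a.eval σ.reg < b.eval σ.reg) (hq : Exec E q σ t σ') :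
      Exec E (.ifLt a b p q) σ t σ'
  | whileLt_true (σ σ₁ σ₂ : State K) (a b : IExp) (p : Program K) (t₁ t₂ : ℕ)
      (h : a.eval σ.reg < b.eval σ.reg) (hp : Exec E p σ t₁ σ₁)
      (hw : Exec E (.whileLt a b p) σ₁ t₂ σ₂) :
      Exec E (.whileLt a b p) σ (t₁ + t₂) σ₂
  | whileLt_false (σ : State K) (a b : IExp) (p : Program K)
      (h : ¬ a.eval σ.reg < b.eval σ.reg) :
      Exec E (.whileLt a b p) σ 0 σ
  | ifZero_true (σ σ' : State K) (s : Src K) (p q : Program K) (t : ℕ)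
      (hs : s.read E σ = some 0) (hp : Exec E p σ t σ') :
      Exec E (.ifZero s p q) σ (t + 1) σ'
  | ifZero_false (σ σ' : State K) (s : Src K) (p q : Program K) (t : ℕ) (v : K)
      (hs : s.read E σ = some v) (hv : v ≠ 0) (hq : Exec E q σ t σ') :
      Exec E (.ifZero s p q) σ (t + 1) σ'

/-- A computational problem on polynomials, for each size parameter `n`: two input polynomials
`f` and `g` of sizes `sizeF n` and `sizeG n` are given in the input space, a polynomial `h` of size
`sizeH n` is given in the registers `offH n, …, offH n + sizeH n - 1` of the output space, and
the polynomial `result n f g h` of size `outSize n` has to be put into the output space. (For most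
problems `sizeH n = 0`, so that `h = 0` and nothing is given in the output space.) -/
structure Problem (K : Type*) [Field K] where
  sizeF : ℕ → ℕ
  sizeG : ℕ → ℕ
  sizeH : ℕ → ℕ
  offH : ℕ → ℕ
  outSize : ℕ → ℕ
  result : ℕ → K[X] → K[X] → K[X] → K[X]

/-- Low short product of two polynomials of size `n`. -/
noncomputable def spLow {K : Type*} [Field K] (n : ℕ) (f g : K[X]) : K[X] := (f * g) %ₘ X ^ n

/-- High short product of two polynomials of size `n`. -/
noncomputable def spHigh {K : Type*} [Field K] (n : ℕ) (f g : K[X]) : K[X] := (f * g) /ₘ X ^ n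

/-- Middle product of polynomials of sizes `n + m - 1` and `n`. -/
noncomputable def mp {K : Type*} [Field K] (n m : ℕ) (f g : K[X]) : K[X] :=
  ((f * g) /ₘ X ^ (n - 1)) %ₘ X ^ m

/-- The (balanced) full product `f * g`. -/
noncomputable def fullProduct (K : Type*) [Field K] : Problem K where
  sizeF n := n
  sizeG n := n
  sizeH _ := 0
  offH _ := 0
  outSize n := 2 * n - 1
  result _ f g _ := f * g

/-- The low-order half-additive full product `h + f * g`, with `h` initially in the `n - 1`
low-order registers of the output space. -/
noncomputable def halfAdditiveLow (K : Type*) [Field K] : Problem K where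
  sizeF n := n
  sizeG n := n
  sizeH n := n - 1
  offH _ := 0
  outSize n := 2 * n - 1
  result _ f g h := h + f * g

/-- The high-order half-additive full product `X ^ n * h + f * g`, with `h` initially in the
`n - 1` high-order registers of the output space. -/
noncomputable def halfAdditiveHigh (K : Type*) [Field K] : Problem K where
  sizeF n := n
  sizeG n := n
  sizeH n := n - 1
  offH n := n
  outSize n := 2 * n - 1
  result n f g h := X ^ n * h + f * g

/-- The low short product. -/
noncomputable def shortProductLow (K : Type*) [Field K] : Problem K where
  sizeF n := n
  sizeG n := n
  sizeH _ := 0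
  offH _ := 0
  outSize n := n
  result n f g _ := spLow n f g

/-- The high short product. -/
noncomputable def shortProductHigh (K : Type*) [Field K] : Problem K where
  sizeF n := n
  sizeG n := n
  sizeH _ := 0
  offH _ := 0
  outSize n := n - 1
  result n f g _ := spHigh n f g

/-- The (balanced) middle product. -/
noncomputable def middleProduct (K : Type*) [Field K] : Problem K where
  sizeF n := n + n - 1
  sizeG n := n
  sizeH _ := 0
  offH _ := 0
  outSize n := n
  result n f g _ := mp n n f g

/-- The environment in which a problem is solved in size `n` on the inputs `f` and `g`, with `w`
algebraic work registers and standard registers that hold integers `< B`. -/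
noncomputable def Problem.env {K : Type*} [Field K] (A : Problem K) (n : ℕ) (f g : K[X])
    (w B : ℕ) : Env K where
  input b i := if b then g.coeff i else f.coeff i
  inputSize b := if b then A.sizeG n else A.sizeF n
  outSize := A.outSize n
  workSize := w
  word := B

/-- `Solves p A s t`: the program `p` solves the problem `A`; in size `n` it uses at most `s n`
algebraic work registers and has cost at most `t n`.

The standard registers hold integers bounded by a polynomial in `n` (that is, of `O(log n)` bits).
Initially the standard register `0` contains `n` and the others contain `0`, whereas the work
space and the registers of the output space that are not part of the data are uninitialized. -/
def Solves {K : Type*} [Field K] (p : Program K) (A : Problem K) (s : ℕ → ℕ) (t : ℕ → ℝ) : Prop :=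
  ∃ d : ℕ, ∀ n : ℕ, 1 ≤ n → ∀ f g h : K[X],
    f.degree < A.sizeF n → g.degree < A.sizeG n → h.degree < A.sizeH n →
    ∀ out₀ work₀ : ℕ → K, (∀ i < A.sizeH n, out₀ (A.offH n + i) = h.coeff i) →
      ∃ (cost : ℕ) (σ' : State K),
        Exec (A.env n f g (s n) ((n + 2) ^ d)) p
          ⟨Function.update (fun _ => 0) 0 n, out₀, work₀⟩ cost σ' ∧
        (cost : ℝ) ≤ t n ∧
        ∀ i < A.outSize n, σ'.out i = (A.result n f g h).coeff i

/-- The usual regularity of a complexity function: `M n > 0` for `n ≥ 1`, and `M n / n` is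
non-decreasing. -/
def Regular (M : ℕ → ℝ) : Prop :=
  (∀ n, 1 ≤ n → 0 < M n) ∧ MonotoneOn (fun n : ℕ => M n / n) (Set.Ici 1)

/-- `M` grows polynomially faster than linearly: for some `γ > 1`, `M n / n ^ γ` is non-decreasing
up to a constant factor. -/
def PolynomiallySuperlinear (M : ℕ → ℝ) : Prop :=
  ∃ γ C : ℝ, 1 < γ ∧
    ∀ k n : ℕ, 1 ≤ k → k ≤ n → M k / (k : ℝ) ^ γ ≤ C * (M n / (n : ℝ) ^ γ)

end AlgRAM

open AlgRAM

set_option linter.unusedSectionVars false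

/-! The registers of the output space that do not yet hold final values serve as memory for the
given algorithm. When m registers are free, it is called on blocks of a size k proportional to m, so
small that its result and its c·k work registers fit into the free zone beside the k registers about
to be completed. Each result is added in its place; then m - k registers are free, and one starts
again. Below a constant threshold the rest is computed from the definition, with a single work
register. All parameters depend on c alone.

Half-additive product: once the first b coefficients of f and g are treated, the output holds fg + h
minus X^(2b) times the product of the two tails (`partialProduct`). This polynomial has size n + b -
1, so the top n - b registers are free. A step multiplies the next block of f by all remaining
blocks of g, and the next block of g by the remaining blocks of f after its own next block
(`partialProduct_step`): 2J+1 products for J+1 blocks.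

Low short product: the output is filled from the top in windows of size k. The contribution of one
block of f to a window splits into a low short product and a high one, and the latter is a low short
product of reversed blocks (`coeff_window_low`); again 2J+1 calls. Reversal also reduces the
high-order problems to the low-order ones.

Middle product: a window is a sum of ⌈n/k⌉ middle products of size k (`coeff_window_mid`).

Cost: for block sizes k ≤ n one has M(k) ≤ (M(n)/n)·k. In the first two problems the sizes k add up
to at most n, so the total is about (2J+1)·M(n), with J = ⌊c⌋+3 or ⌊c⌋+2. In the middle product each
window costs about M(n), and m shrinks by the factor (c+1)/(c+2), whence the logarithm; for
polynomially superlinear M the window costs form a geometric series.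

On the machine, a call is a copy of the program with redirected addresses. `Layout.Fits.exec_tr`
shows that it simulates the original at the same cost, and `Run.while` bounds the outer loops by a
potential function of m. -/

namespace AlgRAM

variable {K : Type*} [Field K]

/-! ### Registers used by a program -/

/-- A strict upper bound on the standard registers that occur in an index expression. -/
def IExp.bd : IExp → ℕ
  | .lit _ => 0
  | .reg x => x + 1
  | .add a b => max a.bd b.bd
  | .sub a b => max a.bd b.bd
  | .mul a b => max a.bd b.bd
  | .div a b => max a.bd b.bd

/-- A strict upper bound on the standard registers that occur in a source. -/
def Src.bd : Src K → ℕ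
  | .input _ e => e.bd
  | .out e => e.bd
  | .work e => e.bd
  | .const _ => 0

/-- A strict upper bound on the standard registers that occur in a destination. -/
def Dst.bd : Dst → ℕ
  | .out e => e.bd
  | .work e => e.bd

/-- A strict upper bound on the standard registers that occur in a program. -/
def Program.bd : Program K → ℕ
  | .skip => 0
  | .assign x e => max (x + 1) e.bd
  | .move d s => max d.bd s.bd
  | .arith _ d s₁ s₂ => max d.bd (max s₁.bd s₂.bd)
  | .seq p q => max p.bd q.bd
  | .ifLt a b p q => max (max a.bd b.bd) (max p.bd q.bd)
  | .whileLt a b p => max (max a.bd b.bd) p.bd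
  | .ifZero s p q => max s.bd (max p.bd q.bd)

theorem IExp.eval_congr {r r' : ℕ → ℕ} {R : ℕ} (h : ∀ x < R, r x = r' x) (e : IExp)
    (he : e.bd ≤ R) : e.eval r = e.eval r' := by
  induction e with
  | lit v => rfl
  | reg x => exact h x he
  | add a b iha ihb | sub a b iha ihb | mul a b iha ihb | div a b iha ihb =>
    simp only [IExp.bd, max_le_iff] at he
    simp only [IExp.eval, iha he.1, ihb he.2]

/-! ### Cells of the read/write memory -/

/-- The content of a cell: `(false, i)` is in the output space, `(true, i)` in the work space. -/
def State.get (σ : State K) (p : Bool × ℕ) : K := if p.1 then σ.work p.2 else σ.out p.2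

/-- The size of the output space (`false`) or of the work space (`true`). -/
def Env.size (E : Env K) (b : Bool) : ℕ := if b then E.workSize else E.outSize

/-- The cell with the given address, as a source. -/
def cellSrc (c : Bool × IExp) : Src K := if c.1 then .work c.2 else .out c.2

/-- The cell with the given address, as a destination. -/
def cellDst (c : Bool × IExp) : Dst := if c.1 then .work c.2 else .out c.2

/-- The state after writing `v` into a cell. -/
def State.set (σ : State K) (p : Bool × ℕ) (v : K) : State K :=
  if p.1 then { σ with work := Function.update σ.work p.2 v }
  else { σ with out := Function.update σ.out p.2 v }

theorem read_cellSrc (E : Env K) (σ : State K) (c : Bool × IExp) :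
    (cellSrc c).read E σ =
      if c.2.eval σ.reg < E.size c.1 then some (σ.get (c.1, c.2.eval σ.reg)) else none := by
  rcases c with ⟨_ | _, e⟩ <;> rfl

theorem write_cellDst (E : Env K) (σ : State K) (c : Bool × IExp) (v : K) :
    (cellDst c).write E σ v =
      if c.2.eval σ.reg < E.size c.1 then some (σ.set (c.1, c.2.eval σ.reg) v) else none := by
  rcases c with ⟨_ | _, e⟩ <;> rfl

theorem State.set_reg (σ : State K) (p : Bool × ℕ) (v : K) : (σ.set p v).reg = σ.reg := by
  rcases p with ⟨_ | _, i⟩ <;> rfl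

theorem State.get_set (σ : State K) (p q : Bool × ℕ) (v : K) :
    (σ.set p v).get q = if q = p then v else σ.get q := by
  rcases p with ⟨_ | _, i⟩ <;> rcases q with ⟨_ | _, j⟩ <;>
    simp [State.set, State.get, Function.update_apply]

/-! ### Moving a program to another place in memory -/

/-- Where the memory accesses of a program are redirected to. A read of an input at address `e`
is replaced by a read of an input guarded by a test on indices, the value being `0` if the test
fails; the output and work cells are moved. -/
structure Layout where
  inp : Bool → IExp → IExp × IExp × Bool × IExp
  cell : Bool → IExp → Bool × IExp

/-- The program that continues as `f` with the source that replaces `s`. -/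
def Layout.withSrc (Λ : Layout) (f : Src K → Program K) : Src K → Program K
  | .input b e => .ifLt (Λ.inp b e).1 (Λ.inp b e).2.1
      (f (.input (Λ.inp b e).2.2.1 (Λ.inp b e).2.2.2)) (f (.const 0))
  | .out e => f (cellSrc (Λ.cell false e))
  | .work e => f (cellSrc (Λ.cell true e))
  | .const a => f (.const a)

/-- The destination that replaces `d`. -/
def Layout.dst (Λ : Layout) : Dst → Dst
  | .out e => cellDst (Λ.cell false e)
  | .work e => cellDst (Λ.cell true e)

/-- The program with its memory accesses redirected. -/
def Layout.tr (Λ : Layout) : Program K → Program K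
  | .skip => .skip
  | .assign x e => .assign x e
  | .move d s => Λ.withSrc (fun s' => .move (Λ.dst d) s') s
  | .arith op d s₁ s₂ =>
    Λ.withSrc (fun s₁' => Λ.withSrc (fun s₂' => .arith op (Λ.dst d) s₁' s₂') s₂) s₁
  | .seq p q => .seq (Λ.tr p) (Λ.tr q)
  | .ifLt a b p q => .ifLt a b (Λ.tr p) (Λ.tr q)
  | .whileLt a b p => .whileLt a b (Λ.tr p)
  | .ifZero s p q => Λ.withSrc (fun s' => .ifZero s' (Λ.tr p) (Λ.tr q)) s

theorem Layout.ringOnly_withSrc (Λ : Layout) (f : Src K → Program K) (s : Src K)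
    (hf : ∀ s', (f s').RingOnly) : (Λ.withSrc f s).RingOnly := by
  cases s <;> simp [Layout.withSrc, Program.RingOnly, hf]

theorem Layout.ringOnly_tr (Λ : Layout) (p : Program K) (hp : p.RingOnly) :
    (Λ.tr p).RingOnly := by
  induction p with
  | skip => trivial
  | assign => trivial
  | move d s => exact Λ.ringOnly_withSrc _ _ fun _ => trivial
  | arith op d s₁ s₂ =>
    exact Λ.ringOnly_withSrc _ _ fun _ => Λ.ringOnly_withSrc _ _ fun _ => hp
  | seq p q ihp ihq => exact ⟨ihp hp.1, ihq hp.2⟩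
  | ifLt a b p q ihp ihq => exact ⟨ihp hp.1, ihq hp.2⟩
  | whileLt a b p ih => exact ih hp
  | ifZero => exact hp.elim

/-- The redirection `Λ` is correct between the environments `E` and `E'`, when the standard
registers `≥ R` have the same contents as in `r₀`; `loc` is the new place of each cell. -/
structure Layout.Fits (Λ : Layout) (R : ℕ) (E E' : Env K) (r₀ : ℕ → ℕ)
    (loc : Bool × ℕ → Bool × ℕ) : Prop where
  word : E.word ≤ E'.word
  inp : ∀ (r : ℕ → ℕ), (∀ x, R ≤ x → r x = r₀ x) → ∀ b (e : IExp), e.eval r < E.inputSize b →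
    if (Λ.inp b e).1.eval r < (Λ.inp b e).2.1.eval r then
      (Λ.inp b e).2.2.2.eval r < E'.inputSize (Λ.inp b e).2.2.1 ∧
      E'.input (Λ.inp b e).2.2.1 ((Λ.inp b e).2.2.2.eval r) = E.input b (e.eval r)
    else E.input b (e.eval r) = 0
  cell : ∀ (r : ℕ → ℕ), (∀ x, R ≤ x → r x = r₀ x) → ∀ b (e : IExp), e.eval r < E.size b →
    ((Λ.cell b e).1, (Λ.cell b e).2.eval r) = loc (b, e.eval r)
  size : ∀ p : Bool × ℕ, p.2 < E.size p.1 → (loc p).2 < E'.size (loc p).1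
  inj : ∀ p q : Bool × ℕ, p.2 < E.size p.1 → q.2 < E.size q.1 → loc p = loc q → p = q

/-- The state `τ` represents the state `σ` of the original program; outside the place of this
program it agrees with `τ₀`. -/
structure Represents (R : ℕ) (E : Env K) (loc : Bool × ℕ → Bool × ℕ) (τ₀ σ τ : State K) :
    Prop where
  low : ∀ x < R, τ.reg x = σ.reg x
  high : ∀ x, R ≤ x → τ.reg x = τ₀.reg x
  get : ∀ p : Bool × ℕ, p.2 < E.size p.1 → τ.get (loc p) = σ.get p
  frame : ∀ q, (∀ p : Bool × ℕ, p.2 < E.size p.1 → loc p ≠ q) → τ.get q = τ₀.get q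

variable {Λ : Layout} {R : ℕ} {E E' : Env K} {loc : Bool × ℕ → Bool × ℕ} {τ₀ σ τ : State K}

/-- Index tests are free, so a guarded read costs no more than the original one; if the guard fails,
`Fits` ensures that the value to be read is 0. In this way blocks that stick out of an input are
padded with zeros that are stored nowhere. -/
theorem Layout.Fits.exec_withSrc (hΛ : Λ.Fits R E E' τ₀.reg loc)
    (h : Represents R E loc τ₀ σ τ) {s : Src K} {v : K} (hs : s.read E σ = some v)
    (hR : s.bd ≤ R) {f : Src K → Program K} {t : ℕ} {τ' : State K}
    (hf : ∀ s' : Src K, s'.read E' τ = some v → Exec E' (f s') τ t τ') :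
    Exec E' (Λ.withSrc f s) τ t τ' := by
  have key : ∀ b (e : IExp), e.bd ≤ R →
      (if e.eval σ.reg < E.size b then some (σ.get (b, e.eval σ.reg)) else none) = some v →
      Exec E' (f (cellSrc (Λ.cell b e))) τ t τ' := by
    intro b e he hv
    split_ifs at hv with hlt
    have hev : e.eval τ.reg = e.eval σ.reg := IExp.eval_congr h.low e he
    have hc := hΛ.cell τ.reg h.high b e (by rwa [hev])
    have h1 : (Λ.cell b e).1 = (loc (b, e.eval τ.reg)).1 := congrArg Prod.fst hc
    have h2 : (Λ.cell b e).2.eval τ.reg = (loc (b, e.eval τ.reg)).2 := congrArg Prod.snd hc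
    apply hf
    rw [read_cellSrc, hc, hev, h.get _ hlt, if_pos]
    · exact hv
    · rw [h1, h2, hev]
      exact hΛ.size _ hlt
  cases s with
  | input b e =>
    have hev : e.eval τ.reg = e.eval σ.reg := IExp.eval_congr h.low e hR
    simp only [Src.read] at hs
    split_ifs at hs with hlt
    have hi := hΛ.inp τ.reg h.high b e (by rwa [hev])
    simp only [Option.some.injEq] at hs
    rw [hev, hs] at hi
    by_cases hg : (Λ.inp b e).1.eval τ.reg < (Λ.inp b e).2.1.eval τ.reg
    · rw [if_pos hg] at hi
      refine Exec.ifLt_true _ _ _ _ _ _ _ hg (hf _ ?_)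
      simp [Src.read, hi.1, hi.2]
    · rw [if_neg hg] at hi
      refine Exec.ifLt_false _ _ _ _ _ _ _ hg (hf _ ?_)
      simp [Src.read, hi]
  | out e => exact key false e hR hs
  | work e => exact key true e hR hs
  | const a => exact hf _ hs

/-- Injectivity of `loc` on the valid cells is what keeps the other cells of the simulated memory
intact. -/
theorem Layout.Fits.write_dst (hΛ : Λ.Fits R E E' τ₀.reg loc)
    (h : Represents R E loc τ₀ σ τ) {d : Dst} {v : K} {σ' : State K}
    (hd : d.write E σ v = some σ') (hR : d.bd ≤ R) :
    ∃ τ', (Λ.dst d).write E' τ v = some τ' ∧ Represents R E loc τ₀ σ' τ' := by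
  have key : ∀ b (e : IExp), e.bd ≤ R →
      (if e.eval σ.reg < E.size b then some (σ.set (b, e.eval σ.reg) v) else none) = some σ' →
      ∃ τ', (cellDst (Λ.cell b e)).write E' τ v = some τ' ∧ Represents R E loc τ₀ σ' τ' := by
    intro b e he hv
    split_ifs at hv with hlt
    have hev : e.eval τ.reg = e.eval σ.reg := IExp.eval_congr h.low e he
    have hc := hΛ.cell τ.reg h.high b e (by rwa [hev])
    have h1 : (Λ.cell b e).1 = (loc (b, e.eval τ.reg)).1 := congrArg Prod.fst hc
    have h2 : (Λ.cell b e).2.eval τ.reg = (loc (b, e.eval τ.reg)).2 := congrArg Prod.snd hc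
    rw [write_cellDst, hc, hev, if_pos (by rw [h1, h2, hev]; exact hΛ.size _ hlt)]
    simp only [Option.some.injEq] at hv
    subst hv
    refine ⟨_, rfl, ?_, ?_, ?_, ?_⟩
    · intro x hx
      rw [State.set_reg, State.set_reg, h.low x hx]
    · intro x hx
      rw [State.set_reg, h.high x hx]
    · intro p hp
      rw [State.get_set, State.get_set, h.get p hp]
      by_cases hpe : p = (b, e.eval σ.reg)
      · rw [if_pos hpe, if_pos (by rw [hpe])]
      · rw [if_neg hpe, if_neg fun hh => hpe (hΛ.inj _ _ hp hlt hh)]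
    · intro q hq
      rw [State.get_set, if_neg fun hh => hq _ hlt hh.symm, h.frame q hq]
  cases d with
  | out e => exact key false e hR hd
  | work e => exact key true e hR hd

/-- A redirected program simulates the original one, at the same cost. -/
theorem Layout.Fits.exec_tr (hΛ : Λ.Fits R E E' τ₀.reg loc) {p : Program K} {t : ℕ}
    {σ' : State K} (hp : Exec E p σ t σ') (hR : p.bd ≤ R) (h : Represents R E loc τ₀ σ τ) :
    ∃ τ', Exec E' (Λ.tr p) τ t τ' ∧ Represents R E loc τ₀ σ' τ' := by
  induction hp generalizing τ with
  | skip σ => exact ⟨τ, .skip τ, h⟩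
  | assign σ x e hlt =>
    simp only [Program.bd, max_le_iff] at hR
    have hev : e.eval τ.reg = e.eval σ.reg := IExp.eval_congr h.low e hR.2
    refine ⟨_, .assign τ x e (by rw [hev]; exact hlt.trans_le hΛ.word), ?_, ?_, h.get, h.frame⟩
    · intro y hy
      simp only [Function.update_apply, hev, h.low y hy]
    · intro y hy
      simp only
      rw [Function.update_of_ne (by omega), h.high y hy]
  | move σ σ' d s v hs hd =>
    simp only [Program.bd, max_le_iff] at hR
    obtain ⟨τ', hw, hr⟩ := hΛ.write_dst h hd hR.1
    exact ⟨τ', hΛ.exec_withSrc h hs hR.2 fun s' hs' => .move _ _ _ _ v hs' hw, hr⟩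
  | arith σ σ' op d s₁ s₂ v₁ v₂ h₁ h₂ hd =>
    simp only [Program.bd, max_le_iff] at hR
    obtain ⟨τ', hw, hr⟩ := hΛ.write_dst h hd hR.1
    exact ⟨τ', hΛ.exec_withSrc h h₁ hR.2.1 fun s₁' hs₁ =>
      hΛ.exec_withSrc h h₂ hR.2.2 fun s₂' hs₂ => .arith _ _ _ _ _ _ v₁ v₂ hs₁ hs₂ hw, hr⟩
  | seq σ σ₁ σ₂ p q t₁ t₂ hp hq ihp ihq =>
    simp only [Program.bd, max_le_iff] at hR
    obtain ⟨τ₁, e₁, h₁⟩ := ihp hR.1 h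
    obtain ⟨τ₂, e₂, h₂⟩ := ihq hR.2 h₁
    exact ⟨τ₂, .seq _ _ _ _ _ _ _ e₁ e₂, h₂⟩
  | ifLt_true σ σ' a b p q t hlt hp ih =>
    simp only [Program.bd, max_le_iff] at hR
    obtain ⟨τ₁, e₁, h₁⟩ := ih hR.2.1 h
    refine ⟨τ₁, .ifLt_true _ _ _ _ _ _ _ ?_ e₁, h₁⟩
    rwa [IExp.eval_congr h.low a hR.1.1, IExp.eval_congr h.low b hR.1.2]
  | ifLt_false σ σ' a b p q t hlt hp ih =>
    simp only [Program.bd, max_le_iff] at hR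
    obtain ⟨τ₁, e₁, h₁⟩ := ih hR.2.2 h
    refine ⟨τ₁, .ifLt_false _ _ _ _ _ _ _ ?_ e₁, h₁⟩
    rwa [IExp.eval_congr h.low a hR.1.1, IExp.eval_congr h.low b hR.1.2]
  | whileLt_true σ σ₁ σ₂ a b p t₁ t₂ hlt hp hw ihp ihw =>
    have hR' := hR
    simp only [Program.bd, max_le_iff] at hR'
    obtain ⟨τ₁, e₁, h₁⟩ := ihp hR'.2 h
    obtain ⟨τ₂, e₂, h₂⟩ := ihw hR h₁
    refine ⟨τ₂, .whileLt_true _ _ _ _ _ _ _ _ ?_ e₁ e₂, h₂⟩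
    rwa [IExp.eval_congr h.low a hR'.1.1, IExp.eval_congr h.low b hR'.1.2]
  | whileLt_false σ a b p hlt =>
    simp only [Program.bd, max_le_iff] at hR
    refine ⟨τ, .whileLt_false _ _ _ _ ?_, h⟩
    rwa [IExp.eval_congr h.low a hR.1.1, IExp.eval_congr h.low b hR.1.2]
  | ifZero_true σ σ' s p q t hs hp ih =>
    simp only [Program.bd, max_le_iff] at hR
    obtain ⟨τ₁, e₁, h₁⟩ := ih hR.2.1 h
    exact ⟨τ₁, hΛ.exec_withSrc h hs hR.1 fun s' hs' => .ifZero_true _ _ _ _ _ _ hs' e₁, h₁⟩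
  | ifZero_false σ σ' s p q t v hs hv hp ih =>
    simp only [Program.bd, max_le_iff] at hR
    obtain ⟨τ₁, e₁, h₁⟩ := ih hR.2.2 h
    exact ⟨τ₁, hΛ.exec_withSrc h hs hR.1 fun s' hs' => .ifZero_false _ _ _ _ _ _ v hs' hv e₁, h₁⟩

/-! ### Bounded runs -/

/-- From the state `σ` the program halts with cost at most `t` in a state that satisfies `Q`. -/
def Run (E : Env K) (p : Program K) (σ : State K) (t : ℝ) (Q : State K → Prop) : Prop :=
  ∃ (cost : ℕ) (σ' : State K), Exec E p σ cost σ' ∧ (cost : ℝ) ≤ t ∧ Q σ'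

theorem Run.mono {p : Program K} {t t' : ℝ} {Q Q' : State K → Prop}
    (h : Run E p σ t Q) (ht : t ≤ t') (hQ : ∀ σ', Q σ' → Q' σ') : Run E p σ t' Q' := by
  obtain ⟨c, σ', h1, h2, h3⟩ := h
  exact ⟨c, σ', h1, h2.trans ht, hQ _ h3⟩

theorem Run.skip {Q : State K → Prop} (h : Q σ) : Run E .skip σ 0 Q :=
  ⟨0, σ, .skip σ, by simp, h⟩

theorem Run.assign {x : ℕ} {e : IExp} {Q : State K → Prop} (he : e.eval σ.reg < E.word)
    (h : Q { σ with reg := Function.update σ.reg x (e.eval σ.reg) }) :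
    Run E (.assign x e) σ 0 Q :=
  ⟨0, _, .assign σ x e he, by simp, h⟩

theorem Run.seq {p q : Program K} {t₁ t₂ : ℝ} {Q₁ Q₂ : State K → Prop}
    (hp : Run E p σ t₁ Q₁) (hq : ∀ σ₁, Q₁ σ₁ → Run E q σ₁ t₂ Q₂) :
    Run E (.seq p q) σ (t₁ + t₂) Q₂ := by
  obtain ⟨c₁, σ₁, e₁, l₁, h₁⟩ := hp
  obtain ⟨c₂, σ₂, e₂, l₂, h₂⟩ := hq σ₁ h₁
  exact ⟨c₁ + c₂, σ₂, .seq _ _ _ _ _ _ _ e₁ e₂, by push_cast; linarith, h₂⟩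

theorem Run.assign_seq {x : ℕ} {e : IExp} {p : Program K} {t : ℝ} {Q : State K → Prop}
    (he : e.eval σ.reg < E.word)
    (h : Run E p { σ with reg := Function.update σ.reg x (e.eval σ.reg) } t Q) :
    Run E (.seq (.assign x e) p) σ t Q := by
  have := Run.seq (Run.assign (Q := fun σ' => σ' =
    { σ with reg := Function.update σ.reg x (e.eval σ.reg) }) he rfl) (fun σ₁ h₁ => h₁ ▸ h)
  rwa [zero_add] at this

theorem Run.ifLt {a b : IExp} {p q : Program K} {t : ℝ} {Q : State K → Prop}
    (hp : a.eval σ.reg < b.eval σ.reg → Run E p σ t Q)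
    (hq : ¬ a.eval σ.reg < b.eval σ.reg → Run E q σ t Q) : Run E (.ifLt a b p q) σ t Q := by
  by_cases h : a.eval σ.reg < b.eval σ.reg
  · obtain ⟨c, σ', e, l, h'⟩ := hp h
    exact ⟨c, σ', .ifLt_true _ _ _ _ _ _ _ h e, l, h'⟩
  · obtain ⟨c, σ', e, l, h'⟩ := hq h
    exact ⟨c, σ', .ifLt_false _ _ _ _ _ _ _ h e, l, h'⟩

/-- A loop with an invariant indexed by a decreasing measure `m`; `Φ m` bounds the remaining
cost. -/
theorem Run.while {a b : IExp} {p : Program K} {Φ : ℕ → ℝ} {Inv : ℕ → State K → Prop}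
    {Q : State K → Prop}
    (hstep : ∀ m σ, Inv m σ → a.eval σ.reg < b.eval σ.reg →
      ∃ m' < m, ∃ t, t + Φ m' ≤ Φ m ∧ Run E p σ t (Inv m'))
    (hend : ∀ m σ, Inv m σ → ¬ a.eval σ.reg < b.eval σ.reg → 0 ≤ Φ m ∧ Q σ)
    (m : ℕ) (h : Inv m σ) : Run E (.whileLt a b p) σ (Φ m) Q := by
  induction m using Nat.strong_induction_on generalizing σ with
  | _ m ih =>
    by_cases hlt : a.eval σ.reg < b.eval σ.reg
    · obtain ⟨m', hm, t, ht, c₁, σ₁, e₁, l₁, h₁⟩ := hstep m σ h hlt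
      obtain ⟨c₂, σ₂, e₂, l₂, h₂⟩ := ih m' hm h₁
      exact ⟨c₁ + c₂, σ₂, .whileLt_true _ _ _ _ _ _ _ _ hlt e₁ e₂, by push_cast; linarith, h₂⟩
    · obtain ⟨h0, hQ⟩ := hend m σ h hlt
      exact ⟨0, σ, .whileLt_false _ _ _ _ hlt, by simpa using h0, hQ⟩

/-- `for x := 0` to `N - 1` do `p`. -/
def forUp (x : ℕ) (N : IExp) (p : Program K) : Program K :=
  .seq (.assign x (.lit 0)) (.whileLt (.reg x) N (.seq p (.assign x (.add (.reg x) (.lit 1)))))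

theorem ringOnly_forUp {x : ℕ} {N : IExp} {p : Program K} (hp : p.RingOnly) :
    (forUp x N p).RingOnly := ⟨trivial, hp, trivial⟩

/-- The rule for counting loops. -/
theorem Run.forUp {x : ℕ} {e : IExp} {p : Program K} {N : ℕ} {t : ℝ}
    {Inv : ℕ → State K → Prop} (hN : N < E.word)
    (he : ∀ j σ, Inv j σ → σ.reg x = j → e.eval σ.reg = N)
    (h0 : Inv 0 { σ with reg := Function.update σ.reg x 0 })
    (hstep : ∀ j σ, j < N → Inv j σ → σ.reg x = j → Run E p σ t (fun σ' => σ'.reg x = j ∧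
      Inv (j + 1) { σ' with reg := Function.update σ'.reg x (j + 1) })) :
    Run E (forUp x e p) σ (N * t) (fun σ' => Inv N σ') := by
  refine Run.assign_seq (by simp only [IExp.eval]; omega) ?_
  refine (Run.while (Φ := fun m : ℕ => m * t) (Q := fun σ' => Inv N σ')
    (Inv := fun m σ => m ≤ N ∧ Inv (N - m) σ ∧ σ.reg x = N - m) ?_ ?_ N ?_).mono le_rfl
    fun _ h => h
  · rintro m σ ⟨hm, hI, hx⟩ hlt
    rw [he _ _ hI hx] at hlt
    simp only [IExp.eval, hx] at hlt
    refine ⟨m - 1, by omega, t, ?_, ?_⟩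
    · rw [Nat.cast_sub (by omega)]
      push_cast
      linarith
    · refine ((hstep (N - m) σ hlt hI hx).seq (t₂ := 0) fun σ₁ h₁ => ?_).mono (by simp)
        fun _ h => h
      refine Run.assign (by simp only [IExp.eval, h₁.1]; omega) ?_
      simp only [IExp.eval, h₁.1, Function.update_self]
      have : N - (m - 1) = N - m + 1 := by omega
      exact ⟨by omega, by rw [this]; exact h₁.2, by omega⟩
  · rintro m σ ⟨hm, hI, hx⟩ hlt
    rw [he _ _ hI hx] at hlt
    simp only [IExp.eval, hx] at hlt
    have : m = 0 := by omega
    subst this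
    exact ⟨by simp, by simpa using hI⟩
  · simpa [IExp.eval] using h0

/-! ### Calling a program as a subroutine -/

/-- Set the standard registers `1, …, R - 1` to `0`. -/
def clearRegs : ℕ → Program K
  | 0 => .skip
  | R + 1 => .seq (clearRegs R) (if R = 0 then .skip else .assign R (.lit 0))

theorem ringOnly_clearRegs (R : ℕ) : (clearRegs R : Program K).RingOnly := by
  induction R with
  | zero => trivial
  | succ R ih =>
    refine ⟨ih, ?_⟩
    split_ifs <;> trivial

theorem Run.clearRegs (R : ℕ) (hw : 0 < E.word) :
    Run E (clearRegs R) σ 0 (fun σ' => σ' =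
      { σ with reg := fun x => if 0 < x ∧ x < R then 0 else σ.reg x }) := by
  induction R with
  | zero => exact Run.skip (by simp)
  | succ R ih =>
    rw [← add_zero (0 : ℝ)]
    refine ih.seq fun σ₁ h₁ => ?_
    subst h₁
    split_ifs with hR
    · refine Run.skip ?_
      subst hR
      congr 1
      funext x
      rw [if_neg (by omega), if_neg (by omega)]
    · refine Run.assign hw ?_
      simp only [IExp.eval]
      congr 1
      funext x
      rw [Function.update_apply]
      split_ifs <;> first | rfl | omega

/-- Run the redirected program `p`, which owns the standard registers `< R`, in size `k`. -/
def callProg (Λ : Layout) (R : ℕ) (p : Program K) (k : IExp) : Program K :=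
  .seq (.assign 0 k) (.seq (clearRegs R) (Λ.tr p))

theorem ringOnly_callProg {p : Program K} (hp : p.RingOnly) (Λ : Layout) (R : ℕ) (k : IExp) :
    (callProg Λ R p k).RingOnly :=
  ⟨trivial, ringOnly_clearRegs R, Λ.ringOnly_tr p hp⟩

/-- The subroutine starts on whatever its cells happen to contain. This is harmless because
`SolvesAt` quantifies over the initial contents of both spaces; only the standard registers have to
be reset. Registers from `R` on belong to the caller and survive the call. -/
theorem Run.call {p : Program K} {kE : IExp} {k : ℕ} {t : ℝ} {Q : State K → Prop}
    (hΛ : Λ.Fits R E E' τ.reg loc) (hpR : p.bd ≤ R) (hR : 0 < R)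
    (hk : kE.eval τ.reg = k) (hkw : k < E'.word)
    (hp : Run E p ⟨Function.update (fun _ => 0) 0 k, fun i => τ.get (loc (false, i)),
      fun i => τ.get (loc (true, i))⟩ t Q) :
    Run E' (callProg Λ R p kE) τ t (fun τ' => (∀ x, R ≤ x → τ'.reg x = τ.reg x) ∧
      (∀ q, (∀ p : Bool × ℕ, p.2 < E.size p.1 → loc p ≠ q) → τ'.get q = τ.get q) ∧
      ∃ σ', Q σ' ∧ ∀ p : Bool × ℕ, p.2 < E.size p.1 → τ'.get (loc p) = σ'.get p) := by
  obtain ⟨c, σ', he, hc, hQ⟩ := hp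
  refine Run.assign_seq (by rwa [hk]) ?_
  rw [hk, ← zero_add t]
  refine (Run.clearRegs R (by omega)).seq fun τ₁ h₁ => ?_
  have hrep : Represents R E loc τ ⟨Function.update (fun _ => 0) 0 k,
      fun i => τ.get (loc (false, i)), fun i => τ.get (loc (true, i))⟩ τ₁ := by
    subst h₁
    refine ⟨?_, ?_, ?_, ?_⟩
    · intro x hx
      rcases Nat.eq_zero_or_pos x with rfl | h0
      · simp
      · simp [h0, hx, Function.update_of_ne h0.ne']
    · intro x hx
      simp only
      rw [if_neg (by omega), Function.update_of_ne (by omega)]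
    · rintro ⟨_ | _, i⟩ _ <;> rfl
    · intro q _
      rfl
  obtain ⟨τ', he', hr⟩ := hΛ.exec_tr he hpR hrep
  exact ⟨c, τ', he', hc, hr.high, hr.frame, σ', hQ, hr.get⟩

/-! ### Elementary loops on the output space -/

/-- Set `len` output registers to `0`, from the address `a` on. -/
def zeroOut (x : ℕ) (a len : IExp) : Program K :=
  forUp x len (.move (.out (.add a (.reg x))) (.const 0))

/-- Add `len` output registers, from the address `s` on, to those from the address `a` on. -/
def addOut (x : ℕ) (a s len : IExp) : Program K :=
  forUp x len (.arith .add (.out (.add a (.reg x))) (.out (.add a (.reg x)))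
    (.out (.add s (.reg x))))

/-- Add products of input coefficients to output registers. -/
def mulAdd (x : ℕ) (len : IExp) (b₁ b₂ : Bool) (e₁ e₂ y : IExp) : Program K :=
  forUp x len (.seq (.arith .mul (.work (.lit 0)) (.input b₁ e₁) (.input b₂ e₂))
    (.arith .add (.out y) (.out y) (.work (.lit 0))))

theorem ringOnly_zeroOut (x : ℕ) (a len : IExp) : (zeroOut x a len : Program K).RingOnly :=
  ringOnly_forUp trivial

theorem ringOnly_addOut (x : ℕ) (a s len : IExp) : (addOut x a s len : Program K).RingOnly :=
  ringOnly_forUp (by simp [Program.RingOnly])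

theorem ringOnly_mulAdd (x : ℕ) (len : IExp) (b₁ b₂ : Bool) (e₁ e₂ y : IExp) :
    (mulAdd x len b₁ b₂ e₁ e₂ y : Program K).RingOnly :=
  ringOnly_forUp (by simp [Program.RingOnly])

theorem Run.zeroOut {x : ℕ} {aE len : IExp} {a N : ℕ}
    (ha : ∀ r : ℕ → ℕ, (∀ y, y ≠ x → r y = σ.reg y) → aE.eval r = a)
    (hN : ∀ r : ℕ → ℕ, (∀ y, y ≠ x → r y = σ.reg y) → len.eval r = N)
    (hw : N < E.word) (hout : a + N ≤ E.outSize) :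
    Run E (zeroOut x aE len) σ 0 (fun σ' => (∀ y, y ≠ x → σ'.reg y = σ.reg y) ∧
      ∀ i, σ'.out i = if a ≤ i ∧ i < a + N then 0 else σ.out i) := by
  rw [← mul_zero (N : ℝ)]
  refine Run.forUp (Inv := fun j σ' => (∀ y, y ≠ x → σ'.reg y = σ.reg y) ∧
      ∀ i, σ'.out i = if a ≤ i ∧ i < a + j then 0 else σ.out i) hw ?_ ?_ ?_
  · rintro j σ' ⟨h, _⟩ _
    exact hN _ h
  · refine ⟨fun y hy => by simp [Function.update_of_ne hy], fun i => ?_⟩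
    rw [if_neg (by omega)]
  · rintro j σ' hj ⟨h, ho⟩ hx
    refine ⟨0, { σ' with out := Function.update σ'.out (a + j) 0 },
      .move _ _ _ _ 0 rfl ?_, by simp, ?_⟩
    · simp only [Dst.write, IExp.eval, ha _ h, hx]
      rw [if_pos (by omega)]
    · refine ⟨hx, fun y hy => ?_, fun i => ?_⟩
      · simp only [Function.update_of_ne hy, h y hy]
      · simp only [Function.update_apply, ho]
        split_ifs <;> first | rfl | omega

/-- The constraints on the target are required only for a nonempty range, since a block product
whose place lies beyond the useful zone is given length 0 at an arbitrary address. -/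
theorem Run.addOut {x : ℕ} {aE sE len : IExp} {a s N : ℕ}
    (ha : ∀ r : ℕ → ℕ, (∀ y, y ≠ x → r y = σ.reg y) → aE.eval r = a)
    (hs : ∀ r : ℕ → ℕ, (∀ y, y ≠ x → r y = σ.reg y) → sE.eval r = s)
    (hN : ∀ r : ℕ → ℕ, (∀ y, y ≠ x → r y = σ.reg y) → len.eval r = N)
    (hw : N < E.word) (hout : 0 < N → a + N ≤ E.outSize) (hsrc : s + N ≤ E.outSize)
    (hdis : 0 < N → a + N ≤ s ∨ s + N ≤ a) :
    Run E (addOut x aE sE len) σ N (fun σ' => (∀ y, y ≠ x → σ'.reg y = σ.reg y) ∧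
      ∀ i, σ'.out i = if a ≤ i ∧ i < a + N then σ.out i + σ.out (s + (i - a)) else σ.out i) := by
  rw [← mul_one (N : ℝ)]
  refine Run.forUp (Inv := fun j σ' => (∀ y, y ≠ x → σ'.reg y = σ.reg y) ∧
      ∀ i, σ'.out i = if a ≤ i ∧ i < a + j then σ.out i + σ.out (s + (i - a)) else σ.out i)
    hw ?_ ?_ ?_
  · rintro j σ' ⟨h, _⟩ _
    exact hN _ h
  · refine ⟨fun y hy => by simp [Function.update_of_ne hy], fun i => ?_⟩
    rw [if_neg (by omega)]
  · rintro j σ' hj ⟨h, ho⟩ hx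
    refine ⟨1, { σ' with out := Function.update σ'.out (a + j) (σ'.out (a + j) + σ'.out (s + j)) },
      .arith _ _ _ _ _ _ (σ'.out (a + j)) (σ'.out (s + j)) ?_ ?_ ?_, by simp, ?_⟩
    · simp only [Src.read, IExp.eval, ha _ h, hx]
      rw [if_pos (by omega)]
    · simp only [Src.read, IExp.eval, hs _ h, hx]
      rw [if_pos (by omega)]
    · simp only [Dst.write, IExp.eval, ha _ h, hx, ArithOp.apply]
      rw [if_pos (by omega)]
    · refine ⟨hx, fun y hy => ?_, fun i => ?_⟩
      · simp only [Function.update_of_ne hy, h y hy]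
      · simp only [Function.update_apply]
        by_cases hi : i = a + j
        · rw [if_pos hi, if_pos (by omega), ho, ho, if_neg (by omega), if_neg (by omega), hi,
            Nat.add_sub_cancel_left]
        · rw [if_neg hi, ho]
          split_ifs <;> first | rfl | omega

theorem Run.mulAdd {x : ℕ} {len e₁ e₂ yE : IExp} {b₁ b₂ : Bool} {N : ℕ} {α β y : ℕ → ℕ}
    (hN : ∀ r : ℕ → ℕ, (∀ y, y ≠ x → r y = σ.reg y) → len.eval r = N)
    (h₁ : ∀ r : ℕ → ℕ, (∀ y, y ≠ x → r y = σ.reg y) → r x < N → e₁.eval r = α (r x))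
    (h₂ : ∀ r : ℕ → ℕ, (∀ y, y ≠ x → r y = σ.reg y) → r x < N → e₂.eval r = β (r x))
    (hy : ∀ r : ℕ → ℕ, (∀ y, y ≠ x → r y = σ.reg y) → r x < N → yE.eval r = y (r x))
    (hα : ∀ i < N, α i < E.inputSize b₁) (hβ : ∀ i < N, β i < E.inputSize b₂)
    (hyo : ∀ i < N, y i < E.outSize) (hwork : 0 < E.workSize) (hw : N < E.word) :
    Run E (mulAdd x len b₁ b₂ e₁ e₂ yE) σ (2 * N) (fun σ' => (∀ y, y ≠ x → σ'.reg y = σ.reg y) ∧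
      ∀ z, σ'.out z = σ.out z +
        ∑ i ∈ Finset.range N, if y i = z then E.input b₁ (α i) * E.input b₂ (β i) else 0) := by
  rw [mul_comm (2 : ℝ)]
  refine Run.forUp (Inv := fun j σ' => (∀ y, y ≠ x → σ'.reg y = σ.reg y) ∧
      ∀ z, σ'.out z = σ.out z +
        ∑ i ∈ Finset.range j, if y i = z then E.input b₁ (α i) * E.input b₂ (β i) else 0)
    hw ?_ ?_ ?_
  · rintro j σ' ⟨h, _⟩ _
    exact hN _ h
  · exact ⟨fun y hy => by simp [Function.update_of_ne hy], fun i => by simp⟩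
  · rintro j σ' hj ⟨h, ho⟩ hx
    have hx' : σ'.reg x < N := by omega
    let v := E.input b₁ (α j) * E.input b₂ (β j)
    let σ₁ : State K := { σ' with work := Function.update σ'.work 0 v }
    refine ⟨1 + 1, { σ₁ with out := Function.update σ₁.out (y j) (σ₁.out (y j) + v) },
      .seq σ' σ₁ _ _ _ _ _
        (.arith _ _ _ _ _ _ (E.input b₁ (α j)) (E.input b₂ (β j)) ?_ ?_ ?_)
        (.arith _ _ _ _ _ _ (σ₁.out (y j)) v ?_ ?_ ?_), by norm_num, ?_⟩
    · simp only [Src.read, h₁ _ h hx', hx]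
      rw [if_pos (hα j hj)]
    · simp only [Src.read, h₂ _ h hx', hx]
      rw [if_pos (hβ j hj)]
    · exact if_pos hwork
    · simp only [Src.read, σ₁, hy _ h hx', hx]
      rw [if_pos (hyo j hj)]
    · refine (if_pos hwork).trans (congrArg some ?_)
      exact Function.update_self (0 : ℕ) v σ'.work
    · simp only [Dst.write, σ₁, hy _ h hx', hx, ArithOp.apply]
      rw [if_pos (hyo j hj)]
    · refine ⟨hx, fun y hy => ?_, fun z => ?_⟩
      · simp only [Function.update_of_ne hy, σ₁, h y hy]
      · simp only [σ₁, Function.update_apply, Finset.sum_range_succ]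
        by_cases hz : z = y j
        · rw [if_pos hz, if_pos hz.symm, ho, ← hz, add_assoc]
        · rw [if_neg hz, if_neg (Ne.symm hz), ho, add_zero]

/-! ### Accumulating the results of a series of calls -/

/-- For `j < J`: run `p`, then add `len` output registers from the address `s` on to those
from the address `a` on. -/
def accLoop (xj xi : ℕ) (J : IExp) (p : Program K) (a s len : IExp) : Program K :=
  forUp xj J (.seq p (addOut xi a s len))

theorem ringOnly_accLoop {p : Program K} (hp : p.RingOnly) (xj xi : ℕ) (J a s len : IExp) :
    (accLoop xj xi J p a s len).RingOnly :=
  ringOnly_forUp ⟨hp, ringOnly_addOut _ _ _ _⟩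

/-- The standard registers `≥ R`, except for `x` and `y`, have the same contents. -/
def AgreeOff (R x y : ℕ) (r r' : ℕ → ℕ) : Prop := ∀ z, R ≤ z → z ≠ x → z ≠ y → r z = r' z

/-- The interval from `t₀` to `t₁` is scratch space: the body writes only there, and every target
avoids it. What a round adds does not depend on the present contents of the output, so the
contributions simply sum up. -/
theorem Run.accLoop {xj xi : ℕ} {J aE sE len : IExp} {p : Program K} {N Lmax t₀ t₁ : ℕ}
    {a s l : ℕ → ℕ} {res : ℕ → ℕ → K} {t : ℝ} (hxj : R ≤ xj) (hne : xj ≠ xi)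
    (hJ : ∀ r, AgreeOff R xj xi r σ.reg → J.eval r = N)
    (ha : ∀ r, AgreeOff R xj xi r σ.reg → r xj < N → aE.eval r = a (r xj))
    (hs : ∀ r, AgreeOff R xj xi r σ.reg → r xj < N → sE.eval r = s (r xj))
    (hl : ∀ r, AgreeOff R xj xi r σ.reg → r xj < N → len.eval r = l (r xj))
    (hN : N < E.word) (hLmax : ∀ j < N, l j ≤ Lmax) (hLw : Lmax < E.word)
    (ht₁ : t₁ ≤ E.outSize) (hsrc : ∀ j < N, t₀ ≤ s j ∧ s j + l j ≤ t₁)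
    (hdst : ∀ j < N, 0 < l j → a j + l j ≤ t₀ ∨ (t₁ ≤ a j ∧ a j + l j ≤ E.outSize))
    (hp : ∀ j < N, ∀ τ : State K, AgreeOff R xj xi τ.reg σ.reg → τ.reg xj = j →
      Run E p τ t (fun τ' => (∀ x, R ≤ x → τ'.reg x = τ.reg x) ∧
        (∀ y, ¬ (t₀ ≤ y ∧ y < t₁) → τ'.out y = τ.out y) ∧
        ∀ i < l j, τ'.out (s j + i) = res j i)) :
    Run E (accLoop xj xi J p aE sE len) σ (N * (t + Lmax)) (fun σ' =>
      AgreeOff R xj xi σ'.reg σ.reg ∧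
      ∀ y, ¬ (t₀ ≤ y ∧ y < t₁) → σ'.out y = σ.out y +
        ∑ j ∈ Finset.range N, if a j ≤ y ∧ y < a j + l j then res j (y - a j) else 0) := by
  refine Run.forUp (Inv := fun j σ' => AgreeOff R xj xi σ'.reg σ.reg ∧
      ∀ y, ¬ (t₀ ≤ y ∧ y < t₁) → σ'.out y = σ.out y +
        ∑ j ∈ Finset.range j, if a j ≤ y ∧ y < a j + l j then res j (y - a j) else 0)
    hN ?_ ?_ ?_
  · rintro j σ' ⟨h, _⟩ _
    exact hJ _ h
  · exact ⟨fun z _ h _ => by simp [Function.update_of_ne h], fun y _ => by simp⟩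
  · rintro j σ' hj ⟨h, ho⟩ hx
    refine ((hp j hj σ' h hx).seq (t₂ := Lmax) (Q₂ := fun τ => τ.reg xj = j ∧
      AgreeOff R xj xi { τ with reg := Function.update τ.reg xj (j + 1) }.reg σ.reg ∧
      ∀ y, ¬ (t₀ ≤ y ∧ y < t₁) → τ.out y = σ.out y + ∑ j ∈ Finset.range (j + 1),
        if a j ≤ y ∧ y < a j + l j then res j (y - a j) else 0) ?_).mono le_rfl fun _ h => h
    rintro τ ⟨hreg, hout, hres⟩
    have hag : ∀ r : ℕ → ℕ, (∀ y, y ≠ xi → r y = τ.reg y) → AgreeOff R xj xi r σ.reg := by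
      intro r hr z hz h1 h2
      rw [hr z h2, hreg z hz, h z hz h1 h2]
    have hjr : ∀ r : ℕ → ℕ, (∀ y, y ≠ xi → r y = τ.reg y) → r xj = j := by
      intro r hr
      rw [hr xj hne, hreg xj hxj, hx]
    have h1 := hsrc j hj
    have h2 := hdst j hj
    have h3 := hLmax j hj
    refine (Run.addOut (a := a j) (s := s j) (N := l j)
      (fun r hr => by rw [ha r (hag r hr) (by rw [hjr r hr]; exact hj), hjr r hr])
      (fun r hr => by rw [hs r (hag r hr) (by rw [hjr r hr]; exact hj), hjr r hr])
      (fun r hr => by rw [hl r (hag r hr) (by rw [hjr r hr]; exact hj), hjr r hr])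
      (by omega) (by omega) (by omega) (by omega)).mono (by exact_mod_cast h3) ?_
    rintro τ' ⟨hr', ho'⟩
    refine ⟨by rw [hr' _ hne, hreg _ hxj, hx], ?_, ?_⟩
    · intro z hz h1 h2
      simp only [Function.update_of_ne h1]
      rw [hr' _ h2, hreg _ hz, h z hz h1 h2]
    · intro y hy
      rw [ho', Finset.sum_range_succ, ← add_assoc, ← ho y hy, ← hout y hy]
      split_ifs with hay
      · rw [hres _ (by omega)]
      · rw [add_zero]

/-! ### Blocks of polynomials -/

/-- The polynomial of size `k` with the coefficients `v 0, …, v (k - 1)`. -/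
noncomputable def blk (k : ℕ) (v : ℕ → K) : K[X] := ∑ i ∈ Finset.range k, monomial i (v i)

theorem coeff_blk (k : ℕ) (v : ℕ → K) (i : ℕ) : (blk k v).coeff i = if i < k then v i else 0 := by
  simp [blk, coeff_monomial]

theorem degree_blk_lt (k : ℕ) (v : ℕ → K) : (blk k v).degree < k := by
  rw [degree_lt_iff_coeff_zero]
  intro m hm
  rw [coeff_blk, if_neg (by omega)]

theorem coeff_mul_eq_zero {p q : K[X]} {a b i : ℕ} (hp : ∀ j, a ≤ j → p.coeff j = 0)
    (hq : ∀ j, b ≤ j → q.coeff j = 0) (hi : a + b ≤ i + 1) : (p * q).coeff i = 0 := by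
  rw [coeff_mul]
  refine Finset.sum_eq_zero fun x hx => ?_
  rw [Finset.HasAntidiagonal.mem_antidiagonal] at hx
  by_cases h : a ≤ x.1
  · rw [hp _ h, zero_mul]
  · rw [hq _ (by omega), mul_zero]

/-- The coefficients of a product of which the first factor has size `N`. -/
theorem coeff_mul_eq_sum_range {p : K[X]} {N : ℕ} (hp : ∀ j, N ≤ j → p.coeff j = 0) (q : K[X])
    (i : ℕ) : (p * q).coeff i =
      ∑ u ∈ Finset.range N, p.coeff u * if u ≤ i then q.coeff (i - u) else 0 := by
  rw [coeff_mul, Finset.Nat.sum_antidiagonal_eq_sum_range_succ (fun a b => p.coeff a * q.coeff b)]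
  have h1 : ∀ M, N ≤ M → i + 1 ≤ M →
      (∑ u ∈ Finset.range N, p.coeff u * if u ≤ i then q.coeff (i - u) else 0) =
      ∑ u ∈ Finset.range M, p.coeff u * if u ≤ i then q.coeff (i - u) else 0 := by
    intro M hM _
    refine Finset.sum_subset (by simpa using hM) fun u _ hu => ?_
    rw [hp u (by simpa using hu), zero_mul]
  have h2 : ∀ M, N ≤ M → i + 1 ≤ M →
      (∑ u ∈ Finset.range (i + 1), p.coeff u * q.coeff (i - u)) =
      ∑ u ∈ Finset.range M, p.coeff u * if u ≤ i then q.coeff (i - u) else 0 := by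
    intro M _ hM
    rw [← Finset.sum_subset (Finset.range_subset_range.2 hM)]
    · refine Finset.sum_congr rfl fun u hu => ?_
      rw [Finset.mem_range] at hu
      rw [if_pos (by omega)]
    · intro u _ hu
      rw [Finset.mem_range] at hu
      rw [if_neg (by omega), mul_zero]
  rw [h1 (max N (i + 1)) (le_max_left _ _) (le_max_right _ _),
    h2 (max N (i + 1)) (le_max_left _ _) (le_max_right _ _)]

/-! ### Calls that use the output space as their whole memory -/

/-- A layout that moves the output space and the work space to places in the output space. -/
def outLayout (inp : Bool → IExp → IExp × IExp × Bool × IExp) (O W : IExp → IExp) : Layout where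
  inp := inp
  cell b e := (false, if b then W e else O e)

/-- `p` solves `A` in size `k` with `s` work registers and cost at most `t`, the standard
registers holding integers `< B`. -/
def SolvesAt (p : Program K) (A : Problem K) (k s B : ℕ) (t : ℝ) : Prop :=
  ∀ f g h : K[X], f.degree < A.sizeF k → g.degree < A.sizeG k → h.degree < A.sizeH k →
    ∀ out₀ work₀ : ℕ → K, (∀ i < A.sizeH k, out₀ (A.offH k + i) = h.coeff i) →
      Run (A.env k f g s B) p ⟨Function.update (fun _ => 0) 0 k, out₀, work₀⟩ t
        (fun σ' => ∀ i < A.outSize k, σ'.out i = (A.result k f g h).coeff i)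

theorem solves_iff {p : Program K} {A : Problem K} {s : ℕ → ℕ} {t : ℕ → ℝ} :
    Solves p A s t ↔ ∃ d, ∀ n, 1 ≤ n → SolvesAt p A n (s n) ((n + 2) ^ d) (t n) := Iff.rfl

/-- The whole memory of the call lies between `t₀` and `t₁` in the output space: the results, placed
by the injection `o`, below `wb`, and the work registers from `wb` on. The operands `F` and `G` are
never stored; `inp` only says how to read their coefficients off the real inputs. -/
theorem SolvesAt.callOut {p : Program K} {A : Problem K} {k s B : ℕ} {t : ℝ}
    (hp : SolvesAt p A k s B t) (hH : A.sizeH k = 0) {kE : IExp} {F G : K[X]}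
    {inp : Bool → IExp → IExp × IExp × Bool × IExp} {O W : IExp → IExp} {o : ℕ → ℕ}
    {wb t₀ t₁ : ℕ} (hpR : p.bd ≤ R) (hR : 0 < R)
    (hF : F.degree < A.sizeF k) (hG : G.degree < A.sizeG k)
    (hk : kE.eval τ.reg = k) (hkw : k < E.word) (hB : B ≤ E.word)
    (hinp : ∀ r : ℕ → ℕ, (∀ x, R ≤ x → r x = τ.reg x) → ∀ b (e : IExp),
      e.eval r < (if b then A.sizeG k else A.sizeF k) →
      if (inp b e).1.eval r < (inp b e).2.1.eval r then
        (inp b e).2.2.2.eval r < E.inputSize (inp b e).2.2.1 ∧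
        E.input (inp b e).2.2.1 ((inp b e).2.2.2.eval r) =
          (if b then G else F).coeff (e.eval r)
      else (if b then G else F).coeff (e.eval r) = 0)
    (hO : ∀ r : ℕ → ℕ, (∀ x, R ≤ x → r x = τ.reg x) → ∀ e : IExp,
      e.eval r < A.outSize k → (O e).eval r = o (e.eval r))
    (hW : ∀ r : ℕ → ℕ, (∀ x, R ≤ x → r x = τ.reg x) → ∀ e : IExp, (W e).eval r = wb + e.eval r)
    (ho : ∀ i < A.outSize k, t₀ ≤ o i ∧ o i < wb)
    (hoi : ∀ i < A.outSize k, ∀ j < A.outSize k, o i = o j → i = j)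
    (hwb : t₀ ≤ wb) (hws : wb + s ≤ t₁) (ht₁ : t₁ ≤ E.outSize) :
    Run E (callProg (outLayout inp O W) R p kE) τ t (fun τ' =>
      (∀ x, R ≤ x → τ'.reg x = τ.reg x) ∧
      (∀ y, ¬ (t₀ ≤ y ∧ y < t₁) → τ'.out y = τ.out y) ∧
      ∀ i < A.outSize k, τ'.out (o i) = (A.result k F G 0).coeff i) := by
  have hfit : (outLayout inp O W).Fits R (A.env k F G s B) E τ.reg
      (fun p => (false, if p.1 then wb + p.2 else o p.2)) := by
    refine ⟨hB, ?_, ?_, ?_, ?_⟩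
    · intro r hr b e he
      have := hinp r hr b e he
      rcases b <;> exact this
    · rintro r hr (_ | _) e he
      · simp [outLayout, hO r hr e he]
      · simp [outLayout, hW r hr e]
    · rintro ⟨_ | _, i⟩ hi
      · have := ho i hi
        simp only [Env.size]
        simp
        omega
      · have : i < s := hi
        simp only [Env.size]
        simp
        omega
    · rintro ⟨_ | _, i⟩ ⟨_ | _, j⟩ hi hj h
      · simp only [Prod.mk.injEq, true_and] at h ⊢
        exact hoi i hi j hj h
      · have := ho i hi
        simp at h
        omega
      · have := ho j hj
        simp at h
        omega
      · simpa using h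
  refine (Run.call hfit hpR hR hk hkw (hp F G 0 hF hG (by simp [hH]) _ _
    (by simp [hH]))).mono le_rfl ?_
  rintro τ' ⟨hreg, hframe, σ', hres, hget⟩
  refine ⟨hreg, ?_, ?_⟩
  · intro y hy
    refine hframe (false, y) ?_
    rintro ⟨_ | _, i⟩ hi h
    · have := ho i hi
      simp at h
      omega
    · have : i < s := hi
      simp at h
      omega
  · intro i hi
    rw [← hres i hi]
    exact hget (false, i) hi

/-! ### Infix notation for index expressions -/

instance : Add IExp := ⟨.add⟩
instance : Sub IExp := ⟨.sub⟩
instance : Mul IExp := ⟨.mul⟩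
instance : Div IExp := ⟨.div⟩

theorem IExp.eval_add (r : ℕ → ℕ) (a b : IExp) : (a + b).eval r = a.eval r + b.eval r := rfl
theorem IExp.eval_sub (r : ℕ → ℕ) (a b : IExp) : (a - b).eval r = a.eval r - b.eval r := rfl
theorem IExp.eval_mul (r : ℕ → ℕ) (a b : IExp) : (a * b).eval r = a.eval r * b.eval r := rfl
theorem IExp.eval_div (r : ℕ → ℕ) (a b : IExp) : (a / b).eval r = a.eval r / b.eval r := rfl
theorem IExp.eval_lit (r : ℕ → ℕ) (a : ℕ) : (IExp.lit a).eval r = a := rfl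
theorem IExp.eval_reg (r : ℕ → ℕ) (a : ℕ) : (IExp.reg a).eval r = r a := rfl

/-! ### Decomposition into blocks -/

theorem blk_add (a b : ℕ) (v : ℕ → K) :
    blk (a + b) v = blk a v + X ^ a * blk b (fun i => v (a + i)) := by
  simp only [blk, Finset.sum_range_add, Finset.mul_sum, X_pow_mul_monomial]
  simp only [add_comm a]

theorem blk_mul (J k : ℕ) (v : ℕ → K) :
    blk (J * k) v = ∑ j ∈ Finset.range J, X ^ (j * k) * blk k (fun i => v (j * k + i)) := by
  induction J with
  | zero => simp [blk]
  | succ J ih => rw [Finset.sum_range_succ, ← ih, Nat.succ_mul, blk_add]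

theorem blk_eq_of_zero {a b : ℕ} (hab : a ≤ b) {v : ℕ → K} (hv : ∀ i, a ≤ i → v i = 0) :
    blk b v = blk a v := by
  ext i
  rw [coeff_blk, coeff_blk]
  split_ifs <;> first | rfl | (exact hv i (by omega)) | omega

theorem blk_coeff {f : K[X]} {n : ℕ} (hf : f.degree < n) : blk n f.coeff = f := by
  ext i
  rw [coeff_blk]
  split_ifs with h
  · rfl
  · exact (coeff_eq_zero_of_degree_lt (hf.trans_le (by exact_mod_cast not_lt.1 h))).symm

theorem coeff_eq_zero_of_size {f : K[X]} {n : ℕ} (hf : f.degree < n) {i : ℕ} (hi : n ≤ i) :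
    f.coeff i = 0 :=
  coeff_eq_zero_of_degree_lt (hf.trans_le (by exact_mod_cast hi))

/-- The polynomial `f quo X ^ b`, for `f` of size `n`. -/
noncomputable def tail (n b : ℕ) (f : K[X]) : K[X] := blk (n - b) fun i => f.coeff (b + i)

theorem eq_blk_add_tail {f : K[X]} {n b : ℕ} (hf : f.degree < n) (hb : b ≤ n) :
    f = blk b f.coeff + X ^ b * tail n b f := by
  conv_lhs => rw [← blk_coeff hf, ← Nat.add_sub_cancel' hb, blk_add]
  rfl

theorem tail_eq_blk_add_tail {f : K[X]} {n b k : ℕ} (hbk : b + k ≤ n) :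
    tail n b f = blk k (fun i => f.coeff (b + i)) + X ^ k * tail n (b + k) f := by
  have : n - b = k + (n - (b + k)) := by omega
  rw [tail, this, blk_add, tail]
  simp only [add_assoc]

theorem tail_eq_sum {f : K[X]} {n b k J : ℕ} (hf : f.degree < n) (hJ : n ≤ b + J * k) :
    tail n b f =
      ∑ j ∈ Finset.range J, X ^ (j * k) * blk k (fun i => f.coeff (b + (j * k + i))) := by
  rw [← blk_mul J k (fun i => f.coeff (b + i)), tail]
  exact (blk_eq_of_zero (by omega) fun i hi => coeff_eq_zero_of_size hf (by omega)).symm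

/-- What the output space holds when the first `b` coefficients of `f` and of `g` have been
treated. -/
noncomputable def partialProduct (n b : ℕ) (f g h : K[X]) : K[X] :=
  h + f * g - X ^ (b + b) * (tail n b f * tail n b g)

/-- The subtraction in `partialProduct` cancels the top part: writing f and g as head plus tail,
what remains is h, the head of f times g, and X^b times the tail of f times the head of g, all of
size at most n + b - 1. -/
theorem coeff_partialProduct {f g h : K[X]} {n b y : ℕ} (hf : f.degree < n) (hg : g.degree < n)
    (hh : h.degree < (n - 1 : ℕ)) (hb : b ≤ n) (hy : n + b ≤ y + 1) :
    (partialProduct n b f g h).coeff y = 0 := by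
  have : partialProduct n b f g h =
      h + blk b f.coeff * g + X ^ b * (tail n b f * blk b g.coeff) := by
    have h1 := eq_blk_add_tail hf hb
    have h2 := eq_blk_add_tail hg hb
    rw [partialProduct]
    generalize tail n b f = u at *
    generalize tail n b g = v at *
    generalize blk b f.coeff = u' at *
    generalize blk b g.coeff = v' at *
    rw [h1, h2, pow_add]
    ring
  rw [this, coeff_add, coeff_add, coeff_eq_zero_of_size hh (by omega), coeff_X_pow_mul',
    coeff_mul_eq_zero (a := b) (b := n) _ (fun j => coeff_eq_zero_of_size hg) (by omega)]
  · rw [zero_add, zero_add]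
    split_ifs
    · refine coeff_mul_eq_zero (a := n - b) (b := b) ?_ ?_ (by omega)
      · intro j hj
        rw [tail, coeff_blk, if_neg (by omega)]
      · intro j hj
        rw [coeff_blk, if_neg (by omega)]
    · rfl
  · intro j hj
    rw [coeff_blk, if_neg (by omega)]

/-- If F, G are the tails from b on, F', G' those from b + k on, and u, v the blocks of size k
between them, then F·G - X^(2k)·F'·G' = u·G + X^k·F'·v. The two sums are the two products on the
right, cut into blocks; the last blocks may exceed the size n and are then padded with zeros. -/
theorem partialProduct_step {f g h : K[X]} {n b k J : ℕ} (hf : f.degree < n) (hg : g.degree < n)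
    (hbk : b + k ≤ n) (hJ : n ≤ b + k + J * k) :
    partialProduct n (b + k) f g h = partialProduct n b f g h +
      ∑ j ∈ Finset.range (J + 1), X ^ (b + (b + j * k)) *
        (blk k (fun i => f.coeff (b + i)) * blk k (fun i => g.coeff (b + j * k + i))) +
      ∑ j ∈ Finset.range J, X ^ (b + k + j * k + b) *
        (blk k (fun i => f.coeff (b + k + j * k + i)) * blk k (fun i => g.coeff (b + i))) := by
  have h1 : ∑ j ∈ Finset.range (J + 1), X ^ (b + (b + j * k)) *
      (blk k (fun i => f.coeff (b + i)) * blk k (fun i => g.coeff (b + j * k + i))) =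
      X ^ (b + b) * (blk k (fun i => f.coeff (b + i)) * tail n b g) := by
    rw [tail_eq_sum hg (J := J + 1) (k := k) (by rw [Nat.succ_mul]; omega), Finset.mul_sum,
      Finset.mul_sum]
    refine Finset.sum_congr rfl fun j _ => ?_
    simp only [add_assoc, pow_add]
    ring
  have h2 : ∑ j ∈ Finset.range J, X ^ (b + k + j * k + b) *
      (blk k (fun i => f.coeff (b + k + j * k + i)) * blk k (fun i => g.coeff (b + i))) =
      X ^ (b + b) * X ^ k * (tail n (b + k) f * blk k (fun i => g.coeff (b + i))) := by
    rw [tail_eq_sum hf hJ, Finset.sum_mul, Finset.mul_sum]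
    refine Finset.sum_congr rfl fun j _ => ?_
    simp only [add_assoc, pow_add]
    ring
  rw [h1, h2, partialProduct, partialProduct, tail_eq_blk_add_tail hbk (f := f),
    tail_eq_blk_add_tail hbk (f := g)]
  ring

/-! ### The in-place half-additive full product -/

/-- For `j < J`: add to the output space the product of the block of `f` at `fo` by the block of
`g` at `go`. The standard registers `R`, `R + 1`, `R + 2` hold the size of the problem, the number
of treated coefficients and the size of the blocks; `R + 3` is the loop counter `j`. -/
def blockProducts (R : ℕ) (p : Program K) (J fo go : IExp) : Program K :=
  accLoop (R + 3) (R + 4) J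
    (callProg (outLayout (fun b e => ((if b then go else fo) + e, .reg R, b,
        (if b then go else fo) + e))
      (fun e => .reg R + .reg (R + 1) - .lit 1 + .reg (R + 2) + e)
      (fun e => .reg R + .reg (R + 1) - .lit 1 + .reg (R + 2) +
        (.lit 2 * .reg (R + 2) - .lit 1) + e)) R p (.reg (R + 2)))
    (fo + go) (.reg R + .reg (R + 1) - .lit 1 + .reg (R + 2))
    ((.lit 2 * .reg (R + 2) - .lit 1) - ((.lit 2 * .reg (R + 2) - .lit 1) -
      (.reg R + .reg (R + 1) - .lit 1 + .reg (R + 2) - (fo + go))))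

/-- The scratch zone starts at n + b - 1 + k, just above the registers being completed, and `hspace`
says that a product of size 2k - 1 and `s` work registers fit between this point and the end. The
nested truncated subtractions compute a minimum: only the part of a product that lies below the
scratch zone is added. Nothing is lost, since the final value has no coefficient beyond. -/
theorem Run.blockProducts {R : ℕ} {p : Program K} {n b k s B W J : ℕ} {t : ℝ} {f g : K[X]}
    {JE fo go : IExp} {foV goV : ℕ → ℕ} {σ : State K}
    (hp : SolvesAt p (fullProduct K) k s B t) (hpR : p.bd ≤ R) (hR : 0 < R)
    (hf : f.degree < n) (hg : g.degree < n)
    (hn : σ.reg R = n) (hb : σ.reg (R + 1) = b) (hk : σ.reg (R + 2) = k)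
    (hJ : ∀ r, AgreeOff R (R + 3) (R + 4) r σ.reg → JE.eval r = J)
    (hfo : ∀ r, AgreeOff R (R + 3) (R + 4) r σ.reg → fo.eval r = foV (r (R + 3)))
    (hgo : ∀ r, AgreeOff R (R + 3) (R + 4) r σ.reg → go.eval r = goV (r (R + 3)))
    (hk1 : 1 ≤ k) (hn1 : 1 ≤ n) (hspace : b + 3 * k + s ≤ n + 1) (hBW : B ≤ W) (hJW : J < W)
    (hkW : 2 * k < W) :
    Run ((halfAdditiveLow K).env n f g 1 W) (blockProducts R p JE fo go) σ (J * (t + 2 * k))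
      (fun σ' => AgreeOff R (R + 3) (R + 4) σ'.reg σ.reg ∧
        ∀ y < n + b - 1 + k, σ'.out y = σ.out y + (∑ j ∈ Finset.range J, X ^ (foV j + goV j) *
          (blk k (fun i => f.coeff (foV j + i)) * blk k (fun i => g.coeff (goV j + i)))).coeff y)
      := by
  have hreg : ∀ r, AgreeOff R (R + 3) (R + 4) r σ.reg →
      r R = n ∧ r (R + 1) = b ∧ r (R + 2) = k := by
    intro r hr
    refine ⟨?_, ?_, ?_⟩
    · rw [← hn]; exact hr _ (by omega) (by omega) (by omega)
    · rw [← hb]; exact hr _ (by omega) (by omega) (by omega)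
    · rw [← hk]; exact hr _ (by omega) (by omega) (by omega)
  have main := Run.accLoop (E := (halfAdditiveLow K).env n f g 1 W) (σ := σ) (R := R)
    (xj := R + 3) (xi := R + 4) (J := JE) (N := J) (Lmax := 2 * k) (t₀ := n + b - 1 + k)
    (t₁ := 2 * n - 1) (t := t) (a := fun j => foV j + goV j) (s := fun _ => n + b - 1 + k)
    (l := fun j => (2 * k - 1) - ((2 * k - 1) - (n + b - 1 + k - (foV j + goV j))))
    (res := fun j i =>
      (blk k (fun i => f.coeff (foV j + i)) * blk k (fun i => g.coeff (goV j + i))).coeff i)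
    (aE := fo + go) (sE := .reg R + .reg (R + 1) - .lit 1 + .reg (R + 2))
    (len := (.lit 2 * .reg (R + 2) - .lit 1) - ((.lit 2 * .reg (R + 2) - .lit 1) -
      (.reg R + .reg (R + 1) - .lit 1 + .reg (R + 2) - (fo + go))))
    (p := callProg (outLayout (fun b e => ((if b then go else fo) + e, .reg R, b,
        (if b then go else fo) + e))
      (fun e => .reg R + .reg (R + 1) - .lit 1 + .reg (R + 2) + e)
      (fun e => .reg R + .reg (R + 1) - .lit 1 + .reg (R + 2) +
        (.lit 2 * .reg (R + 2) - .lit 1) + e)) R p (.reg (R + 2)))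
    (by omega) (by omega) hJ ?_ ?_ ?_ hJW (by intros; omega) hkW le_rfl ?_ ?_ ?_
  · refine main.mono (by push_cast; exact le_rfl) ?_
    rintro σ' ⟨hr, ho⟩
    refine ⟨hr, fun y hy => ?_⟩
    rw [ho y (by omega), finsetSum_coeff]
    congr 1
    refine Finset.sum_congr rfl fun j _ => ?_
    rw [coeff_X_pow_mul']
    by_cases h1 : foV j + goV j ≤ y
    · rw [if_pos h1]
      split_ifs with h2
      · rfl
      · refine (coeff_mul_eq_zero (a := k) (b := k) ?_ ?_ (by omega)).symm <;>
        · intro i hi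
          rw [coeff_blk, if_neg (by omega)]
    · rw [if_neg h1, if_neg (by omega)]
  · intro r hr _
    rw [IExp.eval_add, hfo r hr, hgo r hr]
  · intro r hr _
    obtain ⟨h1, h2, h3⟩ := hreg r hr
    simp only [IExp.eval_add, IExp.eval_sub, IExp.eval_reg, IExp.eval_lit, h1, h2, h3]
  · intro r hr _
    obtain ⟨h1, h2, h3⟩ := hreg r hr
    simp only [IExp.eval_add, IExp.eval_sub, IExp.eval_mul, IExp.eval_reg, IExp.eval_lit, h1, h2,
      h3, hfo r hr, hgo r hr]
  · intro j hj
    omega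
  · intro j hj hl
    omega
  · intro j hj τ hτ hτj
    have hag : ∀ r : ℕ → ℕ, (∀ x, R ≤ x → r x = τ.reg x) →
        AgreeOff R (R + 3) (R + 4) r σ.reg ∧ r (R + 3) = j := by
      intro r hr
      refine ⟨fun z hz h1 h2 => ?_, ?_⟩
      · rw [hr z hz, hτ z hz h1 h2]
      · rw [hr _ (by omega), hτj]
    have hτr := hreg τ.reg hτ
    refine (hp.callOut (τ := τ) (E := (halfAdditiveLow K).env n f g 1 W) rfl
      (kE := .reg (R + 2)) (F := blk k (fun i => f.coeff (foV j + i)))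
      (G := blk k (fun i => g.coeff (goV j + i))) (o := fun i => n + b - 1 + k + i)
      (wb := n + b - 1 + k + (2 * k - 1)) (t₀ := n + b - 1 + k) (t₁ := 2 * n - 1) hpR hR
      (degree_blk_lt _ _) (degree_blk_lt _ _) hτr.2.2 (by change k < W; omega) hBW
      ?_ ?_ ?_ ?_ ?_ (by omega) (by omega) le_rfl).mono le_rfl ?_
    · intro r hr c e he
      obtain ⟨hr1, hr2⟩ := hag r hr
      obtain ⟨h1, h2, h3⟩ := hreg r hr1
      have he' : e.eval r < k := by cases c <;> exact he
      cases c
      · simp only [IExp.eval_add, IExp.eval_reg, h1, hfo r hr1, hr2, Bool.false_eq_true, if_false,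
          coeff_blk, if_pos he']
        split_ifs with h
        · exact ⟨h, rfl⟩
        · exact coeff_eq_zero_of_size hf (by omega)
      · simp only [IExp.eval_add, IExp.eval_reg, h1, hgo r hr1, hr2, if_true,
          coeff_blk, if_pos he']
        split_ifs with h
        · exact ⟨h, rfl⟩
        · exact coeff_eq_zero_of_size hg (by omega)
    · intro r hr e _
      obtain ⟨h1, h2, h3⟩ := hreg r (hag r hr).1
      simp only [IExp.eval_add, IExp.eval_sub, IExp.eval_reg, IExp.eval_lit, h1, h2, h3]
    · intro r hr e
      obtain ⟨h1, h2, h3⟩ := hreg r (hag r hr).1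
      simp only [IExp.eval_add, IExp.eval_sub, IExp.eval_mul, IExp.eval_reg, IExp.eval_lit, h1,
        h2, h3]
    · intro i hi
      have : i < 2 * k - 1 := hi
      omega
    · intro i _ i' _ h
      omega
    · rintro τ' ⟨h1, h2, h3⟩
      refine ⟨h1, h2, fun i hi => ?_⟩
      exact h3 i (by change i < 2 * k - 1; omega)

/-- One round of the in-place half-additive full product: the blocks have size
`⌈m / (J + 1)⌉`, where `m` is the number of coefficients that are not yet treated. -/
def halfAddRound (R : ℕ) (p : Program K) (J : ℕ) : Program K :=
  .seq (.assign (R + 2) ((.reg R - .reg (R + 1) + .lit J) / .lit (J + 1))) <|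
  .seq (zeroOut (R + 4) (.reg R + .reg (R + 1) - .lit 1) (.reg (R + 2))) <|
  .seq (blockProducts R p (.lit (J + 1)) (.reg (R + 1))
    (.reg (R + 1) + .reg (R + 3) * .reg (R + 2))) <|
  .seq (blockProducts R p (.lit J) (.reg (R + 1) + .reg (R + 2) + .reg (R + 3) * .reg (R + 2))
    (.reg (R + 1)))
  (.assign (R + 1) (.reg (R + 1) + .reg (R + 2)))

/-- The end of the in-place half-additive full product, without blocks. -/
def halfAddEnd (R : ℕ) : Program K :=
  .seq (zeroOut (R + 4) (.reg R + .reg (R + 1) - .lit 1) (.reg R - .reg (R + 1)))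
    (forUp (R + 3) (.reg R - .reg (R + 1)) (mulAdd (R + 4) (.reg R - .reg (R + 1)) false true
      (.reg (R + 1) + .reg (R + 3)) (.reg (R + 1) + .reg (R + 4))
      (.reg (R + 1) + .reg (R + 1) + .reg (R + 3) + .reg (R + 4))))

/-- The in-place half-additive full product, from a full product program `p`; blocks are used as
long as the number of coefficients that are not yet treated is at least `N₀`. -/
def halfAddProg (p : Program K) (J N₀ : ℕ) : Program K :=
  let R := p.bd + 1
  .seq (.assign R (.reg 0)) <| .seq (.assign (R + 1) (.lit 0)) <|
  .seq (.whileLt (.lit (N₀ - 1)) (.reg R - .reg (R + 1)) (halfAddRound R p J)) (halfAddEnd R)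

theorem ringOnly_halfAddProg {p : Program K} (hp : p.RingOnly) (J N₀ : ℕ) :
    (halfAddProg p J N₀).RingOnly :=
  ⟨trivial, trivial, ⟨trivial, ringOnly_zeroOut _ _ _,
    ringOnly_accLoop (ringOnly_callProg hp _ _ _) _ _ _ _ _ _,
    ringOnly_accLoop (ringOnly_callProg hp _ _ _) _ _ _ _ _ _, trivial⟩,
    ringOnly_zeroOut _ _ _, ringOnly_forUp (ringOnly_mulAdd _ _ _ _ _ _ _)⟩

/-- The invariant of the in-place half-additive full product. -/
def HalfAddInv (R n : ℕ) (f g h : K[X]) (b : ℕ) (σ : State K) : Prop :=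
  σ.reg R = n ∧ σ.reg (R + 1) = b ∧
    ∀ y < n + b - 1, σ.out y = (partialProduct n b f g h).coeff y

/-- Clearing the next registers extends the agreement with `partialProduct`, whose coefficients
vanish there. -/
theorem HalfAddInv.zeroOut {R n b l W x : ℕ} {f g h : K[X]} {len : IExp} {σ : State K}
    (hσ : HalfAddInv R n f g h b σ) (hx : R + 2 ≤ x) (hf : f.degree < n) (hg : g.degree < n)
    (hh : h.degree < (n - 1 : ℕ)) (hn : 1 ≤ n) (hbl : b + l ≤ n) (hW : n < W)
    (hlen : ∀ r : ℕ → ℕ, (∀ y, y ≠ x → r y = σ.reg y) → len.eval r = l) :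
    Run ((halfAdditiveLow K).env n f g 1 W)
      (zeroOut x (.reg R + .reg (R + 1) - .lit 1) len) σ 0
      (fun σ' => (∀ y, y ≠ x → σ'.reg y = σ.reg y) ∧
        ∀ y < n + b - 1 + l, σ'.out y = (partialProduct n b f g h).coeff y) := by
  obtain ⟨h1, h2, h3⟩ := hσ
  refine (Run.zeroOut (a := n + b - 1) (N := l) ?_ hlen (by change l < W; omega)
    (by change n + b - 1 + l ≤ 2 * n - 1; omega)).mono le_rfl ?_
  · intro r hr
    rw [IExp.eval_sub, IExp.eval_add, IExp.eval_reg, IExp.eval_reg, IExp.eval_lit,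
      hr _ (by omega), hr _ (by omega), h1, h2]
  · rintro σ' ⟨hr, ho⟩
    refine ⟨hr, fun y hy => ?_⟩
    rw [ho]
    split_ifs with hc
    · exact (coeff_partialProduct hf hg hh (by omega) (by omega)).symm
    · exact h3 y (by omega)

theorem Run.halfAddRound {R : ℕ} {p : Program K} {n b k J s B W : ℕ} {t : ℝ} {f g h : K[X]}
    {σ : State K} (hp : SolvesAt p (fullProduct K) k s B t) (hpR : p.bd ≤ R) (hR : 0 < R)
    (hf : f.degree < n) (hg : g.degree < n) (hh : h.degree < (n - 1 : ℕ)) (hBW : B ≤ W)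
    (hW : 2 * n < W) (hJW : J + 1 < W) (hk : k = (n - b + J) / (J + 1)) (hkn : b + k ≤ n)
    (hk1 : 1 ≤ k) (hspace : b + 3 * k + s ≤ n + 1) (hσ : HalfAddInv R n f g h b σ) :
    Run ((halfAdditiveLow K).env n f g 1 W) (halfAddRound R p J) σ
      ((2 * J + 1) * (t + 2 * k)) (HalfAddInv R n f g h (b + k)) := by
  -- Because `k` is rounded up, J + 1 blocks cover all untreated coefficients.
  have hJ : n ≤ b + k + J * k := by
    have := Nat.lt_div_mul_add (a := n - b + J) (b := J + 1) (by omega)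
    rw [← hk, mul_add, mul_comm] at this
    omega
  have hagr : ∀ {r r' : ℕ → ℕ} {z : ℕ}, AgreeOff R (R + 3) (R + 4) r r' → R ≤ z → z ≤ R + 2 →
      r z = r' z := fun h h1 h2 => h _ h1 (by omega) (by omega)
  obtain ⟨h1, h2, h3⟩ := hσ
  refine Run.assign_seq ?_ ?_
  · simp only [IExp.eval_add, IExp.eval_sub, IExp.eval_div, IExp.eval_reg, IExp.eval_lit, h1, h2]
    change _ < W
    omega
  · simp only [IExp.eval_add, IExp.eval_sub, IExp.eval_div, IExp.eval_reg, IExp.eval_lit, h1, h2,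
      ← hk]
    rw [← zero_add ((2 * (J : ℝ) + 1) * (t + 2 * k))]
    have hI : HalfAddInv R n f g h b ⟨Function.update σ.reg (R + 2) k, σ.out, σ.work⟩ :=
      ⟨by simp [h1], by simp [h2], h3⟩
    refine (hI.zeroOut (x := R + 4) (l := k) (W := W) (by omega) hf hg hh (by omega) hkn
      (by omega) ?_).seq ?_
    · intro r hr
      simp [IExp.eval_reg, hr]
    rintro σ₁ ⟨hr₁, ho₁⟩
    have g1 : σ₁.reg R = n := by rw [hr₁ _ (by omega)]; simp [h1]
    have g2 : σ₁.reg (R + 1) = b := by rw [hr₁ _ (by omega)]; simp [h2]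
    have g3 : σ₁.reg (R + 2) = k := by rw [hr₁ _ (by omega)]; simp
    have hcost : ((2 * J + 1) * (t + 2 * k) : ℝ) =
        ((J + 1 : ℕ) * (t + 2 * k)) + ((J * (t + 2 * k)) + 0) := by push_cast; ring
    rw [hcost]
    refine (Run.blockProducts (J := J + 1) (foV := fun _ => b) (goV := fun j => b + j * k)
      hp hpR hR hf hg g1 g2 g3 (fun _ _ => rfl) ?_ ?_ hk1 (by omega) hspace hBW hJW
      (by omega)).seq ?_
    · intro r hr
      rw [IExp.eval_reg, hagr hr (by omega) (by omega), g2]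
    · intro r hr
      rw [IExp.eval_add, IExp.eval_mul, IExp.eval_reg, IExp.eval_reg, IExp.eval_reg,
        hagr hr (z := R + 1) (by omega) (by omega), hagr hr (z := R + 2) (by omega) (by omega),
        g2, g3]
    rintro σ₂ ⟨hr₂, ho₂⟩
    have q1 : σ₂.reg R = n := by rw [hagr hr₂ le_rfl (by omega), g1]
    have q2 : σ₂.reg (R + 1) = b := by rw [hagr hr₂ (by omega) (by omega), g2]
    have q3 : σ₂.reg (R + 2) = k := by rw [hagr hr₂ (by omega) (by omega), g3]
    refine (Run.blockProducts (J := J) (foV := fun j => b + k + j * k) (goV := fun _ => b)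
      hp hpR hR hf hg q1 q2 q3 (fun _ _ => rfl) ?_ ?_ hk1 (by omega) hspace hBW (by omega)
      (by omega)).seq ?_
    · intro r hr
      rw [IExp.eval_add, IExp.eval_add, IExp.eval_mul, IExp.eval_reg, IExp.eval_reg,
        IExp.eval_reg, hagr hr (z := R + 1) (by omega) (by omega),
        hagr hr (z := R + 2) (by omega) (by omega), q2, q3]
    · intro r hr
      rw [IExp.eval_reg, hagr hr (by omega) (by omega), q2]
    rintro σ₃ ⟨hr₃, ho₃⟩
    have w1 : σ₃.reg R = n := by rw [hagr hr₃ le_rfl (by omega), q1]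
    have w2 : σ₃.reg (R + 1) = b := by rw [hagr hr₃ (by omega) (by omega), q2]
    have w3 : σ₃.reg (R + 2) = k := by rw [hagr hr₃ (by omega) (by omega), q3]
    have hev : (IExp.reg (R + 1) + IExp.reg (R + 2)).eval σ₃.reg = b + k := by
      rw [IExp.eval_add, IExp.eval_reg, IExp.eval_reg, w2, w3]
    refine Run.assign ?_ ?_
    · rw [hev]
      change _ < W
      omega
    · refine ⟨by simpa using w1, by simp [hev], fun y hy => ?_⟩
      rw [partialProduct_step hf hg hkn hJ, coeff_add, coeff_add, ← ho₁ y (by omega),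
        ← ho₂ y (by omega), ← ho₃ y (by omega)]

theorem coeff_X_pow_mul_blk_mul_blk (a m y : ℕ) (v w : ℕ → K) :
    (X ^ a * (blk m v * blk m w)).coeff y = ∑ j ∈ Finset.range m, ∑ i ∈ Finset.range m,
      if a + j + i = y then v j * w i else 0 := by
  rw [blk, blk, Finset.sum_mul_sum, Finset.mul_sum, finsetSum_coeff]
  refine Finset.sum_congr rfl fun j _ => ?_
  rw [Finset.mul_sum, finsetSum_coeff]
  refine Finset.sum_congr rfl fun i _ => ?_
  rw [monomial_mul_monomial, X_pow_mul_monomial, coeff_monomial]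
  congr 1
  exact propext (by omega)

/-- The last tail product is computed by the schoolbook method, coefficient by coefficient of f; its
cost depends on the threshold only, not on n. -/
theorem Run.halfAddEnd {R n b W N₀ : ℕ} {f g h : K[X]} {σ : State K}
    (hf : f.degree < n) (hg : g.degree < n) (hh : h.degree < (n - 1 : ℕ)) (hn : 1 ≤ n)
    (hb : b ≤ n) (hW : n < W) (hN₀ : n - b ≤ N₀) (hσ : HalfAddInv R n f g h b σ) :
    Run ((halfAdditiveLow K).env n f g 1 W) (halfAddEnd R) σ (2 * N₀ ^ 2)
      (fun σ' => ∀ y < 2 * n - 1, σ'.out y = (h + f * g).coeff y) := by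
  have h1 := hσ.1
  have h2 := hσ.2.1
  refine ((HalfAddInv.zeroOut (l := n - b) hσ (by omega) hf hg hh hn (by omega) hW ?_).seq
    (t₂ := ((n - b : ℕ) : ℝ) * (2 * (n - b : ℕ))) (Q₂ := fun σ' => ∀ y < 2 * n - 1,
      σ'.out y = (h + f * g).coeff y) ?_).mono ?_ fun _ h => h
  · intro r hr
    rw [IExp.eval_sub, IExp.eval_reg, IExp.eval_reg, hr _ (by omega), hr _ (by omega), h1, h2]
  · rintro σ₁ ⟨hr₁, ho₁⟩
    have g1 : σ₁.reg R = n := by rw [hr₁ _ (by omega), h1]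
    have g2 : σ₁.reg (R + 1) = b := by rw [hr₁ _ (by omega), h2]
    refine (Run.forUp (N := n - b) (Inv := fun j σ => σ.reg R = n ∧ σ.reg (R + 1) = b ∧
      ∀ y, σ.out y = σ₁.out y + ∑ j ∈ Finset.range j, ∑ i ∈ Finset.range (n - b),
        if b + b + j + i = y then f.coeff (b + j) * g.coeff (b + i) else 0)
      (by change _ < W; omega) ?_ ?_ ?_).mono le_rfl ?_
    · rintro j σ ⟨q1, q2, _⟩ _
      rw [IExp.eval_sub, IExp.eval_reg, IExp.eval_reg, q1, q2]
    · exact ⟨by simpa using g1, by simpa using g2, fun y => by simp⟩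
    · rintro j σ hj ⟨q1, q2, qo⟩ hjx
      refine (Run.mulAdd (N := n - b) (α := fun _ => b + j) (β := fun i => b + i)
        (y := fun i => b + b + j + i) ?_ ?_ ?_ ?_ ?_ ?_ ?_ ?_ ?_).mono le_rfl ?_
      · intro r hr
        rw [IExp.eval_sub, IExp.eval_reg, IExp.eval_reg, hr _ (by omega), hr _ (by omega), q1, q2]
      · intro r hr _
        rw [IExp.eval_add, IExp.eval_reg, IExp.eval_reg, hr _ (by omega), hr _ (by omega), q2, hjx]
      · intro r hr _
        rw [IExp.eval_add, IExp.eval_reg, IExp.eval_reg, hr _ (by omega), q2]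
      · intro r hr _
        rw [IExp.eval_add, IExp.eval_add, IExp.eval_add, IExp.eval_reg, IExp.eval_reg,
          IExp.eval_reg, hr _ (by omega), hr _ (by omega), q2, hjx]
      · intro i _
        change _ < n
        omega
      · intro i _
        change _ < n
        omega
      · intro i _
        change _ < 2 * n - 1
        omega
      · exact Nat.one_pos
      · change _ < W
        omega
      · rintro σ' ⟨hr, ho⟩
        refine ⟨by rw [hr _ (by omega), hjx], ?_, ?_, fun y => ?_⟩
        · simp [hr, q1]
        · simp [hr, q2]
        · rw [Finset.sum_range_succ, ← add_assoc, ← qo y]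
          exact ho y
    · rintro σ' ⟨_, _, ho⟩ y hy
      rw [ho, ho₁ y (by omega), ← coeff_X_pow_mul_blk_mul_blk, ← coeff_add]
      congr 1
      -- The double sum is exactly the tail product that `partialProduct` subtracts.
      rw [partialProduct, tail, tail]
      ring
  · have : ((n - b : ℕ) : ℝ) ≤ N₀ := by exact_mod_cast hN₀
    have h0 : (0 : ℝ) ≤ ((n - b : ℕ) : ℝ) := Nat.cast_nonneg _
    nlinarith

/-- With m untreated coefficients there are m free registers: k to be completed, 2k - 1 for a
product and `s k` for its work space, which gives the bound m + 1 in `hs`. The function `Φ` is any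
potential that pays for one round. -/
theorem halfAddProg_solvesAt {p : Program K} {J N₀ n d : ℕ} {s : ℕ → ℕ} {t Φ : ℕ → ℝ}
    (hp : ∀ k, 1 ≤ k → SolvesAt p (fullProduct K) k (s k) ((k + 2) ^ d) (t k)) (hn : 1 ≤ n)
    (hN₀ : J + 2 ≤ N₀)
    (hs : ∀ m, N₀ ≤ m → 3 * ((m + J) / (J + 1)) + s ((m + J) / (J + 1)) ≤ m + 1)
    (hΦ : ∀ m, N₀ ≤ m → m ≤ n →
      (2 * J + 1) * (t ((m + J) / (J + 1)) + 2 * ((m + J) / (J + 1) : ℕ)) +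
        Φ (m - (m + J) / (J + 1)) ≤ Φ m)
    (hΦ₀ : ∀ m, 0 ≤ Φ m) :
    SolvesAt (halfAddProg p J N₀) (halfAdditiveLow K) n 1 ((n + 2) ^ (d + 2))
      (Φ n + 2 * N₀ ^ 2) := by
  intro f g h hf hg hh out₀ work₀ hout
  -- The two extra exponents make room for the caller's own indices, which are at most linear in n.
  have hw2 : (n + 2) ^ 2 ≤ (n + 2) ^ (d + 2) := Nat.pow_le_pow_right (by omega) (by omega)
  have hwd : ∀ k ≤ n, (k + 2) ^ d ≤ (n + 2) ^ (d + 2) := fun k hk =>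
    (Nat.pow_le_pow_left (by omega) d).trans (Nat.pow_le_pow_right (by omega) (by omega))
  have hw : 4 * n + 4 ≤ (n + 2) ^ (d + 2) := by nlinarith
  generalize (n + 2) ^ (d + 2) = W at *
  change f.degree < n at hf
  change g.degree < n at hg
  change h.degree < (n - 1 : ℕ) at hh
  rw [halfAddProg]
  have hpR : p.bd ≤ p.bd + 1 := by omega
  have hR : 0 < p.bd + 1 := by omega
  generalize p.bd + 1 = R at *
  refine Run.assign_seq (by change n < W; omega) ?_
  refine Run.assign_seq (by change 0 < W; omega) ?_
  refine (Run.while (Φ := Φ) (Q := fun σ => ∃ b, b ≤ n ∧ n - b ≤ N₀ ∧ HalfAddInv R n f g h b σ)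
    (Inv := fun m σ => ∃ b, m + b = n ∧ HalfAddInv R n f g h b σ) ?_ ?_ n ?_).seq ?_
  · rintro m σ ⟨b, hmb, hI⟩ hlt
    rw [IExp.eval_sub, IExp.eval_reg, IExp.eval_reg, IExp.eval_lit, hI.1, hI.2.1] at hlt
    have hm : N₀ ≤ m := by omega
    have hnb : n - b = m := by omega
    have hk1 : 1 ≤ (m + J) / (J + 1) := by
      rw [Nat.le_div_iff_mul_le (by omega)]
      omega
    have hkm := hs m hm
    refine ⟨m - (m + J) / (J + 1), by omega, _, hΦ m hm (by omega), ?_⟩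
    refine (Run.halfAddRound (hp _ hk1) hpR hR hf hg hh (hwd _ (by omega)) (by omega) (by omega)
      (by rw [hnb]) (by omega) hk1 (by omega) hI).mono le_rfl ?_
    intro σ' h'
    exact ⟨_, by omega, h'⟩
  · rintro m σ ⟨b, hmb, hI⟩ hlt
    rw [IExp.eval_sub, IExp.eval_reg, IExp.eval_reg, IExp.eval_lit, hI.1, hI.2.1] at hlt
    exact ⟨hΦ₀ m, b, by omega, by omega, hI⟩
  · refine ⟨0, by omega, ?_, by simp [IExp.eval], fun y hy => ?_⟩
    · simp [IExp.eval, Function.update_of_ne]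
    · have := hout y (by change y < n - 1; omega)
      change out₀ (0 + y) = _ at this
      rw [zero_add] at this
      refine this.trans ?_
      -- For b = 0 the tails are f and g themselves, so `partialProduct` is h, which the output
      -- initially holds.
      have h0 : ∀ q : K[X], q.degree < n → tail n 0 q = q := by
        intro q hq
        conv_rhs => rw [← blk_coeff hq]
        simp [tail]
      simp [partialProduct, h0 f hf, h0 g hg]
  · rintro σ ⟨b, hb, hbN, hI⟩
    exact Run.halfAddEnd hf hg hh hn hb (by omega) hbN hI

/-! ### Computing the output by windows -/

/-- For `j < J`: run `p`, with its memory in the registers `0, …, m - k - 1` of the output space,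
and add `len` coefficients of its result, from the `s`-th on, to the window that starts at `m - k`.
The standard registers `R`, `R + 1`, `R + 2` hold the size `n` of the problem, the number `m` of
coefficients that are not yet computed and the size `k` of the window; `R + 3` is the loop counter
`j`. -/
def windowLoop (R : ℕ) (p : Program K) (J : IExp) (inp : Bool → IExp → IExp × IExp × Bool × IExp)
    (O : IExp → IExp) (s : ℕ) (len : IExp) : Program K :=
  accLoop (R + 3) (R + 4) J
    (callProg (outLayout inp O (fun e => .reg (R + 2) + e)) R p (.reg (R + 2)))
    (.reg (R + 1) - .reg (R + 2)) (.lit s) len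

theorem ringOnly_windowLoop {p : Program K} (hp : p.RingOnly) (R : ℕ) (J : IExp)
    (inp : Bool → IExp → IExp × IExp × Bool × IExp) (O : IExp → IExp) (s : ℕ) (len : IExp) :
    (windowLoop R p J inp O s len).RingOnly :=
  ringOnly_accLoop (ringOnly_callProg hp _ _ _) _ _ _ _ _ _

/-- The standard registers `R`, `R + 1`, `R + 2` hold `n`, `m`, `k`. -/
def HoldsSizes (R n m k : ℕ) (r : ℕ → ℕ) : Prop := r R = n ∧ r (R + 1) = m ∧ r (R + 2) = k

theorem HoldsSizes.of_agreeOff {R n m k : ℕ} {r r' : ℕ → ℕ} (h : HoldsSizes R n m k r')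
    (hr : AgreeOff R (R + 3) (R + 4) r r') : HoldsSizes R n m k r :=
  ⟨(hr _ (by omega) (by omega) (by omega)).trans h.1,
    (hr _ (by omega) (by omega) (by omega)).trans h.2.1,
    (hr _ (by omega) (by omega) (by omega)).trans h.2.2⟩

/-- Everything below the window is still free: results go to the first k registers, work registers
follow, and both end before m - k because 2k + s ≤ m. The map `o` is the identity, or a reversal
when a high short product is obtained from a low one; `so` skips the results that are not wanted. -/
theorem Run.windowLoop {R : ℕ} {p : Program K} {A : Problem K} {E : Env K} {n m k s B J so l : ℕ}
    {t : ℝ} {JE len : IExp} {inp : Bool → IExp → IExp × IExp × Bool × IExp} {O : IExp → IExp}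
    {o : ℕ → ℕ} {F G : ℕ → K[X]} {res : ℕ → ℕ → K} {σ : State K}
    (hp : SolvesAt p A k s B t) (hH : A.sizeH k = 0) (hAo : A.outSize k = k)
    (hpR : p.bd ≤ R) (hR : 0 < R) (hσ : HoldsSizes R n m k σ.reg)
    (hF : ∀ j < J, (F j).degree < A.sizeF k) (hG : ∀ j < J, (G j).degree < A.sizeG k)
    (hJ : ∀ r, HoldsSizes R n m k r → JE.eval r = J)
    (hl : ∀ r, HoldsSizes R n m k r → len.eval r = l)
    (hinp : ∀ r, HoldsSizes R n m k r → r (R + 3) < J → ∀ b (e : IExp),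
      e.eval r < (if b then A.sizeG k else A.sizeF k) →
      if (inp b e).1.eval r < (inp b e).2.1.eval r then
        (inp b e).2.2.2.eval r < E.inputSize (inp b e).2.2.1 ∧
        E.input (inp b e).2.2.1 ((inp b e).2.2.2.eval r) =
          (if b then G (r (R + 3)) else F (r (R + 3))).coeff (e.eval r)
      else (if b then G (r (R + 3)) else F (r (R + 3))).coeff (e.eval r) = 0)
    (hO : ∀ r, HoldsSizes R n m k r → ∀ e : IExp, e.eval r < k → (O e).eval r = o (e.eval r))
    (ho : ∀ i < k, o i < k) (hoi : ∀ i < k, ∀ j < k, o i = o j → i = j)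
    (hres : ∀ j < J, ∀ i < l, ∃ i' < k, o i' = so + i ∧
      (A.result k (F j) (G j) 0).coeff i' = res j i)
    (hlk : l ≤ k) (hsol : so + l ≤ k) (hspace : 2 * k + s ≤ m) (hm : m ≤ E.outSize)
    (hB : B ≤ E.word) (hJw : J < E.word) (hkw : k < E.word) :
    Run E (windowLoop R p JE inp O so len) σ (J * (t + k)) (fun σ' =>
      HoldsSizes R n m k σ'.reg ∧ ∀ y, m - k ≤ y → σ'.out y = σ.out y +
        ∑ j ∈ Finset.range J, if y < m - k + l then res j (y - (m - k)) else 0) := by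
  refine (Run.accLoop (R := R) (σ := σ) (N := J) (Lmax := k) (t₀ := 0) (t₁ := m - k) (t := t)
    (a := fun _ => m - k) (s := fun _ => so) (l := fun _ => l) (res := res)
    (by omega) (by omega) (fun r hr => hJ r (hσ.of_agreeOff hr)) ?_ ?_ ?_ hJw (fun _ _ => hlk) hkw
    (by omega) ?_ ?_ ?_).mono le_rfl ?_
  · intro r hr _
    obtain ⟨h1, h2, h3⟩ := hσ.of_agreeOff hr
    rw [IExp.eval_sub, IExp.eval_reg, IExp.eval_reg, h2, h3]
  · intro r hr _
    rfl
  · intro r hr _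
    exact hl r (hσ.of_agreeOff hr)
  · intro j _
    omega
  · intro j _ _
    omega
  · intro j hj τ hτ hτj
    have hag : ∀ r : ℕ → ℕ, (∀ x, R ≤ x → r x = τ.reg x) →
        HoldsSizes R n m k r ∧ r (R + 3) = j := by
      intro r hr
      refine ⟨hσ.of_agreeOff fun z hz h1 h2 => ?_, ?_⟩
      · rw [hr z hz, hτ z hz h1 h2]
      · rw [hr _ (by omega), hτj]
    have hτr := hσ.of_agreeOff hτ
    refine (hp.callOut (τ := τ) (E := E) hH (kE := .reg (R + 2)) (F := F j) (G := G j) (o := o)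
      (wb := k) (t₀ := 0) (t₁ := m - k) hpR hR (hF j hj) (hG j hj) hτr.2.2 hkw hB
      ?_ ?_ ?_ ?_ ?_ (by omega) (by omega) (by omega)).mono le_rfl ?_
    · intro r hr b e he
      obtain ⟨h1, h2⟩ := hag r hr
      have := hinp r h1 (by omega) b e he
      rwa [h2] at this
    · intro r hr e he
      exact hO r (hag r hr).1 e (by omega)
    · intro r hr e
      rw [IExp.eval_add, IExp.eval_reg, (hag r hr).1.2.2]
    · intro i hi
      exact ⟨by omega, ho i (by omega)⟩
    · intro i hi i' hi' h
      exact hoi i (by omega) i' (by omega) h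
    · rintro τ' ⟨h1, h2, h3⟩
      refine ⟨h1, h2, fun i hi => ?_⟩
      obtain ⟨i', hi', ho', hr'⟩ := hres j hj i hi
      rw [← ho', h3 i' (by omega), hr']
  · rintro σ' ⟨hr, hout⟩
    refine ⟨hσ.of_agreeOff hr, fun y hy => ?_⟩
    rw [hout y (by omega)]
    congr 1
    refine Finset.sum_congr rfl fun j _ => ?_
    by_cases h : y < m - k + l
    · rw [if_pos h, if_pos ⟨hy, h⟩]
    · rw [if_neg h, if_neg fun hh => h hh.2]

/-- As long as at least `N₀` coefficients of the output are missing, compute with `body` the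
window formed by the last `kE` of them; then compute the other ones by the definition. -/
def windowProg (R N₀ : ℕ) (kE : IExp) (body : Program K) (len : IExp) (b₁ b₂ : Bool)
    (e₁ e₂ : IExp) : Program K :=
  .seq (.assign R (.reg 0)) <| .seq (.assign (R + 1) (.reg R)) <|
  .seq (.whileLt (.lit (N₀ - 1)) (.reg (R + 1)) <|
    .seq (.assign (R + 2) kE) <|
    .seq (zeroOut (R + 4) (.reg (R + 1) - .reg (R + 2)) (.reg (R + 2))) <|
    .seq body (.assign (R + 1) (.reg (R + 1) - .reg (R + 2)))) <|
  .seq (zeroOut (R + 4) (.lit 0) (.reg (R + 1)))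
    (forUp (R + 3) (.reg (R + 1)) (mulAdd (R + 4) len b₁ b₂ e₁ e₂ (.reg (R + 3))))

theorem ringOnly_windowProg {body : Program K} (hb : body.RingOnly) (R N₀ : ℕ) (kE len : IExp)
    (b₁ b₂ : Bool) (e₁ e₂ : IExp) : (windowProg R N₀ kE body len b₁ b₂ e₁ e₂).RingOnly :=
  ⟨trivial, trivial, ⟨trivial, ringOnly_zeroOut _ _ _, hb, trivial⟩, ringOnly_zeroOut _ _ _,
    ringOnly_forUp (ringOnly_mulAdd _ _ _ _ _ _ _)⟩

/-- This is the skeleton common to short and middle products: `tgt` is the desired output, and the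
invariant says that its coefficients from `m` on are in place. The hypotheses on `α` and `β` concern
only the final direct computation of the few lowest coefficients. -/
theorem Run.windowProg {R N₀ n Lmax : ℕ} {E : Env K} {body : Program K} {kE len e₁ e₂ : IExp}
    {b₁ b₂ : Bool} {κ l : ℕ → ℕ} {α β : ℕ → ℕ → ℕ} {τ Φ : ℕ → ℝ} {tgt out₀ work₀ : ℕ → K}
    (hout : E.outSize = n) (hwork : 0 < E.workSize) (hw : n < E.word)
    (hLw : Lmax < E.word) (hN₀ : 1 ≤ N₀)
    (hkE : ∀ (r : ℕ → ℕ) m, N₀ ≤ m → r R = n → r (R + 1) = m → kE.eval r = κ m)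
    (hκ : ∀ m, N₀ ≤ m → 1 ≤ κ m ∧ κ m ≤ m)
    (hbody : ∀ m σ, N₀ ≤ m → m ≤ n → HoldsSizes R n m (κ m) σ.reg → Run E body σ (τ m) (fun σ' =>
      HoldsSizes R n m (κ m) σ'.reg ∧ ∀ y, m - κ m ≤ y → y < n →
        σ'.out y = σ.out y + if y < m then tgt y else 0))
    (hΦ : ∀ m, N₀ ≤ m → m ≤ n → τ m + Φ (m - κ m) ≤ Φ m) (hΦ₀ : ∀ m, 0 ≤ Φ m)
    (hl : ∀ r : ℕ → ℕ, r R = n → r (R + 3) < n → len.eval r = l (r (R + 3)))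
    (hlL : ∀ j < n, l j ≤ Lmax)
    (h₁ : ∀ r : ℕ → ℕ, r R = n → r (R + 3) < n → r (R + 4) < l (r (R + 3)) →
      e₁.eval r = α (r (R + 3)) (r (R + 4)))
    (h₂ : ∀ r : ℕ → ℕ, r R = n → r (R + 3) < n → r (R + 4) < l (r (R + 3)) →
      e₂.eval r = β (r (R + 3)) (r (R + 4)))
    (hα : ∀ j < n, ∀ i < l j, α j i < E.inputSize b₁)
    (hβ : ∀ j < n, ∀ i < l j, β j i < E.inputSize b₂)
    (htgt : ∀ j < n, tgt j = ∑ i ∈ Finset.range (l j), E.input b₁ (α j i) * E.input b₂ (β j i)) :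
    Run E (windowProg R N₀ kE body len b₁ b₂ e₁ e₂)
      ⟨Function.update (fun _ => 0) 0 n, out₀, work₀⟩ (Φ n + N₀ * (2 * Lmax))
      (fun σ' => ∀ y < n, σ'.out y = tgt y) := by
  refine Run.assign_seq (by simpa [IExp.eval]) ?_
  refine Run.assign_seq (by simpa [IExp.eval]) ?_
  refine (Run.while (Φ := Φ) (Q := fun σ => ∃ m ≤ n, m ≤ N₀ ∧ σ.reg R = n ∧ σ.reg (R + 1) = m ∧
      ∀ y, m ≤ y → y < n → σ.out y = tgt y)
    (Inv := fun m σ => m ≤ n ∧ σ.reg R = n ∧ σ.reg (R + 1) = m ∧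
      ∀ y, m ≤ y → y < n → σ.out y = tgt y) ?_ ?_ n ?_).seq ?_
  · rintro m σ ⟨hmn, h1, h2, h3⟩ hlt
    rw [IExp.eval_reg, IExp.eval_lit, h2] at hlt
    have hm : N₀ ≤ m := by omega
    obtain ⟨hk1, hkm⟩ := hκ m hm
    refine ⟨m - κ m, by omega, τ m, hΦ m hm hmn, ?_⟩
    have hev : kE.eval σ.reg = κ m := hkE _ m hm h1 h2
    refine Run.assign_seq (by rw [hev]; omega) ?_
    rw [hev, ← zero_add (τ m)]
    refine (Run.zeroOut (a := m - κ m) (N := κ m) ?_ ?_ (by omega) (by omega)).seq ?_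
    · intro r hr
      rw [IExp.eval_sub, IExp.eval_reg, IExp.eval_reg, hr _ (by omega), hr _ (by omega)]
      simp [h2]
    · intro r hr
      rw [IExp.eval_reg, hr _ (by omega)]
      simp
    rintro σ₁ ⟨hr₁, ho₁⟩
    rw [← add_zero (τ m)]
    refine (hbody m σ₁ hm hmn ⟨?_, ?_, ?_⟩).seq ?_
    · rw [hr₁ _ (by omega)]
      simpa using h1
    · rw [hr₁ _ (by omega)]
      simpa using h2
    · rw [hr₁ _ (by omega)]
      simp
    rintro σ₂ ⟨⟨q1, q2, q3⟩, ho₂⟩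
    have hev₂ : (IExp.reg (R + 1) - IExp.reg (R + 2)).eval σ₂.reg = m - κ m := by
      rw [IExp.eval_sub, IExp.eval_reg, IExp.eval_reg, q2, q3]
    refine Run.assign (by rw [hev₂]; omega) ⟨by omega, by simpa using q1, by simp [hev₂], ?_⟩
    intro y hy hyn
    rw [ho₂ y hy hyn, ho₁]
    by_cases hym : y < m
    · rw [if_pos (by omega), if_pos hym, zero_add]
    · rw [if_neg (by omega), if_neg hym, add_zero]
      exact h3 y (by omega) hyn
  · rintro m σ ⟨hmn, h1, h2, h3⟩ hlt
    rw [IExp.eval_reg, IExp.eval_lit, h2] at hlt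
    exact ⟨hΦ₀ m, m, hmn, by omega, h1, h2, h3⟩
  · exact ⟨le_rfl, by simp [IExp.eval], by simp [IExp.eval], fun y _ _ => by omega⟩
  · rintro σ ⟨m, hmn, hmN, h1, h2, h3⟩
    refine ((Run.zeroOut (a := 0) (N := m) (fun _ _ => rfl) ?_ (by omega) (by omega)).seq
      (t₂ := (m : ℝ) * (2 * Lmax)) (Q₂ := fun σ' => ∀ y < n, σ'.out y = tgt y) ?_).mono
      ?_ fun _ h => h
    · intro r hr
      rw [IExp.eval_reg, hr _ (by omega), h2]
    · rintro σ₁ ⟨hr₁, ho₁⟩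
      have g1 : σ₁.reg R = n := by rw [hr₁ _ (by omega), h1]
      have g2 : σ₁.reg (R + 1) = m := by rw [hr₁ _ (by omega), h2]
      refine (Run.forUp (N := m) (Inv := fun j σ => σ.reg R = n ∧ σ.reg (R + 1) = m ∧
        ∀ y, σ.out y = if y < j then tgt y else σ₁.out y) (by omega) ?_ ?_ ?_).mono le_rfl ?_
      · rintro j σ ⟨_, q2, _⟩ _
        exact q2
      · exact ⟨by simpa using g1, by simpa using g2, fun y => by simp⟩
      · rintro j σ hj ⟨q1, q2, qo⟩ hjx
        have hreg : ∀ r : ℕ → ℕ, (∀ y, y ≠ R + 4 → r y = σ.reg y) → r R = n ∧ r (R + 3) = j :=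
          fun r hr => ⟨by rw [hr _ (by omega), q1], by rw [hr _ (by omega), hjx]⟩
        have hlj := hlL j (by omega)
        refine (Run.mulAdd (N := l j) (α := α j) (β := β j) (y := fun _ => j) ?_ ?_ ?_ ?_
          (hα j (by omega)) (hβ j (by omega)) (by intros; omega) hwork (by omega)).mono ?_ ?_
        · intro r hr
          obtain ⟨w1, w2⟩ := hreg r hr
          rw [hl r w1 (by omega), w2]
        · intro r hr hlt
          obtain ⟨w1, w2⟩ := hreg r hr
          rw [h₁ r w1 (by omega) (by rwa [w2]), w2]
        · intro r hr hlt
          obtain ⟨w1, w2⟩ := hreg r hr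
          rw [h₂ r w1 (by omega) (by rwa [w2]), w2]
        · intro r hr _
          rw [IExp.eval_reg, (hreg r hr).2]
        · have : (l j : ℝ) ≤ Lmax := by exact_mod_cast hlj
          linarith
        · rintro σ' ⟨hr, ho⟩
          refine ⟨by rw [hr _ (by omega), hjx], ?_, ?_, fun y => ?_⟩
          · simp [hr, q1]
          · simp [hr, q2]
          · refine (ho y).trans ?_
            rw [qo]
            rcases lt_trichotomy y j with h | h | h
            · rw [if_pos h, if_pos (by omega), Finset.sum_eq_zero, add_zero]
              intro i _
              rw [if_neg (by omega)]
            · subst h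
              rw [if_neg (by omega), if_pos (by omega), ho₁, if_pos (by omega), zero_add,
                htgt y (by omega)]
              exact Finset.sum_congr rfl fun i _ => if_pos rfl
            · rw [if_neg (by omega), if_neg (by omega), Finset.sum_eq_zero, add_zero]
              intro i _
              rw [if_neg (by omega)]
      · rintro σ' ⟨_, _, ho⟩ y hy
        rw [ho]
        split_ifs with h
        · rfl
        · rw [ho₁, if_neg (by omega), h3 y (by omega) hy]
    · rw [zero_add]
      have : (m : ℝ) ≤ N₀ := by exact_mod_cast hmN
      gcongr

/-! ### Quotients and remainders by powers of `X` -/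

theorem coeff_divByMonic_X_pow (f : K[X]) (n i : ℕ) :
    (f /ₘ X ^ n).coeff i = f.coeff (n + i) := by
  conv_rhs => rw [← modByMonic_add_div f (X ^ n)]
  have h : (f %ₘ X ^ n).degree < n := by
    simpa using degree_modByMonic_lt f (monic_X_pow (R := K) n)
  rw [coeff_add, coeff_eq_zero_of_size h (by omega), zero_add, coeff_X_pow_mul', if_pos (by omega),
    Nat.add_sub_cancel_left]

theorem coeff_modByMonic_X_pow (f : K[X]) (n i : ℕ) :
    (f %ₘ X ^ n).coeff i = if i < n then f.coeff i else 0 := by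
  have h : (f %ₘ X ^ n).degree < n := by
    simpa using degree_modByMonic_lt f (monic_X_pow (R := K) n)
  split_ifs with hi
  · conv_rhs => rw [← modByMonic_add_div f (X ^ n)]
    rw [coeff_add, coeff_X_pow_mul', if_neg (by omega), add_zero]
  · exact coeff_eq_zero_of_size h (by omega)

/-! ### Reversing the order of the coefficients -/

/-- Reversal with respect to the degree N is multiplicative (`reflect_mul`), and cutting the
reversed factors at size k does not affect the coefficients of their product below k. -/
theorem coeff_reversed_mul {N i : ℕ} {f g : K[X]} (hf : f.natDegree ≤ N) (hg : g.natDegree ≤ N)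
    {k : ℕ} (hik : i < k) (hkN : k ≤ N + 1) (hi : i ≤ 2 * N) :
    (blk k (fun e => f.coeff (N - e)) * blk k (fun e => g.coeff (N - e))).coeff i =
      (f * g).coeff (2 * N - i) := by
  have h := reflect_mul f g hf hg
  have h2 : (f * g).coeff (2 * N - i) = (reflect (N + N) (f * g)).coeff i := by
    rw [coeff_reflect, revAt_le (by omega), two_mul]
  rw [h2, h, coeff_mul, coeff_mul]
  refine Finset.sum_congr rfl fun x hx => ?_
  rw [Finset.HasAntidiagonal.mem_antidiagonal] at hx
  rw [coeff_blk, coeff_blk, coeff_reflect, coeff_reflect, revAt_le (by omega), revAt_le (by omega),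
    if_pos (by omega), if_pos (by omega)]

/-- Turns the upper half of a block product into the lower half of a product of reversed blocks, so
that a low short product algorithm can compute it. -/
theorem coeff_blk_reversed_mul {k i : ℕ} (hi : i < k) (v w : ℕ → K) :
    (blk k (fun e => v (k - 1 - e)) * blk k (fun e => w (k - 1 - e))).coeff i =
      (blk k v * blk k w).coeff (2 * (k - 1) - i) := by
  have hd : ∀ u : ℕ → K, (blk k u).natDegree ≤ k - 1 := fun u =>
    natDegree_le_iff_coeff_eq_zero.2 fun N hN => by rw [coeff_blk, if_neg (by omega)]
  rw [← coeff_reversed_mul (hd v) (hd w) hi (by omega) (by omega)]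
  have hc : ∀ u : ℕ → K, blk k (fun e => u (k - 1 - e)) =
      blk k (fun e => (blk k u).coeff (k - 1 - e)) := by
    intro u
    ext e
    rw [coeff_blk, coeff_blk]
    split_ifs
    · rw [coeff_blk, if_pos (by omega)]
    · rfl
  rw [hc v, hc w]

/-- Run `p` in size `S` with the inputs and the output in the reverse order: it reads the
coefficient `I - e` instead of the coefficient `e` and writes at `O - e` instead of `e`. The
expressions depend on the register that holds the size. -/
def reverseProg (p : Program K) (S I O : IExp → IExp) : Program K :=
  let R := p.bd + 1
  .seq (.assign R (.reg 0)) (callProg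
    ⟨fun b e => (I (.reg R) - e, .reg R, b, I (.reg R) - e),
      fun b e => if b then (true, e) else (false, O (.reg R) - e)⟩ R p (S (.reg R)))

theorem ringOnly_reverseProg {p : Program K} (hp : p.RingOnly) (S I O : IExp → IExp) :
    (reverseProg p S I O).RingOnly :=
  ⟨trivial, ringOnly_callProg hp _ _ _⟩

/-- Only addresses are reflected, so cost and work space do not change. The condition `hO₁` keeps
the truncated subtraction `oV - i` injective on the outputs. A reflected input index may equal or
exceed n; the guard then supplies a zero. -/
theorem reverseProg_solvesAt {p : Program K} {A A' : Problem K} {n k s s' B W iV oV : ℕ} {t : ℝ}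
    {S I O : IExp → IExp} (hp : SolvesAt p A' k s' B t) (hs : s' ≤ s) (hB : B ≤ W) (hkW : k < W)
    (hnW : n < W)
    (hS : ∀ (r : ℕ → ℕ) x, r x = n → (S (.reg x)).eval r = k)
    (hI : ∀ (r : ℕ → ℕ) x, r x = n → (I (.reg x)).eval r = iV)
    (hO : ∀ (r : ℕ → ℕ) x, r x = n → (O (.reg x)).eval r = oV)
    (hAF : A.sizeF n = n) (hAG : A.sizeG n = n)
    (hO₁ : A'.outSize k ≤ oV + 1) (hO₂ : oV < A.outSize n)
    (hA : ∀ f g h : K[X], f.degree < n → g.degree < n → h.degree < A.sizeH n →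
      ∃ F G H : K[X], F.degree < A'.sizeF k ∧ G.degree < A'.sizeG k ∧ H.degree < A'.sizeH k ∧
        (∀ e < A'.sizeF k, F.coeff e = f.coeff (iV - e)) ∧
        (∀ e < A'.sizeG k, G.coeff e = g.coeff (iV - e)) ∧
        (∀ i < A'.sizeH k, ∃ i' < A.sizeH n, oV - (A'.offH k + i) = A.offH n + i' ∧
          h.coeff i' = H.coeff i) ∧
        ∀ i < A.outSize n, ∃ i' < A'.outSize k, oV - i' = i ∧
          (A'.result k F G H).coeff i' = (A.result n f g h).coeff i) :
    SolvesAt (reverseProg p S I O) A n s W t := by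
  intro f g h hf hg hh out₀ work₀ hout
  rw [hAF] at hf
  rw [hAG] at hg
  obtain ⟨F, G, H, hF, hG, hH, cF, cG, cH, hres⟩ := hA f g h hf hg hh
  rw [reverseProg]
  refine Run.assign_seq hnW ?_
  have hev : (IExp.reg 0).eval (Function.update (fun _ => 0) 0 n) = n := by simp [IExp.eval]
  simp only [hev]
  set τ : State K :=
    ⟨Function.update (Function.update (fun _ => 0) 0 n) (p.bd + 1) n, out₀, work₀⟩ with hτ
  have hτR : τ.reg (p.bd + 1) = n := by simp [τ]
  have hfit : (⟨fun b e => (I (.reg (p.bd + 1)) - e, .reg (p.bd + 1), b, I (.reg (p.bd + 1)) - e),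
      fun b e => if b then (true, e) else (false, O (.reg (p.bd + 1)) - e)⟩ : Layout).Fits
      (p.bd + 1) (A'.env k F G s' B) (A.env n f g s W) τ.reg
      (fun q => if q.1 then q else (false, oV - q.2)) := by
    refine ⟨hB, ?_, ?_, ?_, ?_⟩
    · intro r hr b e he
      have hrR : r (p.bd + 1) = n := by rw [hr _ le_rfl, hτR]
      have key : ∀ (q q' : K[X]), q.degree < n → q'.coeff (e.eval r) = q.coeff (iV - e.eval r) →
          if iV - e.eval r < n then iV - e.eval r < n ∧ q.coeff (iV - e.eval r) =
            q'.coeff (e.eval r) else q'.coeff (e.eval r) = 0 := by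
        intro q q' hq hqq
        split_ifs with hlt
        · exact ⟨hlt, hqq.symm⟩
        · rw [hqq]
          exact coeff_eq_zero_of_size hq (by omega)
      simp only [IExp.eval_sub, IExp.eval_reg, hI r _ hrR, hrR]
      cases b
      · have := key f F hf (cF _ he)
        simpa [Problem.env, hAF] using this
      · have := key g G hg (cG _ he)
        simpa [Problem.env, hAG] using this
    · intro r hr b e he
      have hrR : r (p.bd + 1) = n := by rw [hr _ le_rfl, hτR]
      cases b
      · simp [IExp.eval_sub, hO r _ hrR]
      · simp
    · rintro ⟨_ | _, i⟩ hi
      · change oV - i < A.outSize n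
        omega
      · change i < s
        change i < s' at hi
        omega
    · rintro ⟨_ | _, i⟩ ⟨_ | _, j⟩ hi hj hij
      · change i < A'.outSize k at hi
        change j < A'.outSize k at hj
        simp only [Bool.false_eq_true, if_false, Prod.mk.injEq, true_and] at hij ⊢
        omega
      · simp at hij
      · simp at hij
      · simpa using hij
  refine (Run.call hfit (by omega) (by omega) (hS _ _ hτR) hkW
    (hp F G H hF hG hH _ _ ?_)).mono le_rfl ?_
  · intro i hi
    obtain ⟨i', hi', h1, h2⟩ := cH i hi
    simp only [Bool.false_eq_true, if_false, h1, ← h2]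
    exact hout i' hi'
  · rintro τ' ⟨_, _, σ', hσ', hget⟩ i hi
    obtain ⟨i', hi', h1, h2⟩ := hres i hi
    have := hget (false, i') hi'
    simp only [Bool.false_eq_true, if_false, h1] at this
    rw [← h2, ← hσ' i' hi']
    exact this

theorem natDegree_le_of_size {f : K[X]} {n N : ℕ} (hf : f.degree < n) (hN : n ≤ N + 1) :
    f.natDegree ≤ N :=
  natDegree_le_iff_coeff_eq_zero.2 fun _ hi => coeff_eq_zero_of_size hf (by omega)

/-- A low short product in size `n` from a high short product in size `n + 1`. -/
theorem reverseProg_shortProductLow {p : Program K} {n s s' B W : ℕ} {t : ℝ}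
    (hp : SolvesAt p (shortProductHigh K) (n + 1) s' B t) (hs : s' ≤ s) (hn : 1 ≤ n) (hB : B ≤ W)
    (hnW : n + 1 < W) :
    SolvesAt (reverseProg p (fun e => e + .lit 1) (fun e => e) (fun e => e - .lit 1))
      (shortProductLow K) n s W t := by
  refine reverseProg_solvesAt (iV := n) (oV := n - 1) hp hs hB hnW (by omega) ?_ ?_ ?_ rfl rfl ?_
    ?_ ?_
  · intro r x hr
    rw [IExp.eval_add, IExp.eval_reg, hr, IExp.eval_lit]
  · intro r x hr
    exact hr
  · intro r x hr
    rw [IExp.eval_sub, IExp.eval_reg, hr, IExp.eval_lit]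
  · change n + 1 - 1 ≤ _
    omega
  · change _ < n
    omega
  · intro f g h hf hg hh
    -- Reversal in size n + 1 puts a zero at index 0, and the high part of the product then consists
    -- of exactly n coefficients, those of degree n - 1 down to 0 of fg.
    refine ⟨blk (n + 1) (fun e => f.coeff (n - e)), blk (n + 1) (fun e => g.coeff (n - e)), 0,
      degree_blk_lt _ _, degree_blk_lt _ _, by simp [shortProductHigh], ?_, ?_, ?_, ?_⟩
    · intro e he
      rw [coeff_blk]
      exact if_pos he
    · intro e he
      rw [coeff_blk]
      exact if_pos he
    · intro i hi
      exact absurd hi (Nat.not_lt_zero i)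
    · intro i hi
      change i < n at hi
      refine ⟨n - 1 - i, by change _ < n + 1 - 1; omega, by omega, ?_⟩
      have hr : ∀ q : K[X], q.degree < n → blk (n + 1) (fun e => q.coeff (n - e)) = reflect n q := by
        intro q hq
        ext e
        rw [coeff_blk, coeff_reflect]
        split_ifs with he
        · rw [revAt_le (by omega)]
        · rw [revAt_eq_self_of_lt (by omega), coeff_eq_zero_of_size hq (by omega)]
      change (_ /ₘ _).coeff _ = (_ %ₘ _).coeff _
      rw [coeff_divByMonic_X_pow, coeff_modByMonic_X_pow, if_pos hi, hr f hf, hr g hg,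
        ← reflect_mul f g (natDegree_le_of_size hf (by omega)) (natDegree_le_of_size hg (by omega)),
        coeff_reflect, revAt_le (by omega)]
      congr 1
      omega

/-- A high short product in size `n` from a low short product in size `n - 1`. -/
theorem reverseProg_shortProductHigh {p : Program K} {n s s' B W : ℕ} {t : ℝ}
    (hp : SolvesAt p (shortProductLow K) (n - 1) s' B t) (hs : s' ≤ s) (hn : 2 ≤ n) (hB : B ≤ W)
    (hnW : n < W) :
    SolvesAt (reverseProg p (fun e => e - .lit 1) (fun e => e - .lit 1) (fun e => e - .lit 2))
      (shortProductHigh K) n s W t := by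
  refine reverseProg_solvesAt (iV := n - 1) (oV := n - 2) hp hs hB (by omega) (by omega) ?_ ?_ ?_
    rfl rfl ?_ ?_ ?_
  · intro r x hr
    rw [IExp.eval_sub, IExp.eval_reg, hr, IExp.eval_lit]
  · intro r x hr
    rw [IExp.eval_sub, IExp.eval_reg, hr, IExp.eval_lit]
  · intro r x hr
    rw [IExp.eval_sub, IExp.eval_reg, hr, IExp.eval_lit]
  · change n - 1 ≤ _
    omega
  · change _ < n - 1
    omega
  · intro f g h hf hg hh
    refine ⟨blk (n - 1) (fun e => f.coeff (n - 1 - e)), blk (n - 1) (fun e => g.coeff (n - 1 - e)),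
      0, degree_blk_lt _ _, degree_blk_lt _ _, by simp [shortProductLow], ?_, ?_, ?_, ?_⟩
    · intro e he
      rw [coeff_blk]
      exact if_pos he
    · intro e he
      rw [coeff_blk]
      exact if_pos he
    · intro i hi
      exact absurd hi (Nat.not_lt_zero i)
    · intro i hi
      change i < n - 1 at hi
      refine ⟨n - 2 - i, by change _ < n - 1; omega, by omega, ?_⟩
      change (_ %ₘ _).coeff _ = (_ /ₘ _).coeff _
      rw [coeff_divByMonic_X_pow, coeff_modByMonic_X_pow, if_pos (by omega),
        coeff_reversed_mul (natDegree_le_of_size hf (by omega))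
          (natDegree_le_of_size hg (by omega)) (by omega) (by omega) (by omega)]
      congr 1
      omega

/-- The high-order half-additive full product from the low-order one. -/
theorem reverseProg_halfAdditiveHigh {p : Program K} {n s B W : ℕ} {t : ℝ}
    (hp : SolvesAt p (halfAdditiveLow K) n s B t) (hn : 1 ≤ n) (hB : B ≤ W) (hnW : n < W) :
    SolvesAt (reverseProg p (fun e => e) (fun e => e - .lit 1) (fun e => .lit 2 * e - .lit 2))
      (halfAdditiveHigh K) n s W t := by
  refine reverseProg_solvesAt (iV := n - 1) (oV := 2 * n - 2) hp le_rfl hB (by omega) (by omega)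
    ?_ ?_ ?_ rfl rfl ?_ ?_ ?_
  · intro r x hr
    exact hr
  · intro r x hr
    rw [IExp.eval_sub, IExp.eval_reg, hr, IExp.eval_lit]
  · intro r x hr
    rw [IExp.eval_sub, IExp.eval_mul, IExp.eval_reg, hr, IExp.eval_lit]
  · change 2 * n - 1 ≤ _
    omega
  · change _ < 2 * n - 1
    omega
  · intro f g h hf hg hh
    change h.degree < (n - 1 : ℕ) at hh
    refine ⟨blk n (fun e => f.coeff (n - 1 - e)), blk n (fun e => g.coeff (n - 1 - e)),
      blk (n - 1) (fun e => h.coeff (n - 2 - e)), degree_blk_lt _ _, degree_blk_lt _ _,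
      degree_blk_lt _ _, ?_, ?_, ?_, ?_⟩
    · intro e he
      rw [coeff_blk]
      exact if_pos he
    · intro e he
      rw [coeff_blk]
      exact if_pos he
    · intro i hi
      change i < n - 1 at hi
      refine ⟨n - 2 - i, by change _ < n - 1; omega, ?_, ?_⟩
      · change 2 * n - 2 - (0 + i) = n + (n - 2 - i)
        omega
      · rw [coeff_blk, if_pos hi]
    · intro i hi
      change i < 2 * n - 1 at hi
      refine ⟨2 * n - 2 - i, by change _ < 2 * n - 1; omega, by omega, ?_⟩
      have hr : ∀ q : K[X], q.degree < n →
          blk n (fun e => q.coeff (n - 1 - e)) = reflect (n - 1) q := by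
        intro q hq
        ext e
        rw [coeff_blk, coeff_reflect]
        split_ifs with he
        · rw [revAt_le (by omega)]
        · rw [revAt_eq_self_of_lt (by omega), coeff_eq_zero_of_size hq (by omega)]
      change (_ + _ : K[X]).coeff _ = (X ^ n * h + f * g).coeff i
      rw [hr f hf, hr g hg, coeff_add, coeff_add, coeff_X_pow_mul', coeff_blk,
        ← reflect_mul f g (natDegree_le_of_size hf (by omega)) (natDegree_le_of_size hg (by omega)),
        coeff_reflect, revAt_le (by omega)]
      congr 1
      · by_cases hni : n ≤ i
        · rw [if_pos (by omega), if_pos hni]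
          congr 1
          omega
        · rw [if_neg (by omega), if_neg hni]
      · congr 1
        omega

/-! ### The in-place short product -/

theorem coeff_mul_eq_sum_range_of_lt (p q : K[X]) {i N : ℕ} (hN : i < N) : (p * q).coeff i =
    ∑ u ∈ Finset.range N, p.coeff u * if u ≤ i then q.coeff (i - u) else 0 := by
  rw [coeff_mul, Finset.Nat.sum_antidiagonal_eq_sum_range_succ (fun a b => p.coeff a * q.coeff b),
    ← Finset.sum_subset (Finset.range_subset_range.2 hN)]
  · refine Finset.sum_congr rfl fun u hu => ?_
    rw [Finset.mem_range] at hu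
    rw [if_pos (by omega)]
  · intro u _ hu
    rw [Finset.mem_range] at hu
    rw [if_neg (by omega), mul_zero]

theorem coeff_blk_mul_blk (k i : ℕ) (v w : ℕ → K) : (blk k v * blk k w).coeff i =
    ∑ u ∈ Finset.range k, v u * if u ≤ i ∧ i - u < k then w (i - u) else 0 := by
  rw [coeff_mul_eq_sum_range (N := k) (fun j hj => by rw [coeff_blk, if_neg (by omega)])]
  refine Finset.sum_congr rfl fun u hu => ?_
  rw [Finset.mem_range] at hu
  rw [coeff_blk, coeff_blk, if_pos hu]
  congr 1
  split_ifs <;> first | rfl | omega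

theorem sum_range_mul_blocks (J k : ℕ) (φ : ℕ → K) : ∑ u ∈ Finset.range (J * k), φ u =
    ∑ j ∈ Finset.range J, ∑ u ∈ Finset.range k, φ (j * k + u) := by
  induction J with
  | zero => simp
  | succ J ih => rw [Finset.sum_range_succ, ← ih, Nat.succ_mul, Finset.sum_range_add]

/-- The coefficients of `g` from the index `a - d` on; `0` for a negative index. -/
noncomputable def coeffFrom (g : K[X]) (a d u : ℕ) : K :=
  if d ≤ a + u then g.coeff (a + u - d) else 0

/-- The block of f at jk meets 2k - 1 consecutive coefficients of g in the window from m - k to m.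
They are cut at the index m - (j+1)k: the upper piece contributes a low short product, the lower one
a high short product. -/
theorem coeff_window_low {f g : K[X]} {m k J t : ℕ} (hkm : k ≤ m) (hm : m ≤ (J + 1) * k)
    (ht : t < k) :
    ∑ j ∈ Finset.range (J + 1), (blk k (fun u => f.coeff (j * k + u)) *
        blk k (coeffFrom g m ((j + 1) * k))).coeff t +
      ∑ j ∈ Finset.range J, (if m - k + t < m - k + (k - 1) then
        (blk k (fun u => f.coeff (j * k + u)) *
          blk k (coeffFrom g m ((j + 2) * k))).coeff (k + t) else 0) =
      (f * g).coeff (m - k + t) := by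
  -- The high sum can be extended to j = J, because m ≤ (J+1)k makes all indices of g negative
  -- there. The guard excludes only t = k - 1, that is, the coefficient 2k - 1, which vanishes.
  have h1 : ∑ j ∈ Finset.range J, (if m - k + t < m - k + (k - 1) then
      (blk k (fun u => f.coeff (j * k + u)) *
        blk k (coeffFrom g m ((j + 2) * k))).coeff (k + t) else 0) =
      ∑ j ∈ Finset.range (J + 1), (blk k (fun u => f.coeff (j * k + u)) *
        blk k (coeffFrom g m ((j + 2) * k))).coeff (k + t) := by
    rw [Finset.sum_range_succ]
    have h0 : (blk k (fun u => f.coeff (J * k + u)) *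
        blk k (coeffFrom g m ((J + 2) * k))).coeff (k + t) = 0 := by
      rw [coeff_blk_mul_blk]
      refine Finset.sum_eq_zero fun u _ => ?_
      split_ifs with hu
      · rw [coeffFrom, if_neg, mul_zero]
        rw [add_mul] at hm ⊢
        omega
      · rw [mul_zero]
    rw [h0, add_zero]
    refine Finset.sum_congr rfl fun j _ => ?_
    split_ifs
    · rfl
    · refine (coeff_mul_eq_zero (a := k) (b := k) ?_ ?_ (by omega)).symm <;>
      · intro i hi
        rw [coeff_blk, if_neg (by omega)]
  rw [h1, coeff_mul_eq_sum_range_of_lt f g (N := (J + 1) * k) (by omega), sum_range_mul_blocks,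
    ← Finset.sum_add_distrib]
  refine Finset.sum_congr rfl fun j _ => ?_
  rw [coeff_blk_mul_blk, coeff_blk_mul_blk, ← Finset.sum_add_distrib]
  refine Finset.sum_congr rfl fun u hu => ?_
  rw [Finset.mem_range] at hu
  rw [← mul_add]
  congr 1
  simp only [coeffFrom, add_mul]
  generalize j * k = x
  -- Each term occurs in exactly one of the two short products: in the low one for u ≤ t, in the
  -- high one otherwise.
  by_cases hut : u ≤ t
  · rw [if_pos (by omega), if_neg (c := u ≤ k + t ∧ _) (by omega), add_zero]
    by_cases h : x + u ≤ m - k + t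
    · rw [if_pos (by omega), if_pos h]
      congr 1
      omega
    · rw [if_neg (by omega), if_neg h]
  · rw [if_neg (by omega), if_pos (by omega), zero_add]
    by_cases h : x + u ≤ m - k + t
    · rw [if_pos (by omega), if_pos h]
      congr 1
      omega
    · rw [if_neg (by omega), if_neg h]

/-- The inputs of a block product: the `j`-th block of `f`, and the block of `g` that ends `d`
blocks below the index `m`; `u` is the change of index within the blocks. -/
def lowInput (R : ℕ) (d : ℕ) (u : IExp → IExp) (b : Bool) (e : IExp) :
    IExp × IExp × Bool × IExp :=
  if b then ((.reg (R + 3) + .lit d) * .reg (R + 2), .reg (R + 1) + u e + .lit 1, true,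
    .reg (R + 1) + u e - (.reg (R + 3) + .lit d) * .reg (R + 2))
  else (.reg (R + 3) * .reg (R + 2) + u e, .reg R, false, .reg (R + 3) * .reg (R + 2) + u e)

theorem lowInput_spec {R n m k J d : ℕ} {u : IExp → IExp} {uV : ℕ → ℕ} {f g : K[X]} {w W : ℕ}
    (hf : f.degree < n) (hm : m ≤ n) (hd : 1 ≤ d)
    (hu : ∀ r, HoldsSizes R n m k r → ∀ e, e.eval r < k → (u e).eval r = uV (e.eval r))
    (huk : ∀ i < k, uV i < k)
    (r : ℕ → ℕ) (hr : HoldsSizes R n m k r) (_ : r (R + 3) < J) (b : Bool) (e : IExp)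
    (he : e.eval r < k) :
    if (lowInput R d u b e).1.eval r < (lowInput R d u b e).2.1.eval r then
      (lowInput R d u b e).2.2.2.eval r <
        ((shortProductLow K).env n f g w W).inputSize (lowInput R d u b e).2.2.1 ∧
      ((shortProductLow K).env n f g w W).input (lowInput R d u b e).2.2.1
        ((lowInput R d u b e).2.2.2.eval r) =
        (if b then blk k (fun i => coeffFrom g m ((r (R + 3) + d) * k) (uV i))
          else blk k (fun i => f.coeff (r (R + 3) * k + uV i))).coeff (e.eval r)
    else (if b then blk k (fun i => coeffFrom g m ((r (R + 3) + d) * k) (uV i))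
          else blk k (fun i => f.coeff (r (R + 3) * k + uV i))).coeff (e.eval r) = 0 := by
  have hlt := huk _ he
  have hue := hu r hr e he
  obtain ⟨h1, h2, h3⟩ := hr
  cases b
  · simp only [lowInput, Bool.false_eq_true, if_false, IExp.eval_add, IExp.eval_mul, IExp.eval_reg,
      hue, h1, h3, coeff_blk, if_pos he]
    split_ifs with h
    · exact ⟨h, rfl⟩
    · exact coeff_eq_zero_of_size hf (by omega)
  · simp only [lowInput, if_true, IExp.eval_add, IExp.eval_sub, IExp.eval_mul, IExp.eval_reg,
      IExp.eval_lit, hue, h2, h3, coeff_blk, if_pos he, coeffFrom]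
    have hkd : k ≤ (r (R + 3) + d) * k := Nat.le_mul_of_pos_left _ (by omega)
    by_cases h : (r (R + 3) + d) * k ≤ m + uV (e.eval r)
    · rw [if_pos (by omega), if_pos h]
      refine ⟨?_, rfl⟩
      change _ < n
      omega
    · rw [if_neg (by omega), if_neg h]

/-- The computation of a window of the low short product. -/
def lowBody (R : ℕ) (p : Program K) (J : ℕ) : Program K :=
  .seq (windowLoop R p (.lit (J + 1)) (lowInput R 1 fun e => e) (fun e => e) 0 (.reg (R + 2)))
    (windowLoop R p (.lit J) (lowInput R 2 fun e => .reg (R + 2) - .lit 1 - e)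
      (fun e => .reg (R + 2) - .lit 1 - e) 1 (.reg (R + 2) - .lit 1))

theorem Run.lowBody {R n m k s B W J : ℕ} {p : Program K} {f g : K[X]} {t : ℝ} {σ : State K}
    (hp : SolvesAt p (shortProductLow K) k s B t) (hpR : p.bd ≤ R) (hR : 0 < R)
    (hf : f.degree < n) (hk1 : 1 ≤ k) (hmn : m ≤ n) (hkm : 2 * k + s ≤ m) (hm : m ≤ (J + 1) * k)
    (hB : B ≤ W) (hJW : J + 1 < W) (hnW : n < W) (hσ : HoldsSizes R n m k σ.reg) :
    Run ((shortProductLow K).env n f g 1 W) (lowBody R p J) σ ((2 * J + 1) * (t + k)) (fun σ' =>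
      HoldsSizes R n m k σ'.reg ∧ ∀ y, m - k ≤ y → y < n →
        σ'.out y = σ.out y + if y < m then (f * g).coeff y else 0) := by
  have hcost : ((2 * J + 1) * (t + k) : ℝ) = (J + 1 : ℕ) * (t + k) + J * (t + k) := by
    push_cast; ring
  have hu : ∀ r, HoldsSizes R n m k r → ∀ e : IExp, e.eval r < k →
      (.reg (R + 2) - .lit 1 - e : IExp).eval r = k - 1 - e.eval r := by
    intro r hr e _
    rw [IExp.eval_sub, IExp.eval_sub, IExp.eval_reg, IExp.eval_lit, hr.2.2]
  rw [hcost]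
  refine (Run.windowLoop (J := J + 1) (len := .reg (R + 2)) (l := k) (so := 0) (o := fun i => i) (m := m)
    (F := fun j => blk k (fun i => f.coeff (j * k + i)))
    (G := fun j => blk k (coeffFrom g m ((j + 1) * k)))
    (res := fun j i => (blk k (fun i => f.coeff (j * k + i)) *
      blk k (coeffFrom g m ((j + 1) * k))).coeff i)
    hp rfl rfl hpR hR hσ (fun _ _ => degree_blk_lt _ _) (fun _ _ => degree_blk_lt _ _)
    (fun _ _ => rfl) (fun r hr => hr.2.2) ?_ (fun _ _ _ _ => rfl) (fun _ h => h)
    (fun _ _ _ _ h => h) ?_ le_rfl (by omega) hkm hmn hB hJW (by change k < W; omega)).seq ?_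
  · intro r hr hj b e he
    exact lowInput_spec (uV := fun i => i) hf hmn le_rfl (fun _ _ _ _ => rfl) (fun _ h => h) r hr
      hj b e (by cases b <;> exact he)
  · intro j _ i hi
    refine ⟨i, hi, by omega, ?_⟩
    change (_ %ₘ _).coeff i = _
    rw [coeff_modByMonic_X_pow, if_pos hi]
  rintro σ₁ ⟨hσ₁, ho₁⟩
  -- Coefficient k - 2 - i of the low product of reversed blocks is coefficient k + i of the true
  -- product, and the reversed writing puts it into register i + 1. Hence the k - 1 useful values
  -- start at register 1.
  refine (Run.windowLoop (J := J) (l := k - 1) (so := 1) (o := fun i => k - 1 - i) (m := m)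
    (F := fun j => blk k (fun i => f.coeff (j * k + (k - 1 - i))))
    (G := fun j => blk k (fun i => coeffFrom g m ((j + 2) * k) (k - 1 - i)))
    (res := fun j i => (blk k (fun i => f.coeff (j * k + i)) *
      blk k (coeffFrom g m ((j + 2) * k))).coeff (k + i))
    hp rfl rfl hpR hR hσ₁ (fun _ _ => degree_blk_lt _ _) (fun _ _ => degree_blk_lt _ _)
    (fun _ _ => rfl) ?_ ?_ hu (by omega)
    (by omega) ?_ (by omega) ?_ hkm hmn hB (by change J < W; omega) (by change k < W; omega)).mono
    le_rfl ?_
  · intro r hr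
    rw [IExp.eval_sub, IExp.eval_reg, IExp.eval_lit, hr.2.2]
  · intro r hr hj b e he
    exact lowInput_spec (uV := fun i => k - 1 - i) hf hmn (by omega) hu (by omega) r hr hj b e
      (by cases b <;> exact he)
  · intro j _ i hi
    refine ⟨k - 2 - i, by omega, by omega, ?_⟩
    change (_ %ₘ _).coeff _ = _
    rw [coeff_modByMonic_X_pow, if_pos (by omega),
      coeff_blk_reversed_mul (by omega) (fun i => f.coeff (j * k + i))]
    congr 1
    omega
  · omega
  · rintro σ' ⟨hσ', ho⟩
    refine ⟨hσ', fun y hy hyn => ?_⟩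
    rw [ho y hy, ho₁ y hy, add_assoc]
    congr 1
    by_cases hym : y < m
    · rw [if_pos hym]
      have := coeff_window_low (f := f) (g := g) (t := y - (m - k)) (by omega) hm (by omega)
      rw [show m - k + (y - (m - k)) = y by omega] at this
      rw [← this]
      congr 1
      refine Finset.sum_congr rfl fun j _ => ?_
      rw [if_pos (by omega)]
    · rw [if_neg hym, Finset.sum_eq_zero, Finset.sum_eq_zero, add_zero]
      · intro j _
        rw [if_neg (by omega)]
      · intro j _
        rw [if_neg (by omega)]

/-- The in-place low short product, from a low short product program `p`. -/
def lowProg (p : Program K) (J N₀ : ℕ) : Program K :=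
  let R := p.bd + 1
  windowProg R N₀ ((.reg (R + 1) + .lit J) / .lit (J + 1)) (lowBody R p J)
    (.reg (R + 3) + .lit 1) false true (.reg (R + 4)) (.reg (R + 3) - .reg (R + 4))

theorem ringOnly_lowProg {p : Program K} (hp : p.RingOnly) (J N₀ : ℕ) :
    (lowProg p J N₀).RingOnly :=
  ringOnly_windowProg (body := lowBody _ p J) ⟨ringOnly_windowLoop hp _ _ _ _ _ _, ringOnly_windowLoop hp _ _ _ _ _ _⟩
    _ _ _ _ _ _ _ _

theorem lowProg_solvesAt {p : Program K} {J N₀ n d : ℕ} {s : ℕ → ℕ} {t Φ : ℕ → ℝ}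
    (hp : ∀ k, 1 ≤ k → SolvesAt p (shortProductLow K) k (s k) ((k + 2) ^ d) (t k)) (hn : 1 ≤ n)
    (hN₀ : J + 2 ≤ N₀)
    (hs : ∀ m, N₀ ≤ m → 2 * ((m + J) / (J + 1)) + s ((m + J) / (J + 1)) ≤ m)
    (hΦ : ∀ m, N₀ ≤ m → m ≤ n →
      (2 * J + 1) * (t ((m + J) / (J + 1)) + ((m + J) / (J + 1) : ℕ)) +
        Φ (m - (m + J) / (J + 1)) ≤ Φ m)
    (hΦ₀ : ∀ m, 0 ≤ Φ m) :
    SolvesAt (lowProg p J N₀) (shortProductLow K) n 1 ((n + 2) ^ (d + 2))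
      (Φ n + N₀ * (2 * n)) := by
  intro f g h hf hg hh out₀ work₀ hout
  have hw2 : (n + 2) ^ 2 ≤ (n + 2) ^ (d + 2) := Nat.pow_le_pow_right (by omega) (by omega)
  have hwd : ∀ k ≤ n, (k + 2) ^ d ≤ (n + 2) ^ (d + 2) := fun k hk =>
    (Nat.pow_le_pow_left (by omega) d).trans (Nat.pow_le_pow_right (by omega) (by omega))
  have hw : 4 * n + 4 ≤ (n + 2) ^ (d + 2) := by nlinarith
  generalize (n + 2) ^ (d + 2) = W at *
  change f.degree < n at hf
  have hk1 : ∀ m, N₀ ≤ m → 1 ≤ (m + J) / (J + 1) := fun m hm => by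
    rw [Nat.le_div_iff_mul_le (by omega)]
    omega
  refine (Run.windowProg (n := n) (κ := fun m => (m + J) / (J + 1)) (l := fun j => j + 1) (Lmax := n)
    (α := fun _ i => i) (β := fun j i => j - i)
    (τ := fun m => (2 * J + 1) * (t ((m + J) / (J + 1)) + ((m + J) / (J + 1) : ℕ))) (Φ := Φ)
    (tgt := fun y => (f * g).coeff y) rfl Nat.one_pos (by change n < W; omega)
    (by change n < W; omega) (by omega) ?_ ?_ ?_ hΦ hΦ₀ ?_ (by omega) ?_ ?_ ?_ ?_ ?_).mono le_rfl
    ?_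
  · intro r m _ _ h2
    rw [IExp.eval_div, IExp.eval_add, IExp.eval_reg, IExp.eval_lit, IExp.eval_lit, h2]
  · intro m hm
    have := hs m hm
    exact ⟨hk1 m hm, by omega⟩
  · intro m σ hm hmn hσ
    have h1 := hs m hm
    refine Run.lowBody (hp _ (hk1 m hm)) (by omega) (by omega) hf (hk1 m hm) hmn h1 ?_ (hwd _ (by omega))
      (by omega) (by omega) hσ
    have := Nat.lt_div_mul_add (a := m + J) (b := J + 1) (by omega)
    rw [mul_comm]
    omega
  · intro r _ _
    rfl
  · intro r _ _ _
    rfl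
  · intro r _ _ _
    rfl
  · intro j hj i hi
    change _ < n
    omega
  · intro j hj i hi
    change _ < n
    omega
  · intro j _
    rw [coeff_mul,
      Finset.Nat.sum_antidiagonal_eq_sum_range_succ (fun a b => f.coeff a * g.coeff b)]
    rfl
  · intro σ' h' i hi
    rw [h' i hi]
    change _ = (_ %ₘ _).coeff i
    rw [coeff_modByMonic_X_pow]
    exact (if_pos hi).symm

/-! ### The in-place middle product -/

/-- Cutting g into blocks of size k, the block at jk meets 2k - 1 consecutive coefficients of f,
starting at n + m - (j+2)k, in the window: this is a balanced middle product. Negative indices count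
as zeros. -/
theorem coeff_window_mid {f g : K[X]} {n m k J t : ℕ} (hg : g.degree < n) (hk1 : 1 ≤ k)
    (hkm : k ≤ m) (hn : n ≤ J * k) (hn1 : 1 ≤ n) (ht : t < k) :
    ∑ j ∈ Finset.range J, (blk (k + k - 1) (coeffFrom f (n + m) ((j + 2) * k)) *
      blk k (fun u => g.coeff (j * k + u))).coeff (k - 1 + t) =
      (f * g).coeff (n - 1 + (m - k + t)) := by
  rw [mul_comm f, coeff_mul_eq_sum_range (N := J * k)
    (fun j hj => coeff_eq_zero_of_size hg (by omega)), sum_range_mul_blocks]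
  refine Finset.sum_congr rfl fun j _ => ?_
  rw [mul_comm, coeff_mul_eq_sum_range (N := k) (fun j hj => by rw [coeff_blk, if_neg (by omega)])]
  refine Finset.sum_congr rfl fun u hu => ?_
  rw [Finset.mem_range] at hu
  rw [coeff_blk, coeff_blk, if_pos hu, if_pos (by omega), if_pos (by omega)]
  congr 1
  simp only [coeffFrom, add_mul]
  generalize j * k = x
  by_cases h : x + u ≤ n - 1 + (m - k + t)
  · rw [if_pos (by omega), if_pos h]
    congr 1
    omega
  · rw [if_neg (by omega), if_neg h]

/-- The inputs of the `j`-th block product of a window of the middle product. -/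
def midInput (R : ℕ) (b : Bool) (e : IExp) : IExp × IExp × Bool × IExp :=
  if b then (.reg (R + 3) * .reg (R + 2) + e, .reg R, true, .reg (R + 3) * .reg (R + 2) + e)
  else ((.reg (R + 3) + .lit 2) * .reg (R + 2), .reg R + .reg (R + 1) + e + .lit 1, false,
    .reg R + .reg (R + 1) + e - (.reg (R + 3) + .lit 2) * .reg (R + 2))

/-- The computation of a window of the middle product. -/
def midBody (R : ℕ) (p : Program K) : Program K :=
  windowLoop R p ((.reg R + .reg (R + 2) - .lit 1) / .reg (R + 2)) (midInput R) (fun e => e) 0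
    (.reg (R + 2))

theorem Run.midBody {R n m k s B W : ℕ} {p : Program K} {f g : K[X]} {t : ℝ} {σ : State K}
    (hp : SolvesAt p (middleProduct K) k s B t) (hpR : p.bd ≤ R) (hR : 0 < R)
    (hg : g.degree < n) (hk1 : 1 ≤ k) (hmn : m ≤ n) (hkm : 2 * k + s ≤ m)
    (hB : B ≤ W) (hnW : 2 * n < W) (hσ : HoldsSizes R n m k σ.reg) :
    Run ((middleProduct K).env n f g 1 W) (midBody R p) σ (((n + k - 1) / k : ℕ) * (t + k))
      (fun σ' => HoldsSizes R n m k σ'.reg ∧ ∀ y, m - k ≤ y → y < n →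
        σ'.out y = σ.out y + if y < m then (f * g).coeff (n - 1 + y) else 0) := by
  have hJn : n ≤ (n + k - 1) / k * k := by
    have := Nat.lt_div_mul_add (a := n + k - 1) (b := k) (by omega)
    omega
  have hJW : (n + k - 1) / k < W := (Nat.div_le_self _ _).trans_lt (by omega)
  refine (Run.windowLoop (J := (n + k - 1) / k) (l := k) (so := 0) (o := fun i => i) (m := m)
    (len := .reg (R + 2))
    (F := fun j => blk (k + k - 1) (coeffFrom f (n + m) ((j + 2) * k)))
    (G := fun j => blk k (fun i => g.coeff (j * k + i)))
    (res := fun j i => (blk (k + k - 1) (coeffFrom f (n + m) ((j + 2) * k)) *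
      blk k (fun i => g.coeff (j * k + i))).coeff (k - 1 + i))
    hp rfl rfl hpR hR hσ (fun _ _ => degree_blk_lt _ _) (fun _ _ => degree_blk_lt _ _)
    ?_ (fun r hr => hr.2.2) ?_ (fun _ _ _ _ => rfl) (fun _ h => h)
    (fun _ _ _ _ h => h) ?_ le_rfl (by omega) hkm hmn hB hJW (by change k < W; omega)).mono
    le_rfl ?_
  · intro r hr
    rw [IExp.eval_div, IExp.eval_sub, IExp.eval_add, IExp.eval_reg, IExp.eval_reg, IExp.eval_lit,
      hr.1, hr.2.2]
  · intro r hr hj b e he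
    obtain ⟨h1, h2, h3⟩ := hr
    cases b
    · have he' : e.eval r < k + k - 1 := he
      have hkd : 2 * k ≤ (r (R + 3) + 2) * k := Nat.mul_le_mul_right _ (by omega)
      simp only [midInput, Bool.false_eq_true, if_false, IExp.eval_add, IExp.eval_sub,
        IExp.eval_mul, IExp.eval_reg, IExp.eval_lit, h1, h2, h3, coeff_blk, if_pos he', coeffFrom]
      by_cases h : (r (R + 3) + 2) * k ≤ n + m + e.eval r
      · rw [if_pos (by omega), if_pos h]
        refine ⟨?_, rfl⟩
        change _ < n + n - 1
        omega
      · rw [if_neg (by omega), if_neg h]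
    · have he' : e.eval r < k := he
      simp only [midInput, if_true, IExp.eval_add, IExp.eval_mul, IExp.eval_reg, h1, h3,
        coeff_blk, if_pos he']
      split_ifs with h
      · exact ⟨h, rfl⟩
      · exact coeff_eq_zero_of_size hg (by omega)
  · intro j _ i hi
    refine ⟨i, hi, by omega, ?_⟩
    change ((_ /ₘ _) %ₘ _).coeff i = _
    rw [coeff_modByMonic_X_pow, if_pos hi, coeff_divByMonic_X_pow]
  · rintro σ' ⟨hσ', ho⟩
    refine ⟨hσ', fun y hy hyn => ?_⟩
    rw [ho y hy]
    congr 1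
    by_cases hym : y < m
    · rw [if_pos hym]
      have := coeff_window_mid (f := f) (m := m) (t := y - (m - k)) hg hk1 (by omega) hJn
        (by omega) (by omega)
      rw [show m - k + (y - (m - k)) = y by omega] at this
      rw [← this]
      refine Finset.sum_congr rfl fun j _ => ?_
      rw [if_pos (by omega)]
    · rw [if_neg hym]
      refine Finset.sum_eq_zero fun j _ => ?_
      rw [if_neg (by omega)]

/-- The in-place middle product, from a middle product program `p`; the windows have size
`⌊a * m / b⌋`, where `m` is the number of coefficients that are not yet computed. -/
def midProg (p : Program K) (a b N₀ : ℕ) : Program K :=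
  let R := p.bd + 1
  windowProg R N₀ (.lit a * .reg (R + 1) / .lit b) (midBody R p) (.reg R) true false
    (.reg (R + 4)) (.reg R - .lit 1 + .reg (R + 3) - .reg (R + 4))

theorem ringOnly_midProg {p : Program K} (hp : p.RingOnly) (a b N₀ : ℕ) :
    (midProg p a b N₀).RingOnly :=
  ringOnly_windowProg (body := midBody _ p) (ringOnly_windowLoop hp _ _ _ _ _ _) _ _ _ _ _ _ _ _

theorem midProg_solvesAt {p : Program K} {a b N₀ n d : ℕ} {s : ℕ → ℕ} {t Φ : ℕ → ℝ}
    (hp : ∀ k, 1 ≤ k → SolvesAt p (middleProduct K) k (s k) ((k + 2) ^ d) (t k)) (hn : 1 ≤ n)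
    (hN₀ : 1 ≤ N₀)
    (hk1 : ∀ m, N₀ ≤ m → 1 ≤ a * m / b)
    (hs : ∀ m, N₀ ≤ m → 2 * (a * m / b) + s (a * m / b) ≤ m)
    (hΦ : ∀ m, N₀ ≤ m → m ≤ n →
      ((n + a * m / b - 1) / (a * m / b) : ℕ) * (t (a * m / b) + (a * m / b : ℕ)) +
        Φ (m - a * m / b) ≤ Φ m)
    (hΦ₀ : ∀ m, 0 ≤ Φ m) :
    SolvesAt (midProg p a b N₀) (middleProduct K) n 1 ((n + 2) ^ (d + 2))
      (Φ n + N₀ * (2 * n)) := by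
  intro f g h hf hg hh out₀ work₀ hout
  have hw2 : (n + 2) ^ 2 ≤ (n + 2) ^ (d + 2) := Nat.pow_le_pow_right (by omega) (by omega)
  have hwd : ∀ k ≤ n, (k + 2) ^ d ≤ (n + 2) ^ (d + 2) := fun k hk =>
    (Nat.pow_le_pow_left (by omega) d).trans (Nat.pow_le_pow_right (by omega) (by omega))
  have hw : 4 * n + 4 ≤ (n + 2) ^ (d + 2) := by nlinarith
  generalize (n + 2) ^ (d + 2) = W at *
  change g.degree < n at hg
  refine (Run.windowProg (n := n) (κ := fun m => a * m / b) (l := fun _ => n) (Lmax := n)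
    (α := fun _ i => i) (β := fun j i => n - 1 + j - i)
    (τ := fun m => ((n + a * m / b - 1) / (a * m / b) : ℕ) * (t (a * m / b) + (a * m / b : ℕ)))
    (Φ := Φ) (tgt := fun y => (f * g).coeff (n - 1 + y)) rfl Nat.one_pos (by change n < W; omega)
    (by change n < W; omega) hN₀ ?_ ?_ ?_ hΦ hΦ₀ ?_ (by omega) ?_ ?_ ?_ ?_ ?_).mono le_rfl
    ?_
  · intro r m _ _ h2
    rw [IExp.eval_div, IExp.eval_mul, IExp.eval_reg, IExp.eval_lit, IExp.eval_lit, h2]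
  · intro m hm
    have := hs m hm
    exact ⟨hk1 m hm, by omega⟩
  · intro m σ hm hmn hσ
    have h1 := hs m hm
    exact Run.midBody (hp _ (hk1 m hm)) (by omega) (by omega) hg (hk1 m hm) hmn h1
      (hwd _ (by omega)) (by omega) hσ
  · intro r h _
    exact h
  · intro r _ _ _
    rfl
  · intro r h _ _
    rw [IExp.eval_sub, IExp.eval_add, IExp.eval_sub, IExp.eval_reg, IExp.eval_reg, IExp.eval_reg,
      IExp.eval_lit, h]
  · intro j hj i hi
    exact hi
  · intro j hj i hi
    change _ < n + n - 1
    omega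
  · intro j hj
    rw [mul_comm, coeff_mul_eq_sum_range (N := n) fun i hi => coeff_eq_zero_of_size hg hi]
    refine Finset.sum_congr rfl fun i hi => ?_
    rw [Finset.mem_range] at hi
    rw [if_pos (by omega)]
    rfl
  · intro σ' h' i hi
    rw [h' i hi]
    change _ = ((_ /ₘ _) %ₘ _).coeff i
    rw [coeff_modByMonic_X_pow, coeff_divByMonic_X_pow]
    exact (if_pos hi).symm

/-! ### Complexity bounds -/

theorem SolvesAt.mono {p : Program K} {A : Problem K} {n s B : ℕ} {t t' : ℝ}
    (h : SolvesAt p A n s B t) (ht : t ≤ t') : SolvesAt p A n s B t' :=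
  fun f g h' hf hg hh out₀ work₀ hout =>
    (h f g h' hf hg hh out₀ work₀ hout).mono ht fun _ h => h

/-! ### Regular time bounds -/

variable {M : ℕ → ℝ}

theorem Regular.pos (hM : Regular M) {n : ℕ} (hn : 1 ≤ n) : 0 < M n := hM.1 n hn

/-- Regularity is mostly used in this form: with the slope M(n)/n fixed, the costs of calls in sizes
at most n are bounded linearly, so that they telescope with the sizes. -/
theorem Regular.le_mul (hM : Regular M) {k n : ℕ} (hk : 1 ≤ k) (hkn : k ≤ n) :
    M k ≤ M n / n * k := by
  have h := hM.2 (Set.mem_Ici.2 hk) (Set.mem_Ici.2 (hk.trans hkn)) hkn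
  have hk0 : (0 : ℝ) < k := by exact_mod_cast hk
  rwa [div_le_iff₀ hk0] at h

theorem Regular.mono (hM : Regular M) {k n : ℕ} (hk : 1 ≤ k) (hkn : k ≤ n) : M k ≤ M n := by
  have hn0 : (0 : ℝ) < n := by exact_mod_cast hk.trans hkn
  have hkn' : (k : ℝ) ≤ n := by exact_mod_cast hkn
  refine (hM.le_mul hk hkn).trans ?_
  rw [div_mul_eq_mul_div, div_le_iff₀ hn0]
  exact mul_le_mul_of_nonneg_left hkn' (hM.pos (hk.trans hkn)).le

/-- Gives n = O(M(n)) for the middle product, where n = o(M(n)) is not assumed. -/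
theorem Regular.cast_le (hM : Regular M) {n : ℕ} (hn : 1 ≤ n) : (n : ℝ) ≤ M n / M 1 := by
  have h := hM.le_mul le_rfl hn
  have hn0 : (0 : ℝ) < n := by exact_mod_cast hn
  rw [le_div_iff₀ (hM.pos le_rfl)]
  rw [Nat.cast_one, mul_one, le_div_iff₀ hn0] at h
  linarith

/-- With `J + 1 > x`, blocks of size `k = ⌈m / (J + 1)⌉` satisfy `x * k + a ≤ m` for large `m`. -/
theorem exists_threshold (x a : ℚ) (J : ℕ) (hx₀ : 0 ≤ x) (hx : x < J + 1) :
    ∃ N₀, J + 2 ≤ N₀ ∧ ∀ m, N₀ ≤ m → x * ((m + J) / (J + 1) : ℕ) + a ≤ m := by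
  -- Since k ≤ (m + J)/(J + 1), it suffices that (J + 1 - x)·m is at least x·J + a·(J + 1).
  refine ⟨max (J + 2) ⌈(x * J + a * (J + 1)) / (J + 1 - x)⌉₊, le_max_left _ _, fun m hm => ?_⟩
  have h1 : (x * J + a * (J + 1)) / (J + 1 - x) ≤ m :=
    (Nat.le_ceil _).trans (by exact_mod_cast (le_max_right _ _).trans hm)
  rw [div_le_iff₀ (by linarith)] at h1
  have hJ : (0 : ℚ) < J + 1 := by positivity
  have h2 : (((m + J) / (J + 1) : ℕ) : ℚ) ≤ (m + J) / (J + 1) := by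
    refine Nat.cast_div_le.trans ?_
    push_cast
    exact le_rfl
  have h3 : x * ((m + J) / (J + 1) : ℕ) ≤ x * ((m + J) / (J + 1)) :=
    mul_le_mul_of_nonneg_left h2 hx₀
  have h4 : x * ((m + J) / (J + 1)) + a ≤ m := by
    rw [← mul_div_assoc, div_add' _ _ _ hJ.ne', div_le_iff₀ hJ]
    linarith
  linarith

theorem one_le_ceil_div {m J : ℕ} (hm : J + 2 ≤ m) : 1 ≤ (m + J) / (J + 1) := by
  rw [Nat.le_div_iff_mul_le (by omega)]
  omega

theorem le_mul_ceil_div (m J : ℕ) : m ≤ (J + 1) * ((m + J) / (J + 1)) := by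
  have := Nat.lt_div_mul_add (a := m + J) (b := J + 1) (by omega)
  rw [mul_comm]
  omega

theorem cast_floor_mul_le {c : ℚ} (hc : 0 ≤ c) (k : ℕ) : ((⌊c * k⌋₊ : ℕ) : ℚ) ≤ c * k :=
  Nat.floor_le (by positivity)

theorem two_mul_floor_le {c : ℚ} (hc : 0 ≤ c) : 2 * (⌊c⌋₊ : ℝ) ≤ 2 * (c : ℝ) := by
  have : ((⌊c⌋₊ : ℕ) : ℚ) ≤ c := Nat.floor_le hc
  have : (((⌊c⌋₊ : ℕ) : ℚ) : ℝ) ≤ c := by exact_mod_cast this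
  push_cast at this
  linarith

/-- A round needs about (c+3)k registers, so J + 1 must exceed c + 3; the least such J is ⌊c⌋+3, and
2J+1 ≤ 2c+7. The potential is linear in m: a round that treats k coefficients costs at most
(2J+1)(M(n)/n + 2)·k. -/
theorem exists_halfAdd {c : ℚ} (hc : 0 ≤ c) : ∃ J N₀ : ℕ, ∃ D : ℝ, ∀ (p : Program K) (M : ℕ → ℝ)
    (d : ℕ), Regular M →
    (∀ k, 1 ≤ k → SolvesAt p (fullProduct K) k ⌊c * k⌋₊ ((k + 2) ^ d) (M k)) →
    ∀ n, 1 ≤ n → SolvesAt (halfAddProg p J N₀) (halfAdditiveLow K) n 1 ((n + 2) ^ (d + 2))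
      ((2 * (c : ℝ) + 7) * M n + D * n) := by
  have hcJ : c + 3 < (⌊c⌋₊ + 3 : ℕ) + 1 := by
    have := Nat.lt_floor_add_one c
    push_cast
    linarith
  obtain ⟨N₀, hN₀, hthr⟩ := exists_threshold (c + 3) 0 (⌊c⌋₊ + 3) (by linarith) hcJ
  set J := ⌊c⌋₊ + 3 with hJ
  refine ⟨J, N₀, 2 * (2 * J + 1) + 2 * N₀ ^ 2, fun p M d hM hp n hn => ?_⟩
  have hn1 : (1 : ℝ) ≤ n := by exact_mod_cast hn
  have hMn := hM.pos hn
  have hμ : 0 < M n / n := div_pos hMn (by linarith)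
  refine (halfAddProg_solvesAt (Φ := fun m => (2 * J + 1) * (M n / n + 2) * m) hp hn hN₀ ?_ ?_
    ?_).mono ?_
  · intro m hm
    have h1 := hthr m hm
    have h2 := cast_floor_mul_le hc ((m + J) / (J + 1))
    generalize (m + J) / (J + 1) = k at *
    have : ((3 * k + ⌊c * k⌋₊ : ℕ) : ℚ) ≤ (m + 1 : ℕ) := by
      push_cast
      linarith
    exact_mod_cast this
  · intro m hm hmn
    have hk1 := one_le_ceil_div (hN₀.trans hm)
    have hkm : (m + J) / (J + 1) ≤ m := by
      have : (((m + J) / (J + 1) : ℕ) : ℚ) ≤ m := by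
        have h1 := hthr m hm
        have : (0 : ℚ) ≤ ((m + J) / (J + 1) : ℕ) := Nat.cast_nonneg _
        nlinarith
      exact_mod_cast this
    have h1 := hM.le_mul hk1 (hkm.trans hmn)
    rw [Nat.cast_sub hkm]
    generalize (m + J) / (J + 1) = k at *
    have hJ0 : (0 : ℝ) ≤ 2 * J + 1 := by positivity
    have := mul_le_mul_of_nonneg_left h1 hJ0
    nlinarith
  · intro m
    positivity
  · have h1 : (M n / n + 2) * n = M n + 2 * n := by
      field_simp
    have h2 : (2 * (J : ℝ) + 1) * M n ≤ (2 * c + 7) * M n := by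
      refine mul_le_mul_of_nonneg_right ?_ hMn.le
      have := two_mul_floor_le hc
      rw [hJ]
      push_cast
      linarith
    have h3 : (2 * (N₀ : ℝ) ^ 2) ≤ 2 * N₀ ^ 2 * n := le_mul_of_one_le_right (by positivity) hn1
    rw [mul_assoc, h1]
    linarith

/-- Used to count rounds: √m - √(m-k) = k/(√m + √(m-k)) ≥ k/(2√m) ≥ √m/(2(J+1)). A bound O(√n) on
their number is crude but suffices for an error term o(M(n)). -/
theorem sqrt_step {m J k : ℕ} (hm : 1 ≤ m) (hkm : k ≤ m) (hk : m ≤ (J + 1) * k) :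
    1 + 2 * (J + 1) * √((m - k : ℕ) : ℝ) ≤ 2 * (J + 1) * √(m : ℝ) := by
  have ha := Real.sq_sqrt (Nat.cast_nonneg (α := ℝ) m)
  have hb := Real.sq_sqrt (Nat.cast_nonneg (α := ℝ) (m - k))
  have hab : √((m - k : ℕ) : ℝ) ≤ √(m : ℝ) := Real.sqrt_le_sqrt (by exact_mod_cast Nat.sub_le _ _)
  have ha1 : 1 ≤ √(m : ℝ) := Real.one_le_sqrt.2 (by exact_mod_cast hm)
  have hb0 : 0 ≤ √((m - k : ℕ) : ℝ) := Real.sqrt_nonneg _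
  rw [Nat.cast_sub hkm] at *
  have hk' : (m : ℝ) ≤ (J + 1) * k := by exact_mod_cast hk
  generalize √(m : ℝ) = a at *
  generalize √((m : ℝ) - k) = b at *
  have hJ : (0 : ℝ) ≤ J + 1 := by positivity
  have h1 : (J + 1) * ((a - b) * (a + b)) ≤ (J + 1) * ((a - b) * (2 * a)) := by
    refine mul_le_mul_of_nonneg_left (mul_le_mul_of_nonneg_left ?_ ?_) hJ <;> linarith
  have h2 : (J + 1 : ℝ) * ((a - b) * (a + b)) = (J + 1) * k := by
    congr 1
    nlinarith
  have h3 : a * a ≤ a * (2 * (J + 1) * (a - b)) := by nlinarith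
  have h4 := le_of_mul_le_mul_left h3 (by linarith)
  nlinarith

/-- The cost of the in-place low short product beyond the main term. -/
noncomputable def lowError (J : ℕ) (D : ℝ) (M : ℕ → ℝ) (n : ℕ) : ℝ :=
  (2 * J + 1) * (2 * (J + 1)) * (√(n : ℝ) / n * M n) + D * n

/-- Here J = ⌊c⌋+2 is the least value with J + 1 > c + 2, and 2J+1 ≤ 2c+5. Time and space in size k
are those of size k + 1, because a low short product may come from a high one of size k + 1. The
excess M(n)/n per call is paid for by the square root in the potential. -/
theorem exists_low {c : ℚ} (hc : 0 ≤ c) : ∃ J N₀ : ℕ, ∃ D : ℝ, 0 ≤ D ∧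
    ∀ (p : Program K) (M : ℕ → ℝ) (s : ℕ → ℕ) (d : ℕ), Regular M →
    (∀ k, (s k : ℚ) ≤ c * (k + 1 : ℕ)) →
    (∀ k, 1 ≤ k → SolvesAt p (shortProductLow K) k (s k) ((k + 2) ^ d) (M (k + 1))) →
    ∀ n, 1 ≤ n → SolvesAt (lowProg p J N₀) (shortProductLow K) n 1 ((n + 2) ^ (d + 2))
      ((2 * (c : ℝ) + 5) * M n + lowError J D M n) := by
  have hcJ : c + 2 < (⌊c⌋₊ + 2 : ℕ) + 1 := by
    have := Nat.lt_floor_add_one c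
    push_cast
    linarith
  obtain ⟨N₀, hN₀, hthr⟩ := exists_threshold (c + 2) c (⌊c⌋₊ + 2) (by linarith) hcJ
  set J := ⌊c⌋₊ + 2 with hJ
  refine ⟨J, N₀, (2 * J + 1) + 2 * N₀, by positivity, fun p M s d hM hsc hp n hn => ?_⟩
  have hn1 : (1 : ℝ) ≤ n := by exact_mod_cast hn
  have hMn := hM.pos hn
  have hμ : 0 < M n / n := div_pos hMn (by linarith)
  have hs : ∀ m, N₀ ≤ m → 2 * ((m + J) / (J + 1)) + s ((m + J) / (J + 1)) ≤ m := by
    intro m hm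
    have h1 := hthr m hm
    have h2 := hsc ((m + J) / (J + 1))
    generalize (m + J) / (J + 1) = k at *
    have : ((2 * k + s k : ℕ) : ℚ) ≤ m := by
      push_cast at h2 ⊢
      linarith
    exact_mod_cast this
  refine (lowProg_solvesAt (Φ := fun m => (2 * J + 1) * ((M n / n + 1) * m +
    M n / n * (2 * (J + 1) * √(m : ℝ)))) hp hn hN₀ hs ?_ ?_).mono ?_
  · intro m hm hmn
    have hk1 := one_le_ceil_div (hN₀.trans hm)
    have hkm := hs m hm
    have hkc := le_mul_ceil_div m J
    generalize (m + J) / (J + 1) = k at *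
    have h1 := hM.le_mul (k := k + 1) (by omega) (by omega : k + 1 ≤ n)
    have h2 := mul_le_mul_of_nonneg_left
      (sqrt_step (m := m) (J := J) (k := k) (by omega) (by omega) hkc) hμ.le
    have hJ0 : (0 : ℝ) ≤ 2 * J + 1 := by positivity
    rw [← mul_add]
    refine mul_le_mul_of_nonneg_left ?_ hJ0
    rw [Nat.cast_sub (by omega : k ≤ m)] at *
    push_cast at h1
    linarith
  · intro m
    positivity
  · have h1 : (M n / n + 1) * n = M n + n := by
      field_simp
    have h2 : (2 * (J : ℝ) + 1) * M n ≤ (2 * c + 5) * M n := by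
      refine mul_le_mul_of_nonneg_right ?_ hMn.le
      have := two_mul_floor_le hc
      rw [hJ]
      push_cast
      linarith
    have h3 : M n / n * (2 * (J + 1) * √(n : ℝ)) = 2 * (J + 1) * (√(n : ℝ) / n * M n) := by ring
    rw [h1, h3, lowError]
    linarith

theorem lowError_isLittleO {J : ℕ} {D : ℝ} (hM : (fun n : ℕ => (n : ℝ)) =o[atTop] M) :
    lowError J D M =o[atTop] M := by
  refine IsLittleO.add ?_ (hM.const_mul_left D)
  refine IsLittleO.const_mul_left ?_ _
  have h : Tendsto (fun n : ℕ => √(n : ℝ) / n) atTop (nhds 0) := by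
    simp only [Real.sqrt_div_self']
    exact (Real.tendsto_sqrt_atTop.comp tendsto_natCast_atTop_atTop).const_div_atTop 1
  have := ((isLittleO_one_iff ℝ).2 h).mul_isBigO (isBigO_refl M atTop)
  simpa using this

/-! ### Cost of the in-place middle product -/

/-- A contraction by β towards x lowers the logarithm of the distance to x by at least 1. The
maximum with β⁻¹ keeps the logarithm at least -1, also after a last step that overshoots x. -/
theorem logb_max_add_one_le {x β u v : ℝ} (hβ : 1 < β) (hu : 1 ≤ u - x)
    (hv : v - x ≤ β⁻¹ * (u - x)) :
    Real.logb β (max (v - x) β⁻¹) + 1 ≤ Real.logb β (max (u - x) β⁻¹) := by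
  have hβ0 : 0 < β⁻¹ := by positivity
  have h1 : max (v - x) β⁻¹ ≤ β⁻¹ * (u - x) := max_le hv (le_mul_of_one_le_right hβ0.le hu)
  have h2 : Real.logb β (max (v - x) β⁻¹) ≤ Real.logb β (β⁻¹ * (u - x)) :=
    Real.logb_le_logb_of_le hβ (lt_max_of_lt_right hβ0) h1
  have h3 : Real.logb β (u - x) ≤ Real.logb β (max (u - x) β⁻¹) :=
    Real.logb_le_logb_of_le hβ (by linarith) (le_max_left _ _)
  rw [Real.logb_mul hβ0.ne' (by linarith), Real.logb_inv, Real.logb_self_eq_one hβ] at h2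
  linarith

/-- The number of windows in the in-place middle product is at most this. -/
noncomputable def windowCount (x β : ℝ) (m : ℕ) : ℝ := Real.logb β (max (m - x) β⁻¹) + 1

theorem windowCount_nonneg {x β : ℝ} (hβ : 1 < β) (m : ℕ) : 0 ≤ windowCount x β m := by
  have hβ0 : 0 < β⁻¹ := by positivity
  have h2 : Real.logb β β⁻¹ ≤ Real.logb β (max (m - x) β⁻¹) :=
    Real.logb_le_logb_of_le hβ hβ0 (le_max_right _ _)
  rw [Real.logb_inv, Real.logb_self_eq_one hβ] at h2
  rw [windowCount]
  linarith

theorem windowCount_le {x β : ℝ} (hβ : 1 < β) (hx : 0 ≤ x) {n : ℕ} (hn : 1 ≤ n) :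
    windowCount x β n ≤ Real.logb β n + 1 := by
  have hβ0 : 0 < β⁻¹ := by positivity
  have hn1 : (1 : ℝ) ≤ n := by exact_mod_cast hn
  have : Real.logb β (max (n - x) β⁻¹) ≤ Real.logb β n :=
    Real.logb_le_logb_of_le hβ (lt_max_of_lt_right hβ0)
      (max_le (by linarith) ((inv_le_one_of_one_le₀ hβ.le).trans hn1))
  rw [windowCount]
  linarith

theorem ceil_div_mul_le {n k : ℕ} (hk : 1 ≤ k) {T : ℝ} (hT : 0 ≤ T) :
    ((n + k - 1) / k : ℕ) * T ≤ (n + k) / k * T := by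
  refine mul_le_mul_of_nonneg_right (Nat.cast_div_le.trans ?_) hT
  have hk0 : (0 : ℝ) < k := by exact_mod_cast hk
  have : ((n + k - 1 : ℕ) : ℝ) ≤ n + k := by exact_mod_cast Nat.sub_le _ _
  gcongr

/-- The sizes of the windows of the in-place middle product. -/
theorem window_size {c : ℚ} (hc : 0 ≤ c) {a b : ℕ} (ha : 1 ≤ a) (hb : (b : ℚ) = (c + 2) * a) {m : ℕ}
    (hm : 2 * b ≤ m) : 1 ≤ a * m / b ∧ 2 * (a * m / b) + ⌊c * (a * m / b : ℕ)⌋₊ ≤ m ∧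
      (m : ℝ) / (c + 2) - 1 ≤ (a * m / b : ℕ) ∧ 2 * ((c : ℝ) + 2) ≤ m := by
  have ha0 : (1 : ℚ) ≤ a := by exact_mod_cast ha
  have hb2 : (c + 2) ≤ b := by nlinarith
  have hb0 : (0 : ℚ) < b := by linarith
  have hb0' : 0 < b := by exact_mod_cast hb0
  have h1 : (((a * m / b : ℕ) : ℕ) : ℚ) ≤ m / (c + 2) := by
    refine Nat.cast_div_le.trans ?_
    rw [hb, div_le_div_iff₀ (by nlinarith) (by linarith)]
    push_cast
    linarith
  have h2 : (m : ℚ) / (c + 2) - 1 ≤ (a * m / b : ℕ) := by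
    have := Nat.lt_div_mul_add (a := a * m) (b := b) hb0'
    have : ((a * m : ℕ) : ℚ) < ((a * m / b * b + b : ℕ) : ℚ) := by exact_mod_cast this
    push_cast at this
    rw [sub_le_iff_le_add, div_le_iff₀ (by linarith)]
    rw [hb] at this
    refine le_of_mul_le_mul_right ?_ (by linarith : (0 : ℚ) < a)
    nlinarith
  have hmb : 2 * (b : ℚ) ≤ m := by exact_mod_cast hm
  refine ⟨?_, ?_, ?_, ?_⟩
  · rw [Nat.le_div_iff_mul_le hb0']
    nlinarith
  · have h3 := cast_floor_mul_le hc (a * m / b)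
    generalize a * m / b = k at *
    rw [le_div_iff₀ (by linarith)] at h1
    have : ((2 * k + ⌊c * k⌋₊ : ℕ) : ℚ) ≤ m := by
      push_cast
      linarith
    exact_mod_cast this
  · have : (((m : ℚ) / (c + 2) - 1 : ℚ) : ℝ) ≤ (((a * m / b : ℕ) : ℚ) : ℝ) := Rat.cast_le.2 h2
    push_cast at this
    exact this
  · have h : 2 * (c + 2) ≤ (m : ℚ) := by linarith
    exact_mod_cast h

/-- A window costs at most (n + k)(M(n)/n + 1). The parts with k add up to at most n, and the part
with n is charged once per window, which `windowCount` tracks. -/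
theorem mid_cost_log {c : ℚ} (hc : 0 ≤ c) {a b : ℕ} (ha : 1 ≤ a) (hb : (b : ℚ) = (c + 2) * a)
    {p : Program K} {d : ℕ} (hM : Regular M)
    (hp : ∀ k, 1 ≤ k → SolvesAt p (middleProduct K) k ⌊c * k⌋₊ ((k + 2) ^ d) (M k))
    {n : ℕ} (hn : 1 ≤ n) :
    SolvesAt (midProg p a b (2 * b)) (middleProduct K) n 1 ((n + 2) ^ (d + 2))
      (M n * Real.logb (((c : ℝ) + 2) / (c + 1)) n + (2 * M n +
        (Real.log (((c : ℝ) + 2) / (c + 1)))⁻¹ * (n * Real.log n) + (2 + 4 * b) * n)) := by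
  have hcR : (0 : ℝ) ≤ c := by exact_mod_cast hc
  set β : ℝ := ((c : ℝ) + 2) / (c + 1) with hβdef
  have hβ : 1 < β := by
    rw [hβdef, lt_div_iff₀ (by linarith)]
    linarith
  have hβi : β⁻¹ = (c + 1) / (c + 2) := by rw [hβdef, inv_div]
  have hn1 : (1 : ℝ) ≤ n := by exact_mod_cast hn
  have hMn := hM.pos hn
  have hμ : 0 < M n / n := div_pos hMn (by linarith)
  have hb1 : 1 ≤ 2 * b := by
    have ha0 : (1 : ℚ) ≤ a := by exact_mod_cast ha
    have : (1 : ℚ) ≤ b := by nlinarith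
    have : 1 ≤ b := by exact_mod_cast this
    omega
  refine (midProg_solvesAt (Φ := fun m => (M n / n + 1) * (n * windowCount (c + 2) β m + m)) hp hn
    hb1 (fun m hm => (window_size hc ha hb hm).1) (fun m hm => (window_size hc ha hb hm).2.1)
    ?_ ?_).mono ?_
  · intro m hm hmn
    obtain ⟨hk1, hks, hkl, hm2⟩ := window_size hc ha hb hm
    generalize a * m / b = k at *
    have hkm : k ≤ m := by omega
    have hk0 : (0 : ℝ) < k := by exact_mod_cast hk1
    have h1 := hM.le_mul hk1 (hkm.trans hmn)
    have h2 := ceil_div_mul_le (n := n) hk1 (T := M k + k) (by linarith [hM.pos hk1])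
    have h3 : ((n : ℝ) + k) / k * (M k + k) ≤ (n + k) * (M n / n + 1) := by
      rw [div_mul_eq_mul_div, div_le_iff₀ hk0, mul_assoc]
      refine mul_le_mul_of_nonneg_left ?_ (by linarith)
      linarith
    have h4 : windowCount (c + 2) β (m - k) + 1 ≤ windowCount (c + 2) β m := by
      -- Rounding gives m - k ≤ β⁻¹·m + 1; the fixed point of this map is c + 2, hence the choice of
      -- `x`.
      have := logb_max_add_one_le (x := c + 2) (u := m) (v := (m - k : ℕ)) hβ (by linarith) ?_
      · rw [windowCount, windowCount]
        linarith
      · rw [hβi, Nat.cast_sub hkm, div_mul_eq_mul_div, le_div_iff₀ (by linarith)]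
        rw [sub_le_iff_le_add, div_le_iff₀ (by linarith)] at hkl
        linarith
    have h5 : (n : ℝ) * (windowCount (c + 2) β (m - k) + 1) ≤ n * windowCount (c + 2) β m :=
      mul_le_mul_of_nonneg_left h4 (by linarith)
    have h6 := mul_le_mul_of_nonneg_left h5 (by linarith : 0 ≤ M n / n + 1)
    rw [Nat.cast_sub hkm]
    linarith
  · intro m
    have := windowCount_nonneg (x := c + 2) hβ m
    positivity
  · have h1 := windowCount_le (x := c + 2) hβ (by linarith) hn
    have h2 : (n : ℝ) * windowCount (c + 2) β n ≤ n * (Real.logb β n + 1) :=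
      mul_le_mul_of_nonneg_left h1 (by linarith)
    have h3 : (M n / n + 1) * (n * windowCount (c + 2) β n + n) ≤
        (M n / n + 1) * (n * (Real.logb β n + 1) + n) :=
      mul_le_mul_of_nonneg_left (by linarith) (by linarith)
    have h4 : (M n / n + 1) * (n * (Real.logb β n + 1) + n) =
        (M n + n) * (Real.logb β n + 2) := by
      field_simp
      ring
    have h5 : (Real.log β)⁻¹ * (n * Real.log n) = n * Real.logb β n := by
      rw [Real.logb]
      ring
    rw [h5]
    push_cast
    linarith

/-- With δ = γ - 1, superlinearity bounds the cost of the window at m by a constant times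
M(n)·(m/n)^δ. As m shrinks at least by the factor θ in each round, these costs are dominated by a
geometric series of ratio θ^δ < 1. -/
theorem mid_cost_superlinear {c : ℚ} (hc : 0 ≤ c) {a b : ℕ} (ha : 1 ≤ a)
    (hb : (b : ℚ) = (c + 2) * a) (hM : Regular M) (hs : PolynomiallySuperlinear M) :
    ∃ D : ℝ, ∀ (p : Program K) (d : ℕ),
    (∀ k, 1 ≤ k → SolvesAt p (middleProduct K) k ⌊c * k⌋₊ ((k + 2) ^ d) (M k)) → ∀ n, 1 ≤ n →
      SolvesAt (midProg p a b (2 * b)) (middleProduct K) n 1 ((n + 2) ^ (d + 2)) (D * M n) := by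
  obtain ⟨γ, C, hγ, hC⟩ := hs
  have hcR : (0 : ℝ) ≤ c := by exact_mod_cast hc
  have hM1 := hM.pos le_rfl
  have hC0 : 0 < C := by
    have := hC 1 1 le_rfl le_rfl
    simp only [Nat.cast_one, Real.one_rpow, div_one] at this
    by_contra h
    nlinarith
  set δ := γ - 1 with hδ
  have hδ0 : 0 < δ := by linarith
  -- Half of m/(c+2) is given up to absorb the rounding of k, as m ≥ 2(c+2).
  set θ : ℝ := 1 - 1 / (2 * (c + 2)) with hθ
  have hθ1 : θ < 1 := by
    have : (0 : ℝ) < 1 / (2 * (c + 2)) := by positivity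
    linarith
  have hθ0 : 0 ≤ θ := by
    have : (1 : ℝ) / (2 * (c + 2)) ≤ 1 := by
      rw [div_le_one (by linarith)]
      linarith
    linarith
  have hθδ : θ ^ δ < 1 := Real.rpow_lt_one hθ0 hθ1 hδ0
  set G : ℝ := 2 * C * (1 + 1 / M 1) with hG
  have hG0 : 0 ≤ G := by positivity
  have hb1 : 1 ≤ 2 * b := by
    have ha0 : (1 : ℚ) ≤ a := by exact_mod_cast ha
    have : (1 : ℚ) ≤ b := by nlinarith
    have : 1 ≤ b := by exact_mod_cast this
    omega
  refine ⟨G * (1 - θ ^ δ)⁻¹ + 4 * b / M 1, fun p d hp n hn => ?_⟩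
  have hn1 : (1 : ℝ) ≤ n := by exact_mod_cast hn
  have hMn := hM.pos hn
  have hN0 : 0 < (n : ℝ) ^ δ := by positivity
  have hsplit : ∀ k : ℕ, 1 ≤ k → (k : ℝ) ^ γ = (k : ℝ) ^ δ * k := by
    intro k hk
    have hk0 : (0 : ℝ) < k := by exact_mod_cast hk
    rw [show γ = δ + 1 by linarith, Real.rpow_add hk0, Real.rpow_one]
  -- The comparison of sizes 1 and n shows that the linear costs are dominated as well.
  have hnM : (n : ℝ) ≤ C * (1 / M 1) * (M n / (n : ℝ) ^ δ) := by
    have := hC 1 n le_rfl hn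
    rw [Nat.cast_one, Real.one_rpow, div_one, hsplit n hn] at this
    have h : C * (1 / M 1) * (M n / (n : ℝ) ^ δ) =
        C * (M n / ((n : ℝ) ^ δ * n)) * n / M 1 := by
      field_simp
    rw [h, le_div_iff₀ hM1]
    nlinarith
  refine (midProg_solvesAt (Φ := fun m => G * (1 - θ ^ δ)⁻¹ * (M n / (n : ℝ) ^ δ) * (m : ℝ) ^ δ)
    hp hn hb1 (fun m hm => (window_size hc ha hb hm).1) (fun m hm => (window_size hc ha hb hm).2.1)
    ?_ ?_).mono ?_
  · intro m hm hmn
    obtain ⟨hk1, hks, hkl, hm2⟩ := window_size hc ha hb hm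
    generalize a * m / b = k at *
    have hkm : k ≤ m := by omega
    have hk0 : (0 : ℝ) < k := by exact_mod_cast hk1
    have hkm' : (k : ℝ) ≤ m := by exact_mod_cast hkm
    have hmn' : (m : ℝ) ≤ n := by exact_mod_cast hmn
    have hm1 : (1 : ℝ) ≤ (m : ℝ) ^ δ := Real.one_le_rpow (by linarith) hδ0.le
    have hmk : ((m - k : ℕ) : ℝ) ≤ θ * m := by
      rw [Nat.cast_sub hkm, hθ]
      have h1 : (m : ℝ) / (2 * (c + 2)) ≥ 1 := by
        rw [ge_iff_le, one_le_div (by linarith)]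
        exact hm2
      have h2 : (m : ℝ) / (c + 2) = m / (2 * (c + 2)) + m / (2 * (c + 2)) := by
        field_simp
        ring
      have h3 : (1 - 1 / (2 * ((c : ℝ) + 2))) * m = m - m / (2 * (c + 2)) := by ring
      rw [h3]
      linarith
    have hmkδ : ((m - k : ℕ) : ℝ) ^ δ ≤ θ ^ δ * (m : ℝ) ^ δ := by
      rw [← Real.mul_rpow hθ0 (by linarith)]
      exact Real.rpow_le_rpow (Nat.cast_nonneg _) hmk hδ0.le
    have h1 : M k / k ≤ C * (M n / (n : ℝ) ^ δ) / n * (m : ℝ) ^ δ := by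
      have h := hC k n hk1 (hkm.trans hmn)
      rw [hsplit k hk1, hsplit n hn, div_le_iff₀ (by positivity)] at h
      have h' : C * (M n / ((n : ℝ) ^ δ * n)) * ((k : ℝ) ^ δ * k) =
          C * (M n / (n : ℝ) ^ δ) / n * (k : ℝ) ^ δ * k := by
        field_simp
      rw [h', ← div_le_iff₀ hk0] at h
      refine h.trans (mul_le_mul_of_nonneg_left ?_ (by positivity))
      exact Real.rpow_le_rpow hk0.le hkm' hδ0.le
    have h2 := ceil_div_mul_le (n := n) hk1 (T := M k + k) (by linarith [hM.pos hk1])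
    have h3 : ((n : ℝ) + k) / k * (M k + k) ≤ 2 * n * (M k / k + 1) := by
      have : ((n : ℝ) + k) / k * (M k + k) = (n + k) * (M k / k + 1) := by
        field_simp
      rw [this]
      refine mul_le_mul_of_nonneg_right (by linarith) ?_
      have := div_pos (hM.pos hk1) hk0
      linarith
    have h4 : 2 * n * (M k / k + 1) ≤ G * (M n / (n : ℝ) ^ δ) * (m : ℝ) ^ δ := by
      have e1 : (n : ℝ) * (M k / k) ≤ C * (M n / (n : ℝ) ^ δ) * (m : ℝ) ^ δ := by
        refine (mul_le_mul_of_nonneg_left h1 (by linarith)).trans (le_of_eq ?_)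
        field_simp
      have e2 : (n : ℝ) ≤ C * (1 / M 1) * (M n / (n : ℝ) ^ δ) * (m : ℝ) ^ δ :=
        hnM.trans (le_mul_of_one_le_right (by positivity) hm1)
      have e3 : G * (M n / (n : ℝ) ^ δ) * (m : ℝ) ^ δ =
          2 * (C * (M n / (n : ℝ) ^ δ) * (m : ℝ) ^ δ) +
          2 * (C * (1 / M 1) * (M n / (n : ℝ) ^ δ) * (m : ℝ) ^ δ) := by
        rw [hG]
        ring
      rw [e3]
      linarith
    have hH : 0 ≤ G * (M n / (n : ℝ) ^ δ) := by positivity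
    have h1θ : 0 < 1 - θ ^ δ := by linarith
    have h5 : (m : ℝ) ^ δ + (1 - θ ^ δ)⁻¹ * ((m - k : ℕ) : ℝ) ^ δ ≤
        (1 - θ ^ δ)⁻¹ * (m : ℝ) ^ δ := by
      have e := mul_le_mul_of_nonneg_left hmkδ (inv_nonneg.2 h1θ.le)
      have e' : (1 - θ ^ δ)⁻¹ * (m : ℝ) ^ δ =
          (m : ℝ) ^ δ + (1 - θ ^ δ)⁻¹ * (θ ^ δ * (m : ℝ) ^ δ) := by
        field_simp
        ring
      rw [e']
      linarith
    have h6 := mul_le_mul_of_nonneg_left h5 hH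
    linarith
  · intro m
    have h1θ : 0 < 1 - θ ^ δ := by linarith
    positivity
  · have h1 := hM.cast_le hn
    have h2 : G * (1 - θ ^ δ)⁻¹ * (M n / (n : ℝ) ^ δ) * (n : ℝ) ^ δ =
        G * (1 - θ ^ δ)⁻¹ * M n := by
      field_simp
    have h3 : 4 * (b : ℝ) * n ≤ 4 * b * (M n / M 1) :=
      mul_le_mul_of_nonneg_left h1 (by positivity)
    rw [h2]
    push_cast
    have h4 : 4 * (b : ℝ) * (M n / M 1) = 4 * b / M 1 * M n := by ring
    linarith

/-- The in-place high short product, from an in-place low short product program. -/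
def highOfLow (p : Program K) : Program K :=
  .ifLt (.lit 1) (.reg 0)
    (reverseProg p (fun e => e - .lit 1) (fun e => e - .lit 1) (fun e => e - .lit 2)) .skip

theorem highOfLow_solvesAt {p : Program K} {n s B W : ℕ} {t : ℝ} (ht : 0 ≤ t) (hn : 1 ≤ n)
    (hp : 2 ≤ n → SolvesAt p (shortProductLow K) (n - 1) s B t) (hB : B ≤ W) (hnW : n < W) :
    SolvesAt (highOfLow p) (shortProductHigh K) n s W t := by
  intro f g h hf hg hh out₀ work₀ hout
  refine Run.ifLt (fun hlt => ?_) (fun hlt => ?_)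
  · have hn2 : 1 < n := by simpa [IExp.eval] using hlt
    exact reverseProg_shortProductHigh (hp hn2) le_rfl hn2 hB hnW f g h hf hg hh out₀ work₀ hout
  · have hn1 : n ≤ 1 := by simpa [IExp.eval] using hlt
    refine (Run.skip (Q := fun σ' => ∀ i < (shortProductHigh K).outSize n, σ'.out i =
      ((shortProductHigh K).result n f g h).coeff i) ?_).mono ht fun _ h => h
    intro i hi
    change i < n - 1 at hi
    omega

/-! ### Assembly of the three parts -/

theorem lt_add_two_pow (n d : ℕ) : n < (n + 2) ^ (d + 2) := by
  have : (n + 2) ^ 1 ≤ (n + 2) ^ (d + 2) := Nat.pow_le_pow_right (by omega) (by omega)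
  rw [pow_one] at this
  omega

theorem half_additive_in_place (P : Program K) {c : ℚ} (hc : 0 ≤ c) :
    ∀ A ∈ ({halfAdditiveLow K, halfAdditiveHigh K} : Set (Problem K)),
      ∃ (Q : Program K) (s : ℕ), (P.RingOnly → Q.RingOnly) ∧
        ∀ M : ℕ → ℝ, Regular M → (fun n : ℕ => (n : ℝ)) =o[atTop] M →
          Solves P (fullProduct K) (fun n => ⌊c * n⌋₊) M →
          ∃ e : ℕ → ℝ, e =o[atTop] M ∧
            Solves Q A (fun _ => s) (fun n => (2 * (c : ℝ) + 7) * M n + e n) := by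
  obtain ⟨J, N₀, D, h⟩ := exists_halfAdd (K := K) hc
  rintro A (rfl | rfl)
  · refine ⟨halfAddProg P J N₀, 1, fun hP => ringOnly_halfAddProg hP _ _, fun M hM hnM hP => ?_⟩
    obtain ⟨d, hd⟩ := solves_iff.1 hP
    exact ⟨fun n => D * n, hnM.const_mul_left D, solves_iff.2 ⟨d + 2, h P M d hM hd⟩⟩
  · refine ⟨reverseProg (halfAddProg P J N₀) (fun e => e) (fun e => e - .lit 1)
      (fun e => .lit 2 * e - .lit 2), 1,
      fun hP => ringOnly_reverseProg (ringOnly_halfAddProg hP _ _) _ _ _, fun M hM hnM hP => ?_⟩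
    obtain ⟨d, hd⟩ := solves_iff.1 hP
    exact ⟨fun n => D * n, hnM.const_mul_left D, solves_iff.2 ⟨d + 2, fun n hn =>
      reverseProg_halfAdditiveHigh (h P M d hM hd n hn) hn le_rfl (lt_add_two_pow n d)⟩⟩

/-- The high case reverses twice: the given program becomes a low one of size one less, is made
in-place, and the result is reversed back, which restores the size. So the leading constant is
unaffected. -/
theorem short_product_in_place (P : Program K) {c : ℚ} (hc : 0 ≤ c) :
    ∀ A ∈ ({shortProductLow K, shortProductHigh K} : Set (Problem K)),
      ∃ (Q : Program K) (s : ℕ), (P.RingOnly → Q.RingOnly) ∧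
        ∀ M : ℕ → ℝ, Regular M → (fun n : ℕ => (n : ℝ)) =o[atTop] M →
          Solves P A (fun n => ⌊c * n⌋₊) M →
          ∃ e : ℕ → ℝ, e =o[atTop] M ∧
            Solves Q A (fun _ => s) (fun n => (2 * (c : ℝ) + 5) * M n + e n) := by
  obtain ⟨J, N₀, D, hD, h⟩ := exists_low (K := K) hc
  have hcR : (0 : ℝ) ≤ c := by exact_mod_cast hc
  rintro A (rfl | rfl)
  · refine ⟨lowProg P J N₀, 1, fun hP => ringOnly_lowProg hP _ _, fun M hM hnM hP => ?_⟩
    obtain ⟨d, hd⟩ := solves_iff.1 hP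
    refine ⟨lowError J D M, lowError_isLittleO hnM, solves_iff.2 ⟨d + 2,
      h P M (fun n => ⌊c * n⌋₊) d hM (fun k => ?_) fun k hk =>
        (hd k hk).mono (hM.mono hk (Nat.le_succ k))⟩⟩
    refine (cast_floor_mul_le hc k).trans (mul_le_mul_of_nonneg_left ?_ hc)
    exact_mod_cast Nat.le_succ k
  · refine ⟨highOfLow (lowProg (reverseProg P (fun e => e + .lit 1) (fun e => e)
      (fun e => e - .lit 1)) J N₀), 1,
      fun hP => ⟨ringOnly_reverseProg (ringOnly_lowProg (ringOnly_reverseProg hP _ _ _) _ _) _ _ _,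
        trivial⟩, fun M hM hnM hP => ?_⟩
    obtain ⟨d, hd⟩ := solves_iff.1 hP
    have hlow := h (reverseProg P (fun e => e + .lit 1) (fun e => e) (fun e => e - .lit 1)) M
      (fun n => ⌊c * (n + 1 : ℕ)⌋₊) (2 * d + 1) hM (fun k => cast_floor_mul_le hc (k + 1))
      fun k hk => reverseProg_shortProductLow (hd (k + 1) (by omega)) le_rfl hk ?_ ?_
    · have herr : ∀ n, 1 ≤ n → 0 ≤ lowError J D M n := by
        intro n hn
        have := hM.pos hn
        rw [lowError]
        positivity
      refine ⟨fun n => lowError J D M (n - 1), ?_, solves_iff.2 ⟨2 * d + 1 + 2, fun n hn => ?_⟩⟩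
      · refine ((lowError_isLittleO hnM).comp_tendsto (tendsto_sub_atTop_nat 1)).trans_isBigO ?_
        refine IsBigO.of_bound 1 ((eventually_ge_atTop 2).mono fun n hn => ?_)
        have h1 := hM.pos (n := n - 1) (by omega)
        rw [one_mul, Function.comp_apply, Real.norm_of_nonneg h1.le,
          Real.norm_of_nonneg (hM.pos (by omega)).le]
        exact hM.mono (by omega) (by omega)
      · refine highOfLow_solvesAt ?_ hn (fun hn2 => (hlow (n - 1) (by omega)).mono ?_)
          (Nat.pow_le_pow_left (by omega) _) (lt_add_two_pow n _)
        · have hMn := hM.pos hn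
          have : 0 ≤ lowError J D M (n - 1) := by
            -- Nothing is known about the sign of `M 0`; for n = 1 the error term is 0 by the
            -- factors √0/0 and 0.
            rcases Nat.lt_or_ge n 2 with hn2 | hn2
            · have : n - 1 = 0 := by omega
              simp [this, lowError]
            · exact herr _ (by omega)
          positivity
        · have := hM.mono (k := n - 1) (n := n) (by omega) (by omega)
          gcongr
    · calc (k + 1 + 2) ^ d ≤ ((k + 2) ^ 2) ^ d := Nat.pow_le_pow_left (by nlinarith) d
        _ = (k + 2) ^ (2 * d) := by rw [pow_mul]
        _ ≤ (k + 2) ^ (2 * d + 1) := Nat.pow_le_pow_right (by omega) (by omega)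
    · have : (k + 2) ^ 1 ≤ (k + 2) ^ (2 * d + 1) := Nat.pow_le_pow_right (by omega) (by omega)
      rw [pow_one] at this
      omega

theorem isBigO_add_mul_log (hM : Regular M) {A B C : ℝ} (hA : 0 ≤ A) (hB : 0 ≤ B) (hC : 0 ≤ C) :
    (fun n : ℕ => A * M n + B * (n * Real.log n) + C * n) =O[atTop]
      (fun n : ℕ => M n + n * Real.log n) := by
  refine IsBigO.of_bound (A + B + C / M 1) ((eventually_ge_atTop 1).mono fun n hn => ?_)
  have hM1 := hM.pos le_rfl
  have hMn := hM.pos hn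
  have hn1 : (1 : ℝ) ≤ n := by exact_mod_cast hn
  have hlog : 0 ≤ n * Real.log n := mul_nonneg (by linarith) (Real.log_nonneg hn1)
  have h1 : C * n ≤ C / M 1 * M n := by
    have := mul_le_mul_of_nonneg_left (hM.cast_le hn) hC
    rwa [← mul_div_assoc, mul_comm C (M n), mul_div_assoc, mul_comm (M n)] at this
  have h2 : 0 ≤ C / M 1 := by positivity
  rw [Real.norm_of_nonneg (by positivity), Real.norm_of_nonneg (by positivity)]
  nlinarith [mul_nonneg hA hlog, mul_nonneg hB hMn.le, mul_nonneg h2 hlog]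

theorem middle_product_in_place (P : Program K) {c : ℚ} (hc : 0 ≤ c) :
    ∃ (Q : Program K) (s : ℕ), (P.RingOnly → Q.RingOnly) ∧
      ∀ M : ℕ → ℝ, Regular M →
        Solves P (middleProduct K) (fun n => ⌊c * n⌋₊) M →
        (∃ e : ℕ → ℝ,
          e =O[atTop] (fun n : ℕ => M n + n * Real.log n) ∧
          ((fun n : ℕ => n * Real.log n) =O[atTop] M → e =O[atTop] M) ∧
          Solves Q (middleProduct K) (fun _ => s)
            (fun n => M n * Real.logb (((c : ℝ) + 2) / ((c : ℝ) + 1)) n + e n)) ∧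
        (PolynomiallySuperlinear M →
          ∃ T : ℕ → ℝ, T =O[atTop] M ∧ Solves Q (middleProduct K) (fun _ => s) T) := by
  have hcR : (0 : ℝ) ≤ c := by exact_mod_cast hc
  have ha : 1 ≤ c.den := c.pos
  -- The machine computes with integer indices only; writing c + 2 as b/a, the window size ⌊m/(c+2)⌋
  -- becomes ⌊a·m/b⌋.
  have hb : ((c.num.toNat + 2 * c.den : ℕ) : ℚ) = (c + 2) * c.den := by
    have h1 : ((c.num.toNat : ℕ) : ℚ) = c.num := by
      exact_mod_cast Int.toNat_of_nonneg (Rat.num_nonneg.2 hc)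
    push_cast
    rw [h1, add_mul, Rat.mul_den_eq_num]
  generalize c.den = a at *
  generalize c.num.toNat + 2 * a = b at *
  refine ⟨midProg P a b (2 * b), 1, fun hP => ringOnly_midProg hP _ _ _, fun M hM hP => ?_⟩
  obtain ⟨d, hd⟩ := solves_iff.1 hP
  have hlog : 0 ≤ (Real.log (((c : ℝ) + 2) / (c + 1)))⁻¹ := by
    refine inv_nonneg.2 (Real.log_nonneg ?_)
    rw [le_div_iff₀ (by linarith)]
    linarith
  have hO := isBigO_add_mul_log hM (A := 2) (C := 2 + 4 * b) (by norm_num) hlog (by positivity)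
  refine ⟨⟨_, hO, fun h => hO.trans ((isBigO_refl M atTop).add h), solves_iff.2 ⟨d + 2,
    fun n hn => mid_cost_log hc ha hb hM hd hn⟩⟩, fun hs => ?_⟩
  obtain ⟨D, hD⟩ := mid_cost_superlinear (K := K) hc ha hb hM hs
  exact ⟨fun n => D * M n, (isBigO_refl M atTop).const_mul_left D, solves_iff.2 ⟨d + 2, hD P d hd⟩⟩

end AlgRAM

theorem theorem2 {K : Type*} [Field K] (P : Program K) (c : ℚ) (hc : 0 ≤ c) :
    -- full product algorithm to in-place (low-order or high-order) half-additive full product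
    (∀ A ∈ ({halfAdditiveLow K, halfAdditiveHigh K} : Set (Problem K)),
      ∃ (Q : Program K) (s : ℕ), (P.RingOnly → Q.RingOnly) ∧
        ∀ M : ℕ → ℝ, Regular M → (fun n : ℕ => (n : ℝ)) =o[atTop] M →
          Solves P (fullProduct K) (fun n => ⌊c * n⌋₊) M →
          ∃ e : ℕ → ℝ, e =o[atTop] M ∧
            Solves Q A (fun _ => s) (fun n => (2 * (c : ℝ) + 7) * M n + e n)) ∧
    -- (low or high) short product algorithm to in-place algorithm for the same problem
    (∀ A ∈ ({shortProductLow K, shortProductHigh K} : Set (Problem K)),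
      ∃ (Q : Program K) (s : ℕ), (P.RingOnly → Q.RingOnly) ∧
        ∀ M : ℕ → ℝ, Regular M → (fun n : ℕ => (n : ℝ)) =o[atTop] M →
          Solves P A (fun n => ⌊c * n⌋₊) M →
          ∃ e : ℕ → ℝ, e =o[atTop] M ∧
            Solves Q A (fun _ => s) (fun n => (2 * (c : ℝ) + 5) * M n + e n)) ∧
    -- middle product algorithm to in-place middle product algorithm
    (∃ (Q : Program K) (s : ℕ), (P.RingOnly → Q.RingOnly) ∧
      ∀ M : ℕ → ℝ, Regular M →
        Solves P (middleProduct K) (fun n => ⌊c * n⌋₊) M →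
        (∃ e : ℕ → ℝ,
          e =O[atTop] (fun n : ℕ => M n + n * Real.log n) ∧
          ((fun n : ℕ => n * Real.log n) =O[atTop] M → e =O[atTop] M) ∧
          Solves Q (middleProduct K) (fun _ => s)
            (fun n => M n * Real.logb (((c : ℝ) + 2) / ((c : ℝ) + 1)) n + e n)) ∧
        (PolynomiallySuperlinear M →
          ∃ T : ℕ → ℝ, T =O[atTop] M ∧ Solves Q (middleProduct K) (fun _ => s) T)) :=
  ⟨half_additive_in_place P hc, short_product_in_place P hc, middle_product_in_place P hc⟩
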